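/- Let $P\subset\mathbb R^d$ and $Q\subset\mathbb R^e$ be finite point sets, each containing the origin $0$ and having $0$ in the interior of its convex hull. Their free sum is $P\oplus Q=(P\times\{0\})\cup(\{0\}\times Q)\subset\mathbb R^{d+e}$. A triangulation of a finite point set $A$ is a geometric simplicial complex whose vertices belong to $A$ (not all points need be used) and whose simplices cover $\operatorname{conv}A$; $\Delta^{=k}$ denotes its set of $k$-simplices. For a triangulation $\Delta$, $\operatorname{st}_\Delta(0)$ is the closed star of the minimal face containing $0$, and $\Delta|_S$ is the set of simplices of $\Delta$ contained in $S$. *Webs of stars.* For full-dimensional simplices put $\sigma\preceq\tau$ if $\sigma=\tau$, or if for every hyperplane weakly separating $\sigma$ from $\tau$ the simplex $\sigma$ lies in the same closed half-space as $0$, and some hyperplane not through $0$ weakly separates $\sigma$ from $\tau$. A set $S$ is strictly star-shaped with respect to $0$ if $0\in S$ and $[0,y]\subseteq\operatorname{relint}(S)\cup\{y\}$ for all $y\in S$. For a triangulation $\Delta$ in $\mathbb R^k$ let $\mathcal B_\Delta$ consist of $\emptyset$ and all subcomplexes of $\Delta$ that are $k$-dimensional balls and strictly star-shaped with respect to $0$.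 For triangulations $\Delta_P$ of $P$ and $\Delta_Q$ of $Q$, a web of stars in $\Delta_Q$ with respect to $\Delta_P$ is a map $\alpha:\Delta_P^{=d}\to\mathcal B_{\Delta_Q}$ such that $\sigma\preceq\tau$ implies $\alpha(\sigma)\subseteq\alpha(\tau)$. Webs of stars $\alpha:\Delta_P^{=d}\to\mathcal B_{\Delta_Q}$ and $\beta:\Delta_Q^{=e}\to\mathcal B_{\Delta_P}$ are compatible if $\sigma\in\beta(\tau)\iff\tau\notin\alpha(\sigma)$ for all $\sigma\in\Delta_P^{=d}$, $\tau\in\Delta_Q^{=e}$. *Sum-triangulations.* For a simplex $\sigma$ of a triangulation $\Delta$ of $P\oplus Q$ let $\sigma_P$ (resp. $\sigma_Q$) be the convex hull of the vertices of $\sigma$ in $P\times\{0\}$ (resp. $\{0\}\times Q$), viewed in $\mathbb R^d$ (resp. $\mathbb R^e$); conversely $\sigma_P\oplus\sigma_Q=\operatorname{conv}\big((\sigma_P\times\{0\})\cup(\{0\}\times\sigma_Q)\big)$. The triangulation $\Delta$ is the $P$-sum-triangulation of $\Delta_P,\Delta_Q$ with respect to $\alpha,\beta$ if $\alpha,\beta$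 is a compatible pair of webs of stars such that 1. $\alpha(\sigma)=\operatorname{st}_{\Delta_Q}(0)$ for every $d$-simplex $\sigma\in\operatorname{st}_{\Delta_P}(0)$, and 2. $\Delta^{=d+e}=\bigcup_{\sigma\in\Delta_P^{=d}}\{\sigma\oplus\rho:\rho\in\partial\alpha(\sigma)^{=e-1}\}\ \cup\ \bigcup_{\tau\in\Delta_Q^{=e},\,\beta(\tau)\neq\emptyset}\{\rho\oplus\tau:\rho\in\partial\beta(\tau)^{=d-1}\}$. (The boundary of a $0$-dimensional ball has the empty simplex as its only simplex, of dimension $-1$.) A $P$-sum-triangulation of $\Delta_P,\Delta_Q$ is one with respect to some $\alpha,\beta$; a $Q$-sum-triangulation is defined by exchanging the roles of $P$ and $Q$. *Induced triangulations.* The origin lies in the $P$-part of $\Delta$ if $0\in\sigma_P$ for every $(d+e)$-simplex $\sigma\in\Delta$ containing $0$; similarly for $Q$. Put $\tilde\Delta_P=\{\sigma_P:\sigma\in\Delta\}$ and $\tilde\Delta_Q=\{\sigma_Q:\sigma\in\Delta\}$. If the origin lies in the $P$-part, triangulations $\Delta_P$ of $P$ and $\Delta_Q$ of $Q$ are called induced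 by $\Delta$ if $\Delta_P=\tilde\Delta_P$ and either $0$ is a vertex of $\Delta$ and $\Delta_Q=\tilde\Delta_Q$, or $0$ is not a vertex of $\Delta$ and $\Delta_Q$ has $0$ as a vertex and contains $\tilde\Delta_Q$ (so the part of $\operatorname{conv}Q$ not covered by $\tilde\Delta_Q$ is triangulated arbitrarily with $0$ as a vertex). The pair is called conically induced if moreover every simplex of $\Delta_Q$ lies in $\tilde\Delta_Q$ or in $\operatorname{st}_{\Delta_Q}(0)$. For a simplex $\sigma$ let $\bar\Lambda(\sigma)=\{0\}\cup\{\lambda x:\lambda\in[0,1],\ x\in\operatorname{lk}_\Delta(\sigma)\}$ be the cone with apex $0$ over its link in $\Delta$, the link of a simplex that does not belong to $\Delta$ being empty. **Theorem.** Let $\Delta$ be any triangulation of $P\oplus Q$. Then the origin lies in the $P$-part or in the $Q$-part of $\Delta$. Suppose that it lies in the $P$-part. Then conically induced $\Delta_P,\Delta_Q$ exist. For all induced $\Delta_P,\Delta_Q$, the maps $$\alpha(\sigma_P)=\Delta_Q|_{\bar\Lambda(\sigma_P)},\qquad \beta(\sigma_Q)=\begin{cases}\emptyset&\text{if }0\text{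 is a vertex of }\sigma_Q,\\ \Delta_P|_{\bar\Lambda(\sigma_Q)}&\text{otherwise}\end{cases}$$ on $\Delta_P^{=d}$ and $\Delta_Q^{=e}$ form a compatible pair of webs of stars and satisfy (2). If $\Delta_P,\Delta_Q$ are conically induced, then (1) holds too, so that $\Delta$ is the $P$-sum-triangulation of $\Delta_P,\Delta_Q$ with respect to $\alpha,\beta$. If the origin lies in the $Q$-part, the same holds with the roles of $P$ and $Q$ interchanged. In particular, every triangulation of $P\oplus Q$ is a $P$-sum-triangulation or a $Q$-sum-triangulation of some triangulations of $P$ and $Q$. -/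

import Mathlib

open Geometry Module

namespace FreeSum

/-! ### Triangulations, stars, links, restrictions

A simplex is represented by its finite vertex set; a complex by a `Geometry.SimplicialComplex`,
whose faces are the nonempty simplices; a subcomplex by its set of (nonempty) faces. -/

section Complexes

variable {V : Type*} [AddCommGroup V] [Module ℝ V]

/-- `K` is a triangulation of the point configuration `A`: all vertices are points of `A` (not every
point of `A` has to be used), and `K` covers the convex hull of `A`. -/
def IsTriangulation (A : Set V) (K : SimplicialComplex ℝ V) : Prop :=
  (∀ s ∈ K.faces, (s : Set V) ⊆ A) ∧ K.space = convexHull ℝ A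

/-- The full-dimensional simplices of `K`. -/
def topFaces (K : SimplicialComplex ℝ V) : Set (Finset V) :=
  {s | s ∈ K.faces ∧ s.card = finrank ℝ V + 1}

/-- The underlying point set of a family of simplices. -/
def body (B : Set (Finset V)) : Set V :=
  ⋃ s ∈ B, convexHull ℝ (s : Set V)

/-- The closed star of the point `x`: all simplices of `K` containing `x` (equivalently, containing
the minimal face around `x`), and all their faces. -/
def starAt (K : SimplicialComplex ℝ V) (x : V) : Set (Finset V) :=
  {t | t.Nonempty ∧ ∃ s ∈ K.faces, x ∈ convexHull ℝ (s : Set V) ∧ t ⊆ s}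

/-- The link of `s` in `K`: the simplices in the closed star of `s` that are disjoint from `s`. -/
def link (K : SimplicialComplex ℝ V) (s : Finset V) : Set (Finset V) :=
  {t | t.Nonempty ∧ Disjoint t s ∧ ∃ r ∈ K.faces, s ⊆ r ∧ t ⊆ r}

/-- The cone `0 ⋆ lk(s)` over the link of `s` with apex the origin, as a subset of the ambient
space. It is `{0}` if the link has no nonempty simplex. -/
def linkCone (K : SimplicialComplex ℝ V) (s : Finset V) : Set V :=
  {0} ∪ {z | ∃ c : ℝ, 0 ≤ c ∧ c ≤ 1 ∧ ∃ x ∈ body (link K s), z = c • x}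

/-- The restriction of `K` to `S`: all simplices of `K` contained in `S`. -/
def restrict (K : SimplicialComplex ℝ V) (S : Set V) : Set (Finset V) :=
  {s | s ∈ K.faces ∧ convexHull ℝ (s : Set V) ⊆ S}

/-- The facets (simplices of codimension one, possibly the empty simplex when the space is
`0`-dimensional) of the boundary complex of a full-dimensional ball `B`: those contained in
exactly one full-dimensional simplex of `B`. -/
def boundaryFacets (B : Set (Finset V)) : Set (Finset V) :=
  {r | r.card = finrank ℝ V ∧ ∃! s, s ∈ B ∧ s.card = finrank ℝ V + 1 ∧ r ⊆ s}

/-- The stabbing order on full-dimensional simplices. A hyperplane is `{f = c}` with `f ≠ 0`; it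
separates `s` from `t` (not necessarily strictly) if `f ≤ c` on `s` and `c ≤ f` on `t`; the origin
lies on the side of `s` iff `0 ≤ c`; and the hyperplane is strictly affine iff `c ≠ 0`. -/
def Stabs (s t : Finset V) : Prop :=
  s = t ∨
    ((∀ (f : V →ₗ[ℝ] ℝ) (c : ℝ), f ≠ 0 →
        (∀ x ∈ convexHull ℝ (s : Set V), f x ≤ c) →
        (∀ x ∈ convexHull ℝ (t : Set V), c ≤ f x) → 0 ≤ c) ∧
      ∃ (f : V →ₗ[ℝ] ℝ) (c : ℝ), f ≠ 0 ∧ c ≠ 0 ∧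
        (∀ x ∈ convexHull ℝ (s : Set V), f x ≤ c) ∧
        (∀ x ∈ convexHull ℝ (t : Set V), c ≤ f x))

end Complexes

/-! ### Strictly star-shaped balls and webs of stars -/

section Webs

variable {E : Type*} [NormedAddCommGroup E] [NormedSpace ℝ E]
variable {F : Type*} [NormedAddCommGroup F] [NormedSpace ℝ F]

/-- `S` is strictly star-shaped with respect to `x`. -/
def StrictlyStarShaped (S : Set E) (x : E) : Prop :=
  x ∈ S ∧ ∀ y ∈ S, segment ℝ x y ⊆ intrinsicInterior ℝ S ∪ {y}

/-- `S` is homeomorphic to the closed `k`-dimensional ball. -/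
def IsTopBall (k : ℕ) (S : Set E) : Prop :=
  Nonempty (S ≃ₜ Metric.closedBall (0 : EuclideanSpace ℝ (Fin k)) 1)

/-- The set of all subcomplexes of `K` that are full-dimensional balls and strictly star-shaped with
respect to the origin, together with the empty complex. -/
def starBalls (K : SimplicialComplex ℝ E) : Set (Set (Finset E)) :=
  {B | B ⊆ K.faces ∧ (∀ s ∈ B, ∀ t ⊆ s, t.Nonempty → t ∈ B) ∧
      IsTopBall (finrank ℝ E) (body B) ∧ StrictlyStarShaped (body B) 0} ∪ {∅}

/-- `α` (only its values on the full-dimensional simplices of `KP` matter) is a web of stars in `KQ`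
with respect to `KP`. -/
def IsWebOfStars (KP : SimplicialComplex ℝ E) (KQ : SimplicialComplex ℝ F)
    (α : Finset E → Set (Finset F)) : Prop :=
  (∀ s ∈ topFaces KP, α s ∈ starBalls KQ) ∧
    ∀ s ∈ topFaces KP, ∀ t ∈ topFaces KP, Stabs s t → α s ⊆ α t

/-- `α` and `β` form a compatible pair of webs of stars. -/
def IsCompatiblePair (KP : SimplicialComplex ℝ E) (KQ : SimplicialComplex ℝ F)
    (α : Finset E → Set (Finset F)) (β : Finset F → Set (Finset E)) : Prop :=
  IsWebOfStars KP KQ α ∧ IsWebOfStars KQ KP β ∧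
    ∀ s ∈ topFaces KP, ∀ t ∈ topFaces KQ, (s ∈ β t ↔ t ∉ α s)

end Webs

/-! ### Free sums and sum-triangulations

To treat both summands alike, everything is written in terms of two embeddings `i : E ↪ V` and
`j : F ↪ V`; they are used only for `V = E × F` and the two coordinate inclusions, in either order. -/

section Sums

variable {E : Type*} [NormedAddCommGroup E] [NormedSpace ℝ E]
variable {F : Type*} [NormedAddCommGroup F] [NormedSpace ℝ F]

/-- The inclusion `p ↦ (p, 0)`. -/
def inP {E F : Type*} [Zero F] : E ↪ E × F := ⟨fun p => (p, 0), fun _ _ h => congrArg Prod.fst h⟩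

/-- The inclusion `q ↦ (0, q)`. -/
def inQ {E F : Type*} [Zero E] : F ↪ E × F := ⟨fun q => (0, q), fun _ _ h => congrArg Prod.snd h⟩

/-- The free sum of two point configurations. -/
def freeSum (P : Set E) (Q : Set F) : Set (E × F) := inP '' P ∪ inQ '' Q

variable {V : Type*} [AddCommGroup V] [Module ℝ V]

/-- The part `s_P` of a simplex `s` in the summand included by `i`: the simplex spanned by the
vertices of `s` that lie in that summand. -/
noncomputable def part (i : E ↪ V) (s : Finset V) : Finset E := s.preimage i i.injective.injOn

open Classical in
/-- The simplex `s ⊕ t`. -/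
noncomputable def sumSimplex (i : E ↪ V) (j : F ↪ V) (s : Finset E) (t : Finset F) : Finset V :=
  s.map i ∪ t.map j

/-- The complex of the (nonempty) parts of the simplices of `K` in the summand included by `i`. -/
def parts (i : E ↪ V) (K : SimplicialComplex ℝ V) : Set (Finset E) :=
  {s | s.Nonempty ∧ ∃ r ∈ K.faces, s = part i r}

/-- The origin lies in the part of `K` belonging to `i`: every full-dimensional simplex `s` in the
star of the origin satisfies `0 ∈ s_P`. -/
def OriginInPart (i : E ↪ V) (K : SimplicialComplex ℝ V) : Prop :=
  ∀ s ∈ topFaces K, (0 : V) ∈ convexHull ℝ (s : Set V) →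
    (0 : E) ∈ convexHull ℝ (part i s : Set E)

/-- `KP` and `KQ` are triangulations of `P` and `Q` obtained from the triangulation `K` of the free
sum, when the origin lies in the `i`-part of `K`: `KP` consists of all `i`-parts of simplices
of `K`. If `0` is a vertex of `K`, then `KQ` consists of all `j`-parts; otherwise `KQ` arises from the
complex of all `j`-parts by filling in, in any way, the region not covered by it, such that `0` becomes
a vertex. -/
def IsInducedPair (i : E ↪ V) (j : F ↪ V) (P : Set E) (Q : Set F) (K : SimplicialComplex ℝ V)
    (KP : SimplicialComplex ℝ E) (KQ : SimplicialComplex ℝ F) : Prop :=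
  IsTriangulation P KP ∧ IsTriangulation Q KQ ∧ KP.faces = parts i K ∧
    ({0} ∈ K.faces → KQ.faces = parts j K) ∧
    ({0} ∉ K.faces → parts j K ⊆ KQ.faces ∧ {0} ∈ KQ.faces)

/-- The region not covered by the `j`-parts of `K` is filled in by coning from the origin: every
simplex of `KQ` is a `j`-part of `K` or lies in the closed star of `0`. -/
def IsConed (j : F ↪ V) (K : SimplicialComplex ℝ V) (KQ : SimplicialComplex ℝ F) : Prop :=
  ∀ t ∈ KQ.faces, t ∈ parts j K ∨ t ∈ starAt KQ 0

/-- The map `α`: the restriction to the cone over the link in `K`. -/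
def alphaMap (i : E ↪ V) (j : F ↪ V) (K : SimplicialComplex ℝ V) (KQ : SimplicialComplex ℝ F)
    (s : Finset E) : Set (Finset F) :=
  restrict KQ (j ⁻¹' linkCone K (s.map i))

open Classical in
/-- The map `β`: empty if `0` is a vertex, otherwise the restriction to the cone over the link. -/
noncomputable def betaMap (i : E ↪ V) (j : F ↪ V) (K : SimplicialComplex ℝ V)
    (KP : SimplicialComplex ℝ E) (t : Finset F) : Set (Finset E) :=
  if (0 : F) ∈ t then ∅ else restrict KP (i ⁻¹' linkCone K (t.map j))

/-- The full-dimensional simplices of `K` are the sums of the full-dimensional simplices of one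
summand with the boundary facets of the assigned ball in the other one. -/
def FacetFormula (i : E ↪ V) (j : F ↪ V) (K : SimplicialComplex ℝ V) (KP : SimplicialComplex ℝ E)
    (KQ : SimplicialComplex ℝ F) (α : Finset E → Set (Finset F))
    (β : Finset F → Set (Finset E)) : Prop :=
  topFaces K =
    {r | ∃ s ∈ topFaces KP, ∃ t ∈ boundaryFacets (α s), r = sumSimplex i j s t} ∪
    {r | ∃ t ∈ topFaces KQ, β t ≠ ∅ ∧ ∃ s ∈ boundaryFacets (β t), r = sumSimplex i j s t}

/-- `K` is the sum-triangulation of `KP` and `KQ` with respect to `α` and `β`, where the summand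
included by `i` plays the special role: a `P`-sum-triangulation for `i = inP`, `j = inQ`, and a
`Q`-sum-triangulation for `i = inQ`, `j = inP` (and `KP`, `KQ` interchanged). -/
def IsSumTriangulationVia (i : E ↪ V) (j : F ↪ V) (K : SimplicialComplex ℝ V)
    (KP : SimplicialComplex ℝ E) (KQ : SimplicialComplex ℝ F) (α : Finset E → Set (Finset F))
    (β : Finset F → Set (Finset E)) : Prop :=
  IsCompatiblePair KP KQ α β ∧
    (∀ s ∈ topFaces KP, s ∈ starAt KP 0 → α s = starAt KQ 0) ∧
    FacetFormula i j K KP KQ α β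

/-- `K` is a sum-triangulation of `KP` and `KQ` in which the summand included by `i` plays the
special role. -/
def IsSumTriangulation (i : E ↪ V) (j : F ↪ V) (K : SimplicialComplex ℝ V)
    (KP : SimplicialComplex ℝ E) (KQ : SimplicialComplex ℝ F) : Prop :=
  ∃ (α : Finset E → Set (Finset F)) (β : Finset F → Set (Finset E)),
    IsSumTriangulationVia i j K KP KQ α β

end Sums

end FreeSum

/-! Two objects control everything: the carrier of the origin and the links of the full-dimensional
simplices of the summands.

The carrier `c` is the face of `K` with `0` in its relative interior. A convex combination of
vertices that equals `0` vanishes in both coordinate blocks, so the vertices from one summand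
already represent `0` on their own. Since the carrier is unique, `c` lies in a single summand, say
that of `P`. Then the `P`-parts cover `conv P`, while a point of `conv Q` missed by the `Q`-parts
lies only in faces containing `c`. Replacing `c` by the vertex `0` in those faces (`coneLift`) gives
the conical filling.

Let `s` be a full-dimensional simplex of `P`. For dimension reasons its link lives in the other
summand, and it meets every ray from `0` exactly once. A point is found by leaving the interior of
`s` in the given direction; two points would produce crossing segments, hence overlapping simplices.
So the link is the unit sphere of a continuous, positively homogeneous, not necessarily convex
function `g`, and the cone over it is `{g ≤ 1}` (`exists_isGauge_linkCone`). Radial rescaling makes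
this a ball, homogeneity makes it strictly star-shaped, and because the sphere is a subcomplex, the
intermediate value theorem puts each face of `KQ` inside the ball or its relative interior outside.
The boundary facets are the full-dimensional link simplices, so the facet formula is a count of
vertices: of the `d + e + 1` vertices of a top face, either `d + 1` lie in `P` or `e + 1` lie in
`Q`.

Monotonicity and compatibility rest on the same planar fact (`exists_crossing`): if the order of two
pairs of points is reversed on two coordinate axes, the joining segments cross, and a common point
of two faces forces inclusions of carriers (`subset_of_mix_mem`). For monotonicity, Farkas' lemma
turns the stabbing relation into a ray meeting `s` no later than `t`. Faces of `KQ` that do not come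
from `K` are handled by shrinking towards `0`: a contracted point of a face containing `c` lies only
in faces containing `c` (`subset_of_smul_mem`). -/

namespace FreeSum

set_option linter.unusedSectionVars false

/-! ### Relative interiors of simplices and carriers of points. -/

section OpenHull

variable {V : Type*} [AddCommGroup V] [Module ℝ V]

/-- The points with a convex representation by `s` all of whose weights are positive: the relative
interior of the simplex `s` if `s` is affinely independent. -/
def openHull (s : Finset V) : Set V :=
  {x | ∃ w : V → ℝ, (∀ v ∈ s, 0 < w v) ∧ ∑ v ∈ s, w v = 1 ∧ ∑ v ∈ s, w v • v = x}

lemma openHull_subset_convexHull (s : Finset V) : openHull s ⊆ convexHull ℝ (s : Set V) := by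
  rintro x ⟨w, h0, h1, h2⟩
  exact Finset.mem_convexHull'.2 ⟨w, fun v hv => (h0 v hv).le, h1, h2⟩

lemma nonempty_of_mem_openHull {s : Finset V} {x : V} (hx : x ∈ openHull s) : s.Nonempty := by
  obtain ⟨w, -, h1, -⟩ := hx
  rw [Finset.nonempty_iff_ne_empty]
  rintro rfl
  simp at h1

lemma openHull_nonempty {s : Finset V} (hs : s.Nonempty) : (openHull s).Nonempty := by
  have hc : (0 : ℝ) < s.card := by exact_mod_cast hs.card_pos
  refine ⟨_, fun _ => (s.card : ℝ)⁻¹, fun v _ => inv_pos.2 hc, ?_, rfl⟩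
  simp [hc.ne']

lemma mem_openHull_singleton (v : V) : v ∈ openHull {v} :=
  ⟨fun _ => 1, by simp, by simp, by simp⟩

lemma exists_mem_openHull {s : Finset V} {x : V} (hx : x ∈ convexHull ℝ (s : Set V)) :
    ∃ t ⊆ s, t.Nonempty ∧ x ∈ openHull t := by
  classical
  obtain ⟨w, h0, h1, h2⟩ := Finset.mem_convexHull'.1 hx
  have hz : ∀ v ∈ s, v ∉ s.filter (fun v => w v ≠ 0) → w v = 0 := by
    intro v hv hv'
    by_contra h
    exact hv' (Finset.mem_filter.2 ⟨hv, h⟩)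
  have hm : x ∈ openHull (s.filter fun v => w v ≠ 0) := by
    refine ⟨w, fun v hv => ?_, ?_, ?_⟩
    · rw [Finset.mem_filter] at hv
      exact lt_of_le_of_ne (h0 v hv.1) (Ne.symm hv.2)
    · rw [Finset.sum_subset (Finset.filter_subset _ _) hz, h1]
    · rw [Finset.sum_subset (Finset.filter_subset _ _), h2]
      intro v hv hv'
      rw [hz v hv hv', zero_smul]
  exact ⟨_, Finset.filter_subset _ _, nonempty_of_mem_openHull hm, hm⟩

lemma mix_mem_openHull {s : Finset V} {x y : V} (hx : x ∈ openHull s)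
    (hy : y ∈ convexHull ℝ (s : Set V)) {θ : ℝ} (h0 : 0 < θ) (h1 : θ ≤ 1) :
    θ • x + (1 - θ) • y ∈ openHull s := by
  obtain ⟨w, hw0, hw1, rfl⟩ := hx
  obtain ⟨u, hu0, hu1, rfl⟩ := Finset.mem_convexHull'.1 hy
  refine ⟨fun v => θ * w v + (1 - θ) * u v, fun v hv => ?_, ?_, ?_⟩
  · have := mul_pos h0 (hw0 v hv)
    have := mul_nonneg (sub_nonneg.2 h1) (hu0 v hv)
    linarith
  · rw [Finset.sum_add_distrib, ← Finset.mul_sum, ← Finset.mul_sum, hw1, hu1]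
    ring
  · simp only [add_smul, Finset.sum_add_distrib, Finset.smul_sum, mul_smul]

lemma convex_openHull (s : Finset V) : Convex ℝ (openHull s) := by
  intro x hx y hy p q hp hq hpq
  rcases hp.eq_or_lt with rfl | hp
  · rw [zero_add] at hpq
    simpa [hpq] using hy
  · obtain rfl : q = 1 - p := by linarith
    exact mix_mem_openHull hx (openHull_subset_convexHull s hy) hp (by linarith)

lemma mix_mem_openHull_union [DecidableEq V] {s t : Finset V} {x y : V} (hx : x ∈ openHull s)
    (hy : y ∈ openHull t) {θ : ℝ} (h0 : 0 < θ) (h1 : θ < 1) :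
    θ • x + (1 - θ) • y ∈ openHull (s ∪ t) := by
  obtain ⟨w, hw0, hw1, rfl⟩ := hx
  obtain ⟨u, hu0, hu1, rfl⟩ := hy
  refine ⟨fun v => θ * (if v ∈ s then w v else 0) + (1 - θ) * (if v ∈ t then u v else 0),
    fun v hv => ?_, ?_, ?_⟩
  · have h1' : 0 < 1 - θ := by linarith
    rcases Finset.mem_union.1 hv with h | h
    · have h2 : 0 ≤ (if v ∈ t then u v else 0) := by
        split_ifs with h
        exacts [(hu0 v h).le, le_rfl]
      have h3 := hw0 v h
      simp only [h, if_true]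
      positivity
    · have h2 : 0 ≤ (if v ∈ s then w v else 0) := by
        split_ifs with h
        exacts [(hw0 v h).le, le_rfl]
      have h3 := hu0 v h
      simp only [h, if_true]
      positivity
  · simp [Finset.sum_add_distrib, ← Finset.mul_sum, Finset.sum_ite_mem,
      Finset.inter_eq_right.2 Finset.subset_union_left,
      Finset.inter_eq_right.2 Finset.subset_union_right, hw1, hu1]
  · simp [add_smul, Finset.sum_add_distrib, mul_smul, ← Finset.smul_sum, ite_smul,
      Finset.sum_ite_mem, Finset.inter_eq_right.2 Finset.subset_union_left,
      Finset.inter_eq_right.2 Finset.subset_union_right]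

variable {K : SimplicialComplex ℝ V}

/-- The point lies in the hull of `s ∩ t`, and barycentric coordinates in `s` are unique, so no
vertex of `s` with positive weight can be missing from `t`. -/
lemma subset_of_mem_openHull {s t : Finset V} (hs : s ∈ K.faces) (ht : t ∈ K.faces) {x : V}
    (hx : x ∈ openHull s) (hx' : x ∈ convexHull ℝ (t : Set V)) : s ⊆ t := by
  classical
  have h := K.inter_subset_convexHull hs ht ⟨openHull_subset_convexHull s hx, hx'⟩
  rw [← Finset.coe_inter] at h
  obtain ⟨w, hw0, hw1, hw2⟩ := hx
  obtain ⟨u, hu0, hu1, hu2⟩ := Finset.mem_convexHull'.1 h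
  intro v hv
  by_contra hvt
  have h1 : ∑ v ∈ s, (w v - if v ∈ s ∩ t then u v else 0) = 0 := by
    simp only [Finset.sum_sub_distrib, hw1, Finset.sum_ite_mem, ← Finset.inter_assoc,
      Finset.inter_self, hu1, sub_self]
  have h2 : ∑ v ∈ s, (w v - if v ∈ s ∩ t then u v else 0) • v = 0 := by
    simp only [sub_smul, ite_smul, zero_smul, Finset.sum_sub_distrib, hw2, Finset.sum_ite_mem,
      ← Finset.inter_assoc, Finset.inter_self, hu2, sub_self]
  have h3 := (K.indep hs).eq_zero_of_sum_eq_zero_subtype h1 h2 v hv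
  have h4 := hw0 v hv
  simp [hvt] at h3
  linarith

lemma eq_of_mem_openHull {s t : Finset V} (hs : s ∈ K.faces) (ht : t ∈ K.faces) {x : V}
    (hx : x ∈ openHull s) (hx' : x ∈ openHull t) : s = t :=
  (subset_of_mem_openHull hs ht hx (openHull_subset_convexHull t hx')).antisymm
    (subset_of_mem_openHull ht hs hx' (openHull_subset_convexHull s hx))

/-- If `t ⊆ r` carries `y`, a proper mixture of `x` and `y` has carrier `s ∪ t`, which is a face
because both sets lie in `r`. This converts coincidences of points into inclusions of vertex sets in
all the crossing arguments. -/
lemma subset_of_mix_mem {s r r' : Finset V} (hr : r ∈ K.faces) (hr' : r' ∈ K.faces) (hsr : s ⊆ r)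
    {x y : V} (hx : x ∈ openHull s) (hy : y ∈ convexHull ℝ (r : Set V)) {θ : ℝ} (h0 : 0 < θ)
    (h1 : θ ≤ 1) (h : θ • x + (1 - θ) • y ∈ convexHull ℝ (r' : Set V)) : s ⊆ r' := by
  classical
  rcases h1.eq_or_lt with rfl | h1
  · refine subset_of_mem_openHull (K.down_closed hr hsr (nonempty_of_mem_openHull hx)) hr' hx ?_
    simpa using h
  · obtain ⟨t, htr, htn, ht⟩ := exists_mem_openHull hy
    have := subset_of_mem_openHull (K.down_closed hr (Finset.union_subset hsr htr)
      (htn.mono Finset.subset_union_right)) hr' (mix_mem_openHull_union hx ht h0 h1) h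
    exact Finset.subset_union_left.trans this

lemma exists_face_of_mem_space {x : V} (hx : x ∈ K.space) :
    ∃ s ∈ K.faces, x ∈ openHull s := by
  obtain ⟨s, hs, hxs⟩ := SimplicialComplex.mem_space_iff.1 hx
  obtain ⟨t, hts, htn, ht⟩ := exists_mem_openHull hxs
  exact ⟨t, K.down_closed hs hts htn, ht⟩

lemma faces_finite_of_subset {A : Set V} (hA : A.Finite)
    (h : ∀ s ∈ K.faces, (s : Set V) ⊆ A) : K.faces.Finite := by
  classical
  refine (Finset.finite_toSet hA.toFinset.powerset).subset fun s hs => ?_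
  simp only [Finset.coe_powerset, Set.mem_preimage, Set.mem_powerset_iff]
  simpa using h s hs

end OpenHull

/-! ### Finite complexes near a point, and full-dimensional simplices. -/

section Topological

variable {V : Type*} [NormedAddCommGroup V] [NormedSpace ℝ V]

open Filter Topology

lemma convexHull_subset_closure_openHull {s : Finset V} (hs : s.Nonempty) :
    convexHull ℝ (s : Set V) ⊆ closure (openHull s) := by
  intro y hy
  obtain ⟨x, hx⟩ := openHull_nonempty hs
  have h : Tendsto (fun θ : ℝ => θ • x + (1 - θ) • y) (𝓝[>] 0) (𝓝 y) := by
    have : ContinuousAt (fun θ : ℝ => θ • x + (1 - θ) • y) 0 := by fun_prop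
    have h2 := this.tendsto
    simp only [zero_smul, sub_zero, one_smul, zero_add] at h2
    exact h2.mono_left nhdsWithin_le_nhds
  refine mem_closure_of_tendsto h ?_
  filter_upwards [Ioo_mem_nhdsGT (zero_lt_one (α := ℝ))] with θ hθ
  exact mix_mem_openHull hx hy hθ.1 hθ.2.le

variable {K : SimplicialComplex ℝ V}

/-- With finitely many faces, one of them contains `z + ε • v` for arbitrarily small `ε`; being
closed, it also contains the limit `z`. -/
lemma exists_face_along (hK : K.faces.Finite) {z v : V} {δ : ℝ} (hδ : 0 < δ)
    (h : ∀ ε, 0 < ε → ε < δ → z + ε • v ∈ K.space) :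
    ∃ r ∈ K.faces, ∃ ε, 0 < ε ∧ ε < δ ∧ z ∈ convexHull ℝ (r : Set V) ∧
      z + ε • v ∈ convexHull ℝ (r : Set V) := by
  have hδ' : ∀ᶠ ε in 𝓝[>] (0 : ℝ), 0 < ε ∧ ε < δ := Ioo_mem_nhdsGT hδ
  have h1 : ∃ r ∈ K.faces, ∃ᶠ ε in 𝓝[>] (0 : ℝ), z + ε • v ∈ convexHull ℝ (r : Set V) := by
    by_contra! hcon
    have h2 : ∀ᶠ ε in 𝓝[>] (0 : ℝ), ∀ r ∈ K.faces, z + ε • v ∉ convexHull ℝ (r : Set V) :=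
      (eventually_all_finite hK).2 hcon
    obtain ⟨ε, hε, hε'⟩ := (h2.and hδ').exists
    obtain ⟨s, hs, hxs⟩ := SimplicialComplex.mem_space_iff.1 (h ε hε'.1 hε'.2)
    exact hε s hs hxs
  obtain ⟨r, hr, hfr⟩ := h1
  obtain ⟨ε, hε, hε'⟩ := (hfr.and_eventually hδ').exists
  refine ⟨r, hr, ε, hε'.1, hε'.2, ?_, hε⟩
  have hcl : IsClosed (convexHull ℝ (r : Set V)) := r.finite_toSet.isClosed_convexHull ℝ
  refine hcl.mem_of_frequently_of_tendsto hfr ?_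
  have : ContinuousAt (fun ε : ℝ => z + ε • v) 0 := by fun_prop
  have h2 := this.tendsto
  simp only [zero_smul, add_zero] at h2
  exact h2.mono_left nhdsWithin_le_nhds

lemma exists_pos_forall_add_smul_mem {U : Set V} (hU : U ∈ 𝓝 (z : V)) (v : V) :
    ∃ δ > (0 : ℝ), ∀ ε, |ε| < δ → z + ε • v ∈ U := by
  have : ContinuousAt (fun ε : ℝ => z + ε • v) 0 := by fun_prop
  have h2 := this.tendsto
  simp only [zero_smul, add_zero] at h2
  obtain ⟨δ, hδ, h⟩ := Metric.eventually_nhds_iff.1 (h2.eventually hU)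
  exact ⟨δ, hδ, fun ε hε => h (by simpa using hε)⟩

variable [FiniteDimensional ℝ V]

lemma card_le_of_affineIndependent {s : Finset V} (hs : AffineIndependent ℝ ((↑) : s → V)) :
    s.card ≤ finrank ℝ V + 1 := by
  have := hs.card_le_finrank_succ
  rw [Fintype.card_coe] at this
  exact this.trans (Nat.succ_le_succ (Submodule.finrank_le _))

lemma affineSpan_eq_top_of_card {s : Finset V} (hs : AffineIndependent ℝ ((↑) : s → V))
    (hc : s.card = finrank ℝ V + 1) : affineSpan ℝ (s : Set V) = ⊤ := by
  have := hs.affineSpan_eq_top_iff_card_eq_finrank_add_one.2 (by rw [Fintype.card_coe, hc])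
  simpa using this

/-- A full-dimensional simplex as an affine basis. -/
noncomputable def affineBasisOfCard {s : Finset V} (hs : AffineIndependent ℝ ((↑) : s → V))
    (hc : s.card = finrank ℝ V + 1) : AffineBasis s ℝ V :=
  ⟨(↑), hs, by simpa using affineSpan_eq_top_of_card hs hc⟩

lemma mem_openHull_iff_coord {s : Finset V} (hs : AffineIndependent ℝ ((↑) : s → V))
    (hc : s.card = finrank ℝ V + 1) {x : V} :
    x ∈ openHull s ↔ ∀ v : s, 0 < (affineBasisOfCard hs hc).coord v x := by
  set B := affineBasisOfCard hs hc with hB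
  have hBv : ∀ v : s, B v = v := fun v => rfl
  constructor
  · rintro ⟨w, h0, h1, rfl⟩ v
    have h2 : ∑ v ∈ s, w v • v = ∑ v : s, w v • B v := by
      rw [← Finset.sum_coe_sort s (fun v => w v • v)]
      rfl
    have h3 : ∑ v : s, w v = 1 := by rw [Finset.sum_coe_sort s w, h1]
    have h4 : ∑ v : s, w v • B v = Finset.univ.affineCombination ℝ B (fun v : s => w v) := by
      rw [Finset.affineCombination_eq_linear_combination _ _ _ h3]
    rw [h2, h4, B.coord_apply_combination_of_mem (Finset.mem_univ v) h3]
    exact h0 v v.2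
  · intro h
    classical
    refine ⟨fun v => if hv : v ∈ s then B.coord ⟨v, hv⟩ x else 0, fun v hv => ?_, ?_, ?_⟩
    · simpa [hv] using h ⟨v, hv⟩
    · rw [← Finset.sum_coe_sort s]
      simp only [Finset.coe_mem, dite_true, Subtype.coe_eta]
      exact B.sum_coord_apply_eq_one x
    · rw [← Finset.sum_coe_sort s]
      simp only [Finset.coe_mem, dite_true, Subtype.coe_eta]
      exact B.linear_combination_coord_eq_self x

lemma isOpen_openHull {s : Finset V} (hs : AffineIndependent ℝ ((↑) : s → V))
    (hc : s.card = finrank ℝ V + 1) : IsOpen (openHull s) := by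
  have : openHull s = ⋂ v : s, {x | 0 < (affineBasisOfCard hs hc).coord v x} := by
    ext x
    simp [mem_openHull_iff_coord hs hc]
  rw [this]
  exact isOpen_iInter_of_finite fun v =>
    isOpen_lt continuous_const (continuous_barycentric_coord _ v)

/-- A largest face containing `c` must be full-dimensional: otherwise, from a point of its relative
interior that is interior to the space, a step off its affine span enters a strictly larger face. -/
lemma exists_topFace_of_mem_interior (hK : K.faces.Finite) {c : Finset V} (hc : c ∈ K.faces)
    {z : V} (hz : z ∈ convexHull ℝ (c : Set V)) (hz' : z ∈ interior K.space) :
    ∃ r ∈ topFaces K, c ⊆ r := by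
  obtain ⟨r, ⟨hr, hcr⟩, hmax⟩ := (hK.subset (Set.sep_subset K.faces (c ⊆ ·))).exists_maximalFor
    Finset.card _ ⟨c, hc, Finset.Subset.refl c⟩
  refine ⟨r, ⟨hr, ?_⟩, hcr⟩
  by_contra hcard
  obtain ⟨y, hy⟩ := openHull_nonempty (K.nonempty_of_mem_faces hr)
  have hspan : affineSpan ℝ (r : Set V) ≠ ⊤ := by
    intro h
    refine hcard ?_
    have := (K.indep hr).affineSpan_eq_top_iff_card_eq_finrank_add_one.1 (by simpa using h)
    simpa using this
  obtain ⟨p, hp⟩ : ∃ p, p ∉ affineSpan ℝ (r : Set V) := by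
    by_contra! h
    exact hspan (by ext; simp [h])
  obtain ⟨δ, hδ, hδ'⟩ := exists_pos_forall_add_smul_mem (isOpen_interior.mem_nhds hz') (y - z)
  -- A small step from `z` towards `y` reaches the relative interior of `r` without leaving the
  -- interior of the space.
  obtain ⟨θ, hθ0, hθ⟩ := exists_between (lt_min hδ zero_lt_one)
  have hx : z + θ • (y - z) ∈ openHull r := by
    have := mix_mem_openHull hy (convexHull_mono (Finset.coe_subset.2 hcr) hz) hθ0
      (hθ.le.trans (min_le_right _ _))
    convert this using 1
    module
  have hxi := hδ' θ (by rw [abs_of_pos hθ0]; exact hθ.trans_le (min_le_left _ _))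
  set x := z + θ • (y - z)
  obtain ⟨η, hη, hη'⟩ := exists_pos_forall_add_smul_mem (isOpen_interior.mem_nhds hxi) (p - x)
  obtain ⟨r', hr', ε, hε, -, h1, h2⟩ := exists_face_along hK (z := x) (v := p - x) hη
    (fun ε h0 h1 => interior_subset (hη' ε (by rwa [abs_of_pos h0])))
  have hrr' : r ⊆ r' := subset_of_mem_openHull hr hr' hx h1
  have hle := hmax ⟨hr', hcr.trans hrr'⟩ (Finset.card_le_card hrr')
  obtain rfl : r = r' := Finset.eq_of_subset_of_card_le hrr' hle
  apply hp
  have hx1 := convexHull_subset_affineSpan (𝕜 := ℝ) _ h1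
  have hx2 := convexHull_subset_affineSpan (𝕜 := ℝ) _ h2
  have := AffineMap.lineMap_mem (k := ℝ) (ε⁻¹) hx1 hx2
  rw [AffineMap.lineMap_apply] at this
  simpa [smul_smul, hε.ne'] using this

end Topological

/-! ### Gauges and their radially rescaled unit balls. -/

section Gauges

open Filter Topology

variable {F : Type*} [NormedAddCommGroup F] [NormedSpace ℝ F]

/-- Continuous, positively homogeneous functions that are positive away from the origin. -/
structure IsGauge (g : F → ℝ) : Prop where
  continuous : Continuous g
  pos : ∀ y, y ≠ 0 → 0 < g y
  hom : ∀ (r : ℝ) (y : F), 0 ≤ r → g (r • y) = r * g y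

namespace IsGauge

variable {g h : F → ℝ}

lemma map_zero (hg : IsGauge g) : g 0 = 0 := by
  simpa using hg.hom 0 0 le_rfl

lemma nonneg (hg : IsGauge g) (y : F) : 0 ≤ g y := by
  rcases eq_or_ne y 0 with rfl | hy
  · exact hg.map_zero.ge
  · exact (hg.pos y hy).le

lemma ne_zero (hg : IsGauge g) {y : F} (hy : y ≠ 0) : g y ≠ 0 := (hg.pos y hy).ne'

lemma isOpen_lt_one (hg : IsGauge g) : IsOpen {y | g y < 1} :=
  isOpen_lt hg.continuous continuous_const

lemma isClosed_le_one (hg : IsGauge g) : IsClosed {y | g y ≤ 1} :=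
  isClosed_le hg.continuous continuous_const

lemma zero_mem_interior (hg : IsGauge g) : (0 : F) ∈ interior {y | g y ≤ 1} :=
  mem_interior.2 ⟨{y | g y < 1}, fun y (hy : g y < 1) => hy.le, hg.isOpen_lt_one, by
    simp [hg.map_zero]⟩

lemma strictlyStarShaped (hg : IsGauge g) : StrictlyStarShaped {y | g y ≤ 1} 0 := by
  refine ⟨by simp [hg.map_zero], fun y hy => ?_⟩
  rintro _ ⟨a, b, ha, hb, hab, rfl⟩
  rw [smul_zero, zero_add]
  rcases ha.eq_or_lt with rfl | ha
  · right
    simp [show b = 1 by linarith]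
  · left
    refine interior_subset_intrinsicInterior (mem_interior.2
      ⟨{y | g y < 1}, fun y (hy : g y < 1) => hy.le, hg.isOpen_lt_one, ?_⟩)
    simp only [Set.mem_ofPred_eq] at hy ⊢
    rw [hg.hom b y hb]
    nlinarith [hg.nonneg y]

lemma map_rescale (hg : IsGauge g) (hh : IsGauge h) (y : F) : h ((g y / h y) • y) = g y := by
  rcases eq_or_ne y 0 with rfl | hy
  · simp [hg.map_zero, hh.map_zero]
  · rw [hh.hom _ _ (div_nonneg (hg.nonneg y) (hh.nonneg y)), div_mul_cancel₀ _ (hh.ne_zero hy)]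

lemma rescale_rescale (hg : IsGauge g) (hh : IsGauge h) (y : F) :
    (h ((g y / h y) • y) / g ((g y / h y) • y)) • (g y / h y) • y = y := by
  rcases eq_or_ne y 0 with rfl | hy
  · simp
  · rw [map_rescale hg hh, hg.hom _ _ (div_nonneg (hg.nonneg y) (hh.nonneg y)), smul_smul]
    have h1 := hg.ne_zero hy
    have h2 := hh.ne_zero hy
    convert one_smul ℝ y using 2
    field_simp

variable [FiniteDimensional ℝ F]

lemma exists_mul_norm_le (hg : IsGauge g) : ∃ m > 0, ∀ y, m * ‖y‖ ≤ g y := by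
  have : ProperSpace F := FiniteDimensional.proper ℝ F
  rcases subsingleton_or_nontrivial F with hF | hF
  · refine ⟨1, one_pos, fun y => ?_⟩
    rw [Subsingleton.elim y 0]
    simp [hg.map_zero]
  · obtain ⟨x, hx, hmin⟩ := (isCompact_sphere (0 : F) 1).exists_isMinOn
      (NormedSpace.sphere_nonempty.2 zero_le_one) hg.continuous.continuousOn
    have hx0 : x ≠ 0 := by
      rintro rfl
      simp at hx
    refine ⟨g x, hg.pos x hx0, fun y => ?_⟩
    rcases eq_or_ne y 0 with rfl | hy
    · simp [hg.map_zero]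
    · have h1 : (‖y‖⁻¹ • y) ∈ Metric.sphere (0 : F) 1 := by
        simp [norm_smul, hy]
      have h2 := hmin h1
      simp only [Set.mem_ofPred_eq] at h2
      rw [hg.hom _ _ (by positivity), inv_mul_eq_div, le_div_iff₀ (norm_pos_iff.2 hy)] at h2
      exact h2

/-- Only the origin needs care, since `g y / h y` has no limit there in general. The bound `m * ‖y‖
≤ h y` gives norm at most `g y / m`, which tends to `0`. -/
lemma continuous_rescale (hg : IsGauge g) (hh : IsGauge h) :
    Continuous fun y => (g y / h y) • y := by
  rw [continuous_iff_continuousAt]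
  intro y
  rcases eq_or_ne y 0 with rfl | hy
  · obtain ⟨m, hm, hm'⟩ := hh.exists_mul_norm_le
    have hb : ∀ y, ‖(g y / h y) • y‖ ≤ g y / m := by
      intro y
      rcases eq_or_ne y 0 with rfl | hy
      · simp [hg.map_zero]
      · rw [norm_smul, norm_div, Real.norm_of_nonneg (hg.nonneg y),
          Real.norm_of_nonneg (hh.nonneg y), div_mul_eq_mul_div, div_le_div_iff₀ (hh.pos y hy) hm]
        have := mul_le_mul_of_nonneg_left (hm' y) (hg.nonneg y)
        linarith
    unfold ContinuousAt
    simp only [smul_zero]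
    refine squeeze_zero_norm hb ?_
    have := (hg.continuous.div_const m).tendsto 0
    simpa [hg.map_zero] using this
  · exact (hg.continuous.continuousAt.div hh.continuous.continuousAt (hh.ne_zero hy)).smul
      continuousAt_id

/-- The unit balls of two gauges are homeomorphic by radial rescaling. -/
noncomputable def rescaleHomeomorph (hg : IsGauge g) (hh : IsGauge h) :
    {y | g y ≤ 1} ≃ₜ {y | h y ≤ 1} where
  toFun y := ⟨(g y / h y) • (y : F), (map_rescale hg hh (y : F)).trans_le y.2⟩
  invFun y := ⟨(h y / g y) • (y : F), (map_rescale hh hg (y : F)).trans_le y.2⟩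
  left_inv y := Subtype.ext (rescale_rescale hg hh y)
  right_inv y := Subtype.ext (rescale_rescale hh hg y)
  continuous_toFun :=
    ((continuous_rescale hg hh).comp continuous_subtype_val).subtype_mk _
  continuous_invFun :=
    ((continuous_rescale hh hg).comp continuous_subtype_val).subtype_mk _

lemma isTopBall (hg : IsGauge g) : IsTopBall (finrank ℝ F) {y | g y ≤ 1} := by
  obtain ⟨e⟩ : Nonempty (F ≃L[ℝ] EuclideanSpace ℝ (Fin (finrank ℝ F))) :=
    FiniteDimensional.nonempty_continuousLinearEquiv_of_finrank_eq (by simp)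
  have hh : IsGauge fun y => ‖e y‖ :=
    ⟨by fun_prop, fun y hy => by simpa using hy, fun r y hr => by
      simp [norm_smul, abs_of_nonneg hr]⟩
  refine ⟨(rescaleHomeomorph hg hh).trans (e.toHomeomorph.sets ?_)⟩
  ext y
  simp

end IsGauge

/-- A compact set meeting every ray from the origin in exactly one point is the unit sphere of a
gauge. -/
lemma exists_isGauge {S : Set F} (hS : IsCompact S)
    (hcov : ∀ v, v ≠ 0 → ∃ u > (0 : ℝ), ∃ x ∈ S, v = u • x) (h0 : (0 : F) ∉ S)
    (hinj : ∀ x ∈ S, ∀ s > (0 : ℝ), s • x ∈ S → s = 1) :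
    ∃ g : F → ℝ, IsGauge g ∧ ∀ y, g y = 1 ↔ y ∈ S := by
  classical
  choose! u hu x hx hux using hcov
  set g : F → ℝ := fun y => if y = 0 then 0 else u y with hgdef
  have hg0 : g 0 = 0 := by simp [hgdef]
  have hgpos : ∀ y, y ≠ 0 → 0 < g y := fun y hy => by simpa [hgdef, hy] using hu y hy
  have hgS : ∀ y, y ≠ 0 → (g y)⁻¹ • y ∈ S := by
    intro y hy
    have h2 : (g y)⁻¹ • y = x y := by
      conv_lhs => rw [hux y hy]
      have : g (u y • x y) = u y := by rw [← hux y hy]; simp [hgdef, hy]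
      rw [this, smul_smul, inv_mul_cancel₀ (hu y hy).ne', one_smul]
    rw [h2]
    exact hx y hy
  have huniq : ∀ r > 0, ∀ z ∈ S, g (r • z) = r := by
    intro r hr z hz
    have hz0 : z ≠ 0 := by
      rintro rfl
      exact h0 hz
    have hrz : r • z ≠ 0 := smul_ne_zero hr.ne' hz0
    have h1 := hgS _ hrz
    rw [smul_smul] at h1
    have h2 := hinj z hz _ (mul_pos (inv_pos.2 (hgpos _ hrz)) hr) h1
    rwa [inv_mul_eq_one₀ (hgpos _ hrz).ne'] at h2
  have hhom : ∀ (r : ℝ) (y : F), 0 ≤ r → g (r • y) = r * g y := by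
    intro r y hr
    rcases hr.eq_or_lt with rfl | hr
    · simp [hg0]
    rcases eq_or_ne y 0 with rfl | hy
    · simp [hg0]
    have h1 := huniq (r * g y) (mul_pos hr (hgpos y hy)) _ (hgS y hy)
    rwa [smul_smul, mul_assoc, mul_inv_cancel₀ (hgpos y hy).ne', mul_one] at h1
  have hone : ∀ y, g y = 1 ↔ y ∈ S := by
    intro y
    constructor
    · intro h
      have hy : y ≠ 0 := by
        rintro rfl
        rw [hg0] at h
        exact zero_ne_one h
      simpa [h] using hgS y hy
    · intro h
      simpa using huniq 1 one_pos y h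
  refine ⟨g, ⟨?_, hgpos, hhom⟩, hone⟩
  -- The radial projection `y ↦ (g y)⁻¹ • y` onto `S` keeps directions. Continuity of `g` away from
  -- `0` is reduced to continuity of this projection, because `g` is the quotient of the two norms.
  have hψ : ∀ y, ‖(g y)⁻¹ • y‖ • y = ‖y‖ • ((g y)⁻¹ • y) := by
    intro y
    rcases eq_or_ne y 0 with rfl | hy
    · simp
    · rw [norm_smul, smul_smul, norm_inv, Real.norm_of_nonneg (hgpos y hy).le, mul_comm]
  have hgψ : ∀ y, g y = ‖y‖ / ‖(g y)⁻¹ • y‖ := by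
    intro y
    rcases eq_or_ne y 0 with rfl | hy
    · simp [hg0]
    · have h1 : ‖y‖ ≠ 0 := by simpa using hy
      have h2 := (hgpos y hy).ne'
      rw [norm_smul, norm_inv, Real.norm_of_nonneg (hgpos y hy).le]
      field_simp
  obtain ⟨m, hm, hmS⟩ : ∃ m > (0 : ℝ), ∀ z ∈ S, m ≤ ‖z‖ := by
    rcases S.eq_empty_or_nonempty with hSe | hSn
    · exact ⟨1, one_pos, by simp [hSe]⟩
    · obtain ⟨z, hz, hmin⟩ := hS.exists_isMinOn hSn continuous_norm.continuousOn
      refine ⟨‖z‖, norm_pos_iff.2 ?_, fun y hy => hmin hy⟩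
      rintro rfl
      exact h0 hz
  rw [continuous_iff_continuousAt]
  intro y
  rcases eq_or_ne y 0 with rfl | hy
  · unfold ContinuousAt
    rw [hg0]
    refine squeeze_zero (g := fun y => ‖y‖ / m) (fun y => ?_) (fun y => ?_) ?_
    · rcases eq_or_ne y 0 with rfl | hy
      exacts [hg0.ge, (hgpos y hy).le]
    · rcases eq_or_ne y 0 with rfl | hy
      · simp [hg0]
      · rw [hgψ y]
        exact div_le_div_of_nonneg_left (norm_nonneg _) hm (hmS _ (hgS y hy))
    · have : Continuous fun y : F => ‖y‖ / m := by fun_prop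
      simpa using this.tendsto 0
  -- The projection takes values in the compact set `S`, so it is enough that its only cluster point
  -- at `y` is its value there. A cluster point lies on the ray of `y`, and `S` meets that ray once.
  · have hψc : ContinuousAt (fun y => (g y)⁻¹ • y) y := by
      refine hS.tendsto_nhds_of_unique_mapClusterPt ?_ ?_
      · filter_upwards [isOpen_ne.mem_nhds hy] with z hz
        exact hgS z hz
      · intro x' hx' hcl
        obtain ⟨U, hU, hUx⟩ := mapClusterPt_iff_ultrafilter.1 hcl
        have hid : Tendsto (fun z : F => z) U (𝓝 y) := hU
        have h1 : Tendsto (fun z => ‖(g z)⁻¹ • z‖ • z) U (𝓝 (‖x'‖ • y)) := hUx.norm.smul hid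
        have h2 : Tendsto (fun z => ‖z‖ • ((g z)⁻¹ • z)) U (𝓝 (‖y‖ • x')) := hid.norm.smul hUx
        have h3 : ‖x'‖ • y = ‖y‖ • x' := tendsto_nhds_unique h1 (h2.congr fun z => (hψ z).symm)
        have hx'0 : x' ≠ 0 := by
          rintro rfl
          exact h0 hx'
        have hny := norm_pos_iff.2 hy
        have hnx := norm_pos_iff.2 hx'0
        have h4 : x' = (‖x'‖ * ‖y‖⁻¹ * g y) • ((g y)⁻¹ • y) := by
          rw [smul_smul, mul_assoc, mul_inv_cancel₀ (hgpos y hy).ne', mul_one, mul_comm,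
            mul_smul, h3, smul_smul, inv_mul_cancel₀ hny.ne', one_smul]
        have hg := hgpos y hy
        have h5 := hinj _ (hgS y hy) (‖x'‖ * ‖y‖⁻¹ * g y) (by positivity) (h4 ▸ hx')
        rw [h5, one_smul] at h4
        exact h4
    have hne : ‖(g y)⁻¹ • y‖ ≠ 0 := norm_ne_zero_iff.2
      (smul_ne_zero (inv_ne_zero (hgpos y hy).ne') hy)
    have := (continuous_norm.continuousAt (x := y)).div hψc.norm hne
    exact this.congr (Eventually.of_forall fun z => (hgψ z).symm)

end Gauges

/-! ### Subcomplexes cut out by a gauge whose unit sphere is a subcomplex. -/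

section GaugeComplex

open Filter Topology

variable {F : Type*} [NormedAddCommGroup F] [NormedSpace ℝ F]
variable {K : SimplicialComplex ℝ F} {L : Set (Finset F)} {g : F → ℝ}

lemma mem_body {B : Set (Finset F)} {x : F} :
    x ∈ body B ↔ ∃ s ∈ B, x ∈ convexHull ℝ (s : Set F) := by
  simp [body]

/-- If the relative interior of `t` meets the sphere `g = 1`, then `t` is a face of a simplex of `L`
and `g = 1` on all of `t`. Otherwise connectedness keeps `g` below `1` on the relative interior, and
closure gives the rest. -/
lemma convexHull_subset_of_mem_openHull (hg : IsGauge g) (hL : L ⊆ K.faces)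
    (hgL : ∀ y, g y = 1 ↔ y ∈ body L) {t : Finset F} (ht : t ∈ K.faces) {y : F}
    (hy : y ∈ openHull t) (hy1 : g y ≤ 1) : convexHull ℝ (t : Set F) ⊆ {y | g y ≤ 1} := by
  by_cases hmeet : ∃ x ∈ openHull t, g x = 1
  · obtain ⟨x, hx, hx1⟩ := hmeet
    obtain ⟨s, hs, hxs⟩ := mem_body.1 ((hgL x).1 hx1)
    have hts := subset_of_mem_openHull ht (hL hs) hx hxs
    exact fun z hz => ((hgL z).2 (mem_body.2
      ⟨s, hs, convexHull_mono (Finset.coe_subset.2 hts) hz⟩)).le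
  · push Not at hmeet
    have hle : openHull t ⊆ {y | g y ≤ 1} := by
      intro z hz
      by_contra hz1
      simp only [Set.mem_ofPred_eq, not_le] at hz1
      obtain ⟨x, hx, hx1⟩ := (convex_openHull t).isPreconnected.intermediate_value hy hz
        hg.continuous.continuousOn ⟨hy1, hz1.le⟩
      exact hmeet x hx hx1
    exact (convexHull_subset_closure_openHull (K.nonempty_of_mem_faces ht)).trans
      (closure_minimal hle hg.isClosed_le_one)

lemma convexHull_subset_of_lt_one (hg : IsGauge g) (hL : L ⊆ K.faces)
    (hgL : ∀ y, g y = 1 ↔ y ∈ body L) {t : Finset F} (ht : t ∈ K.faces) {y : F}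
    (hy : y ∈ convexHull ℝ (t : Set F)) (hy1 : g y < 1) :
    convexHull ℝ (t : Set F) ⊆ {y | g y ≤ 1} := by
  obtain ⟨z, hz1, hz⟩ := mem_closure_iff.1
    (convexHull_subset_closure_openHull (K.nonempty_of_mem_faces ht) hy) _ hg.isOpen_lt_one hy1
  exact convexHull_subset_of_mem_openHull hg hL hgL ht hz (le_of_lt hz1)

lemma body_restrict (hg : IsGauge g) (hL : L ⊆ K.faces) (hgL : ∀ y, g y = 1 ↔ y ∈ body L)
    (hsp : {y | g y ≤ 1} ⊆ K.space) : body (restrict K {y | g y ≤ 1}) = {y | g y ≤ 1} := by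
  ext y
  rw [mem_body]
  constructor
  · rintro ⟨s, hs, hy⟩
    exact hs.2 hy
  · intro hy
    obtain ⟨s, hs, hys⟩ := exists_face_of_mem_space (hsp hy)
    exact ⟨s, ⟨hs, convexHull_subset_of_mem_openHull hg hL hgL hs hys hy⟩,
      openHull_subset_convexHull s hys⟩

variable [FiniteDimensional ℝ F]

lemma restrict_mem_starBalls (hg : IsGauge g) (hL : L ⊆ K.faces)
    (hgL : ∀ y, g y = 1 ↔ y ∈ body L) (hsp : {y | g y ≤ 1} ⊆ K.space) :
    restrict K {y | g y ≤ 1} ∈ starBalls K := by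
  refine Or.inl ⟨fun s hs => hs.1, fun s hs t hts ht => ⟨K.down_closed hs.1 hts ht,
    (convexHull_mono (Finset.coe_subset.2 hts)).trans hs.2⟩, ?_, ?_⟩
  · rw [body_restrict hg hL hgL hsp]
    exact hg.isTopBall
  · rw [body_restrict hg hL hgL hsp]
    exact hg.strictlyStarShaped

/-- Across a facet `r` of a full-dimensional simplex `s`, a line through an interior point of `r`
that leaves `s` in one direction enters it in the opposite one. -/
lemma exists_sub_smul_mem_openHull {r s : Finset F} (hs : AffineIndependent ℝ ((↑) : s → F))
    (hc : s.card = finrank ℝ F + 1) (hrs : r ⊆ s) (hr : r.card = finrank ℝ F) {y : F}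
    (hy : y ∈ openHull r) (v : F)
    (hv : ∃ᶠ ε in 𝓝[>] (0 : ℝ), y + ε • v ∉ convexHull ℝ (s : Set F)) :
    ∀ᶠ ε in 𝓝[>] (0 : ℝ), y - ε • v ∈ openHull s := by
  classical
  set B := affineBasisOfCard hs hc with hB
  have hrange : Set.range B = (s : Set F) := Subtype.range_coe
  obtain ⟨w, hw0, hw1, hw2⟩ := hy
  have hcy : ∀ u : s, B.coord u y = if (u : F) ∈ r then w u else 0 := by
    intro u
    have e1 : ∑ v : s, (if (v : F) ∈ r then w v else 0) = 1 := by
      rw [Finset.sum_coe_sort s (fun v => if v ∈ r then w v else 0), Finset.sum_ite_mem,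
        Finset.inter_eq_right.2 hrs, hw1]
    have e2 : ∑ v : s, (if (v : F) ∈ r then w v else 0) • B v = y := by
      have : ∑ v : s, (if (v : F) ∈ r then w v else 0) • B v
          = ∑ v : s, (fun v : F => (if v ∈ r then w v else 0) • v) v := rfl
      rw [this, Finset.sum_coe_sort s (fun v : F => (if v ∈ r then w v else 0) • v)]
      simp only [ite_smul, zero_smul]
      rw [Finset.sum_ite_mem, Finset.inter_eq_right.2 hrs, hw2]
    rw [← Finset.univ.affineCombination_eq_linear_combination _ _ e1] at e2
    conv_lhs => rw [← e2]
    rw [B.coord_apply_combination_of_mem (Finset.mem_univ u) e1]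
  have hlin : ∀ (u : s) (ε : ℝ), B.coord u (y + ε • v)
      = B.coord u y + ε * (B.coord u).linear v := by
    intro u ε
    have := (B.coord u).map_vadd y (ε • v)
    rw [vadd_eq_add, vadd_eq_add, add_comm] at this
    rw [this, map_smul, smul_eq_mul, add_comm]
  have hpos : ∀ u : s, (u : F) ∈ r → ∀ᶠ ε in 𝓝 (0 : ℝ),
      0 < B.coord u y + ε * (B.coord u).linear v := by
    intro u hu
    have hcont : Continuous fun ε : ℝ => B.coord u y + ε * (B.coord u).linear v := by fun_prop
    refine hcont.continuousAt.eventually (lt_mem_nhds ?_)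
    simp only [zero_mul, add_zero, hcy, if_pos hu]
    exact hw0 _ hu
  have hallpos : ∀ᶠ ε in 𝓝 (0 : ℝ), ∀ u : s, (u : F) ∈ r →
      0 < B.coord u y + ε * (B.coord u).linear v := by
    rw [eventually_all]
    intro u
    by_cases hu : (u : F) ∈ r
    · exact (hpos u hu).mono fun _ h _ => h
    · exact Eventually.of_forall fun _ h => absurd h hu
  -- Coordinates of vertices in `r` stay positive for small `ε`, and those of vertices outside `r`
  -- start at `0`. Leaving `s` therefore forces one of the latter to decrease.
  obtain ⟨u, hur, hul⟩ : ∃ u : s, (u : F) ∉ r ∧ (B.coord u).linear v < 0 := by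
    by_contra! hcon
    refine hv ?_
    filter_upwards [hallpos.filter_mono nhdsWithin_le_nhds, self_mem_nhdsWithin] with ε hε hε0
    rw [not_not, ← hrange, B.convexHull_eq_nonneg_coord]
    intro u
    rw [hlin]
    by_cases hu : (u : F) ∈ r
    · exact (hε u hu).le
    · rw [hcy, if_neg hu, zero_add]
      exact mul_nonneg (le_of_lt hε0) (hcon u hu)
  have hsing : ∀ u' : s, (u' : F) ∉ r → u' = u := by
    intro u' hu'
    have h1 : (s \ r).card = 1 := by
      rw [Finset.card_sdiff_of_subset hrs, hc, hr]
      omega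
    obtain ⟨a, ha⟩ := Finset.card_eq_one.1 h1
    have h2 : (u' : F) ∈ s \ r := Finset.mem_sdiff.2 ⟨u'.2, hu'⟩
    have h3 : (u : F) ∈ s \ r := Finset.mem_sdiff.2 ⟨u.2, hur⟩
    rw [ha, Finset.mem_singleton] at h2 h3
    exact Subtype.ext (h2.trans h3.symm)
  have hneg : ∀ᶠ ε in 𝓝[>] (0 : ℝ), ∀ u : s, (u : F) ∈ r →
      0 < B.coord u y + (-ε) * (B.coord u).linear v := by
    have : Tendsto (fun ε : ℝ => -ε) (𝓝[>] 0) (𝓝 0) := by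
      have := (continuous_neg (G := ℝ)).tendsto 0
      rw [neg_zero] at this
      exact this.mono_left nhdsWithin_le_nhds
    exact this.eventually hallpos
  filter_upwards [hneg, self_mem_nhdsWithin] with ε hε hε0
  rw [mem_openHull_iff_coord hs hc, sub_eq_add_neg, ← neg_smul]
  intro u'
  rw [← hB, hlin]
  by_cases hu : (u' : F) ∈ r
  · exact hε u' hu
  · obtain rfl := hsing u' hu
    rw [hcy, if_neg hu, zero_add]
    exact mul_pos_of_neg_of_neg (neg_lt_zero.2 hε0) hul

/-- A facet with an interior point where `g < 1` can be crossed away from the vertex opposite to it,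
which yields a second full-dimensional simplex of the ball. At a facet on the sphere the outward
radial direction leaves the ball, so every simplex of the ball adjacent to it contains the nearby
inward points, and two such simplices coincide. -/
lemma mem_boundaryFacets_restrict (hK : K.faces.Finite) (hg : IsGauge g) (hL : L ⊆ K.faces)
    (hLc : ∀ t ∈ L, t.card ≤ finrank ℝ F) (hgL : ∀ y, g y = 1 ↔ y ∈ body L)
    (hsp : {y | g y ≤ 1} ⊆ K.space) {r : Finset F} :
    r ∈ boundaryFacets (restrict K {y | g y ≤ 1}) ↔ r.card = finrank ℝ F ∧ (r ∈ L ∨ r = ∅) := by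
  classical
  have hLr : ∀ {r : Finset F} {y : F}, r ∈ K.faces → r.card = finrank ℝ F → y ∈ openHull r →
      g y = 1 → r ∈ L := by
    intro r y hr hrc hy hy1
    obtain ⟨t, ht, hyt⟩ := mem_body.1 ((hgL y).1 hy1)
    have := subset_of_mem_openHull hr (hL ht) hy hyt
    rwa [Finset.eq_of_subset_of_card_le this (by rw [hrc]; exact hLc t ht)]
  constructor
  · rintro ⟨hrc, τ, ⟨hτ, hτc, hrτ⟩, huniq⟩
    refine ⟨hrc, ?_⟩
    rcases r.eq_empty_or_nonempty with rfl | hrn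
    · exact Or.inr rfl
    left
    have hr : r ∈ K.faces := K.down_closed hτ.1 hrτ hrn
    obtain ⟨y, hy⟩ := openHull_nonempty hrn
    refine hLr hr hrc hy ?_
    by_contra hy1
    have hylt : g y < 1 := lt_of_le_of_ne
      (hτ.2 (convexHull_mono (Finset.coe_subset.2 hrτ) (openHull_subset_convexHull r hy))) hy1
    obtain ⟨w, hwτ, hwr⟩ : ∃ w ∈ τ, w ∉ r := by
      by_contra! h
      have := Finset.card_le_card (show τ ⊆ r from h)
      omega
    obtain ⟨δ, hδ, hδ'⟩ := exists_pos_forall_add_smul_mem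
      (hg.isOpen_lt_one.mem_nhds (show y ∈ {y | g y < 1} from hylt)) (y - w)
    obtain ⟨τ', hτ', ε, hε, hεδ, h1, h2⟩ := exists_face_along hK (z := y) (v := y - w) hδ
      (fun ε h0 h1 => by
        have h2 : g (y + ε • (y - w)) < 1 := hδ' ε (by rwa [abs_of_pos h0])
        exact hsp h2.le)
    have hrτ' := subset_of_mem_openHull hr hτ' hy h1
    have hnot : y + ε • (y - w) ∉ convexHull ℝ (τ : Set F) := by
      intro hmem
      -- The point `y` divides the segment from `w` to `y + ε • (y - w)`, with weight `ε / (1 + ε)`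
      -- on `w`. If the far end were in `τ`, then `w` would belong to the carrier of `y`.
      have h3 : ({w} : Finset F) ⊆ r := by
        refine subset_of_mix_mem hτ.1 hr (Finset.singleton_subset_iff.2 hwτ)
          (mem_openHull_singleton w) hmem (θ := ε / (1 + ε)) (by positivity)
          ((div_le_one (by positivity)).2 (by linarith)) ?_
        convert openHull_subset_convexHull r hy using 1
        have : (1 : ℝ) + ε ≠ 0 := by positivity
        have h4 : 1 - ε / (1 + ε) = 1 / (1 + ε) := by field_simp; ring
        rw [h4]
        rw [smul_add, smul_sub, smul_sub, smul_smul, smul_smul]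
        (match_scalars <;> field_simp); ring
      exact hwr (Finset.singleton_subset_iff.1 h3)
    have hnsub : ¬ τ' ⊆ τ := fun h => hnot (convexHull_mono (Finset.coe_subset.2 h) h2)
    have hτ'c : τ'.card = finrank ℝ F + 1 := by
      refine (card_le_of_affineIndependent (K.indep hτ')).antisymm ?_
      rw [← hrc]
      refine Finset.card_lt_card ⟨hrτ', fun h => hnsub (h.trans hrτ)⟩
    have hτ'g := convexHull_subset_of_lt_one hg hL hgL hτ' h1 hylt
    have := huniq τ' ⟨⟨hτ', hτ'g⟩, hτ'c, hrτ'⟩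
    exact hnsub this.le
  · rintro ⟨hrc, hr | rfl⟩
    · refine ⟨hrc, ?_⟩
      have hrn := K.nonempty_of_mem_faces (hL hr)
      obtain ⟨y, hy⟩ := openHull_nonempty hrn
      have hr1 : ∀ z ∈ convexHull ℝ (r : Set F), g z = 1 := fun z hz =>
        (hgL z).2 (mem_body.2 ⟨r, hr, hz⟩)
      have hy1 : g y = 1 := hr1 y (openHull_subset_convexHull r hy)
      have hscale : ∀ ε : ℝ, ε ≤ 1 → g (y - ε • y) = 1 - ε := by
        intro ε hε
        have : y - ε • y = (1 - ε) • y := by module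
        rw [this, hg.hom _ _ (by linarith), hy1, mul_one]
      obtain ⟨τ, hτ, ε, hε, hε1, h1, h2⟩ := exists_face_along hK (z := y) (v := -y) one_pos
        (fun ε h0 h1 => hsp (by
          have := hscale ε h1.le
          rw [smul_neg, ← sub_eq_add_neg]
          simp only [Set.mem_ofPred_eq]
          linarith))
      rw [smul_neg, ← sub_eq_add_neg] at h2
      have hrτ := subset_of_mem_openHull (hL hr) hτ hy h1
      have hgε := hscale ε hε1.le
      have hτc : τ.card = finrank ℝ F + 1 := by
        refine (card_le_of_affineIndependent (K.indep hτ)).antisymm ?_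
        rw [← hrc]
        refine Finset.card_lt_card ⟨hrτ, fun h => ?_⟩
        have := hr1 _ (convexHull_mono (Finset.coe_subset.2 h) h2)
        linarith
      have hτg := convexHull_subset_of_lt_one hg hL hgL hτ h2 (by linarith)
      have hin : ∀ τ, τ ∈ restrict K {y | g y ≤ 1} ∧ τ.card = finrank ℝ F + 1 ∧ r ⊆ τ →
          ∀ᶠ ε in 𝓝[>] (0 : ℝ), y - ε • y ∈ openHull τ := by
        rintro τ ⟨hτ, hτc, hrτ⟩
        refine exists_sub_smul_mem_openHull (K.indep hτ.1) hτc hrτ hrc hy y ?_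
        refine Eventually.frequently ?_
        filter_upwards [self_mem_nhdsWithin] with ε hε hmem
        have h3 := hscale (-ε) (by linarith [Set.mem_Ioi.1 hε])
        rw [neg_smul, sub_neg_eq_add] at h3
        have h4 : g (y + ε • y) ≤ 1 := hτ.2 hmem
        linarith [Set.mem_Ioi.1 hε]
      refine ⟨τ, ⟨⟨hτ, hτg⟩, hτc, hrτ⟩, fun τ' hτ' => ?_⟩
      obtain ⟨ε, ha, hb⟩ := ((hin τ' hτ').and (hin τ ⟨⟨hτ, hτg⟩, hτc, hrτ⟩)).exists
      exact eq_of_mem_openHull hτ'.1.1 hτ ha hb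
    -- The empty facet occurs only in dimension zero, where `{0}` is the only face.
    · refine ⟨hrc, ?_⟩
      rw [Finset.card_empty] at hrc
      have : Subsingleton F := finrank_zero_iff.1 hrc.symm
      have hall : ∀ y : F, g y ≤ 1 := fun y => by
        rw [Subsingleton.elim y 0, hg.map_zero]
        exact zero_le_one
      obtain ⟨s, hs, -⟩ := exists_face_of_mem_space (hsp (hall 0))
      have hone : ∀ t ∈ K.faces, t = {0} := fun t ht => by
        obtain ⟨a, ha⟩ := K.nonempty_of_mem_faces ht
        ext b
        rw [Subsingleton.elim b a, Finset.mem_singleton]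
        exact ⟨fun _ => Subsingleton.elim _ _, fun _ => ha⟩
      refine ⟨s, ⟨⟨hs, fun y _ => hall y⟩, ?_, Finset.empty_subset _⟩, fun t ht => ?_⟩
      · rw [hone s hs, ← hrc]
        rfl
      · rw [hone s hs, hone t ht.1.1]

end GaugeComplex

/-! ### Direct sum decompositions and the parts of a complex. -/

section Coordinates

variable {E F V : Type*} [AddCommGroup E] [Module ℝ E] [AddCommGroup F] [Module ℝ F]
  [AddCommGroup V] [Module ℝ V]

/-- `V` is the direct sum of the images of `i` and `j`, with coordinate projections `a` and `b`. -/
structure IsDirectSum (i : E ↪ V) (j : F ↪ V) (a : V →ₗ[ℝ] E) (b : V →ₗ[ℝ] F) : Prop where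
  fst_inl : ∀ x, a (i x) = x
  fst_inr : ∀ y, a (j y) = 0
  snd_inl : ∀ x, b (i x) = 0
  snd_inr : ∀ y, b (j y) = y
  sum_eq : ∀ v, i (a v) + j (b v) = v

namespace IsDirectSum

variable {i : E ↪ V} {j : F ↪ V} {a : V →ₗ[ℝ] E} {b : V →ₗ[ℝ] F}

lemma symm (h : IsDirectSum i j a b) : IsDirectSum j i b a :=
  ⟨h.snd_inr, h.snd_inl, h.fst_inr, h.fst_inl, fun v => by rw [add_comm, h.sum_eq]⟩

lemma ext (h : IsDirectSum i j a b) {v w : V} (ha : a v = a w) (hb : b v = b w) : v = w := by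
  rw [← h.sum_eq v, ← h.sum_eq w, ha, hb]

/-- The first embedding as a linear map. -/
def inl (h : IsDirectSum i j a b) : E →ₗ[ℝ] V where
  toFun := i
  map_add' x y := h.ext (by simp [h.fst_inl]) (by simp [h.snd_inl])
  map_smul' r x := h.ext (by simp [h.fst_inl]) (by simp [h.snd_inl])

lemma inl_apply (h : IsDirectSum i j a b) (x : E) : h.inl x = i x := rfl

lemma map_zero (h : IsDirectSum i j a b) : i 0 = 0 := h.inl.map_zero

lemma map_smul (h : IsDirectSum i j a b) (r : ℝ) (x : E) : i (r • x) = r • i x :=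
  h.inl.map_smul r x

lemma map_add (h : IsDirectSum i j a b) (x y : E) : i (x + y) = i x + i y := h.inl.map_add x y

lemma eq_zero_of_eq (h : IsDirectSum i j a b) {x : E} {y : F} (hxy : i x = j y) : x = 0 := by
  rw [← h.fst_inl x, hxy, h.fst_inr]

lemma coe_map (h : IsDirectSum i j a b) (s : Finset E) : (s.map i : Set V) = h.inl '' s := by
  rw [Finset.coe_map]
  rfl

lemma convexHull_map (h : IsDirectSum i j a b) (s : Finset E) :
    convexHull ℝ (s.map i : Set V) = i '' convexHull ℝ (s : Set E) := by
  rw [h.coe_map, ← LinearMap.image_convexHull]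
  rfl

lemma mem_convexHull_map (h : IsDirectSum i j a b) {s : Finset E} {x : E} :
    i x ∈ convexHull ℝ (s.map i : Set V) ↔ x ∈ convexHull ℝ (s : Set E) := by
  rw [h.convexHull_map, i.injective.mem_set_image]

lemma mem_openHull_map (h : IsDirectSum i j a b) {s : Finset E} {x : E} (hx : x ∈ openHull s) :
    i x ∈ openHull (s.map i) := by
  obtain ⟨w, h0, h1, rfl⟩ := hx
  refine ⟨fun v => w (a v), ?_, ?_, ?_⟩
  · intro v hv
    obtain ⟨x, hx, rfl⟩ := Finset.mem_map.1 hv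
    simp only [h.fst_inl]
    exact h0 x hx
  · simp [h.fst_inl, h1]
  · rw [← h.inl_apply, map_sum, Finset.sum_map]
    refine Finset.sum_congr rfl fun x _ => ?_
    simp only [h.fst_inl]
    exact (h.map_smul _ _).symm

lemma affineIndependent_of_map (h : IsDirectSum i j a b) {s : Finset E}
    (hs : AffineIndependent ℝ ((↑) : s.map i → V)) : AffineIndependent ℝ ((↑) : s → E) := by
  let e : s ↪ s.map i := ⟨fun x => ⟨i x, Finset.mem_map_of_mem i x.2⟩, fun x y hxy =>
    Subtype.ext (i.injective (congrArg Subtype.val hxy))⟩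
  have := hs.comp_embedding e
  exact AffineIndependent.of_comp h.inl.toAffineMap this

lemma finrank_eq [FiniteDimensional ℝ E] [FiniteDimensional ℝ F] (h : IsDirectSum i j a b) :
    finrank ℝ V = finrank ℝ E + finrank ℝ F := by
  rw [← finrank_prod]
  refine LinearEquiv.finrank_eq (LinearEquiv.ofLinearMap (a.prod b) (h.inl.coprod h.symm.inl) ?_ ?_)
  · ext <;> simp [inl_apply, h.fst_inl, h.fst_inr, h.snd_inl, h.snd_inr]
  · ext v
    simp [inl_apply, h.sum_eq]

lemma mem_part {s : Finset V} {x : E} : x ∈ part i s ↔ i x ∈ s := by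
  simp [part]

lemma part_map_subset (s : Finset V) : (part i s).map i ⊆ s := by
  intro v hv
  obtain ⟨x, hx, rfl⟩ := Finset.mem_map.1 hv
  exact mem_part.1 hx

lemma part_map (s : Finset E) : part i (s.map i) = s := by
  ext x
  simp [mem_part]

lemma subset_part_map {s c : Finset V} (hcs : c ⊆ s) (hc : ∀ v ∈ c, v ∈ Set.range i) :
    c ⊆ (part i s).map i := by
  intro v hv
  obtain ⟨x, rfl⟩ := hc v hv
  exact Finset.mem_map_of_mem i (mem_part.2 (hcs hv))

lemma mem_parts {K : SimplicialComplex ℝ V} {s : Finset E} :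
    s ∈ parts i K ↔ s.map i ∈ K.faces := by
  constructor
  · rintro ⟨hs, r, hr, rfl⟩
    exact K.down_closed hr (part_map_subset r) (hs.map)
  · intro hs
    exact ⟨Finset.map_nonempty.1 (K.nonempty_of_mem_faces hs), _, hs, (part_map s).symm⟩

/-- The subcomplex of `K` in the first summand. -/
def partComplex (h : IsDirectSum i j a b) (K : SimplicialComplex ℝ V) :
    SimplicialComplex ℝ E where
  faces := {s | s.map i ∈ K.faces}
  isRelLowerSet_faces := by
    intro s hs
    refine ⟨Finset.map_nonempty.1 (K.nonempty_of_mem_faces hs), fun t hts ht => ?_⟩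
    exact K.down_closed hs (Finset.map_subset_map.2 hts) ht.map
  indep hs := h.affineIndependent_of_map (K.indep hs)
  inter_subset_convexHull := by
    classical
    rintro s t hs ht x ⟨hxs, hxt⟩
    have := K.inter_subset_convexHull hs ht
      ⟨h.mem_convexHull_map.2 hxs, h.mem_convexHull_map.2 hxt⟩
    rw [← Finset.coe_inter, ← Finset.map_inter, h.mem_convexHull_map] at this
    simpa using this

lemma faces_partComplex (h : IsDirectSum i j a b) (K : SimplicialComplex ℝ V) :
    (h.partComplex K).faces = parts i K := by
  ext s
  exact mem_parts.symm

end IsDirectSum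

end Coordinates

/-! ### Triangulations of a free sum and the carrier of the origin. -/

section Triangulations

open Filter Topology

variable {E F V : Type*} [NormedAddCommGroup E] [NormedSpace ℝ E] [FiniteDimensional ℝ E]
  [NormedAddCommGroup F] [NormedSpace ℝ F] [FiniteDimensional ℝ F]
  [NormedAddCommGroup V] [NormedSpace ℝ V] [FiniteDimensional ℝ V]

/-- `K` is a triangulation of the free sum of `P` and `Q`, realized in `V` by means of the
embeddings `i` and `j`. -/
structure IsFreeSumTriangulation (i : E ↪ V) (j : F ↪ V) (a : V →ₗ[ℝ] E) (b : V →ₗ[ℝ] F)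
    (P : Set E) (Q : Set F) (K : SimplicialComplex ℝ V) : Prop extends IsDirectSum i j a b where
  finite_left : P.Finite
  finite_right : Q.Finite
  zero_left : 0 ∈ P
  zero_right : 0 ∈ Q
  interior_left : 0 ∈ interior (convexHull ℝ P)
  interior_right : 0 ∈ interior (convexHull ℝ Q)
  vertices_subset : ∀ s ∈ K.faces, (s : Set V) ⊆ i '' P ∪ j '' Q
  space_eq : K.space = convexHull ℝ (i '' P ∪ j '' Q)

namespace IsFreeSumTriangulation

variable {i : E ↪ V} {j : F ↪ V} {a : V →ₗ[ℝ] E} {b : V →ₗ[ℝ] F}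
  {P : Set E} {Q : Set F} {K : SimplicialComplex ℝ V}

lemma symm (h : IsFreeSumTriangulation i j a b P Q K) :
    IsFreeSumTriangulation j i b a Q P K where
  toIsDirectSum := h.toIsDirectSum.symm
  finite_left := h.finite_right
  finite_right := h.finite_left
  zero_left := h.zero_right
  zero_right := h.zero_left
  interior_left := h.interior_right
  interior_right := h.interior_left
  vertices_subset := by
    rw [Set.union_comm]
    exact h.vertices_subset
  space_eq := by
    rw [Set.union_comm]
    exact h.space_eq

lemma faces_finite (h : IsFreeSumTriangulation i j a b P Q K) : K.faces.Finite :=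
  faces_finite_of_subset ((h.finite_left.image i).union (h.finite_right.image j))
    h.vertices_subset

lemma mem_range_or (h : IsFreeSumTriangulation i j a b P Q K) {s : Finset V} (hs : s ∈ K.faces)
    {v : V} (hv : v ∈ s) : v ∈ Set.range i ∨ v ∈ Set.range j := by
  rcases h.vertices_subset s hs hv with ⟨x, -, rfl⟩ | ⟨y, -, rfl⟩
  exacts [Or.inl ⟨x, rfl⟩, Or.inr ⟨y, rfl⟩]

lemma mem_left (h : IsFreeSumTriangulation i j a b P Q K) {s : Finset V} (hs : s ∈ K.faces)
    {x : E} (hx : i x ∈ s) : x ∈ P := by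
  rcases h.vertices_subset s hs hx with ⟨x', hx', hxx⟩ | ⟨y, -, hy⟩
  · rwa [← i.injective hxx]
  · rw [h.eq_zero_of_eq hy.symm]
    exact h.zero_left

lemma coe_subset_left (h : IsFreeSumTriangulation i j a b P Q K) {s : Finset E}
    (hs : s.map i ∈ K.faces) : (s : Set E) ⊆ P := fun _ hx =>
  h.mem_left hs (Finset.mem_map_of_mem i hx)

lemma mem_space_left (h : IsFreeSumTriangulation i j a b P Q K) {x : E}
    (hx : x ∈ convexHull ℝ P) : i x ∈ K.space := by
  rw [h.space_eq]
  refine convexHull_mono Set.subset_union_left ?_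
  have : i '' P = h.inl '' P := rfl
  rw [this, ← LinearMap.image_convexHull]
  exact ⟨x, hx, rfl⟩

lemma convex_space (h : IsFreeSumTriangulation i j a b P Q K) : Convex ℝ K.space := by
  rw [h.space_eq]
  exact convex_convexHull ℝ _

lemma mix_mem_space (h : IsFreeSumTriangulation i j a b P Q K) {x : E} {y : F}
    (hx : i x ∈ K.space) (hy : j y ∈ K.space) {p q : ℝ} (hp : 0 ≤ p) (hq : 0 ≤ q)
    (hpq : p + q = 1) : p • i x + q • j y ∈ K.space :=
  h.convex_space hx hy hp hq hpq

lemma zero_mem_interior (h : IsFreeSumTriangulation i j a b P Q K) : 0 ∈ interior K.space := by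
  have hac : Continuous a := a.continuous_of_finiteDimensional
  have hbc : Continuous b := b.continuous_of_finiteDimensional
  -- The factor `2` makes `v` the midpoint of points in the two summands: `v` is half of `2 • a v`
  -- plus half of `2 • b v`.
  refine mem_interior.2 ⟨{v | (2 : ℝ) • a v ∈ interior (convexHull ℝ P)} ∩
    {v | (2 : ℝ) • b v ∈ interior (convexHull ℝ Q)}, ?_,
    (isOpen_interior.preimage (hac.const_smul 2)).inter
      (isOpen_interior.preimage (hbc.const_smul 2)), ?_⟩
  · rintro v ⟨hv1, hv2⟩
    have h1 := h.mem_space_left (interior_subset hv1)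
    have h2 := h.symm.mem_space_left (interior_subset hv2)
    have := h.mix_mem_space h1 h2 (p := 1 / 2) (q := 1 / 2) (by norm_num) (by norm_num)
      (by norm_num)
    rw [h.map_smul, h.symm.map_smul, smul_smul, smul_smul] at this
    norm_num at this
    rwa [h.sum_eq] at this
  · simpa using ⟨h.interior_left, h.interior_right⟩

/-- From an interior point of the first summand one can move a little in every direction of the
second one. -/
lemma exists_forall_add_smul_mem_space (h : IsFreeSumTriangulation i j a b P Q K) {x : E}
    (hx : x ∈ interior (convexHull ℝ P)) (v : F) :
    ∃ δ > (0 : ℝ), ∀ ε, 0 < ε → ε < δ → i x + ε • j v ∈ K.space := by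
  obtain ⟨η, hη, hη'⟩ := exists_pos_forall_add_smul_mem (isOpen_interior.mem_nhds hx) x
  obtain ⟨δ, hδ, hδ'⟩ := exists_pos_forall_add_smul_mem
    (isOpen_interior.mem_nhds h.interior_right) v
  obtain ⟨ζ, hζ, hζη⟩ := exists_between hη
  have h1 := h.mem_space_left (interior_subset (hη' ζ (by rwa [abs_of_pos hζ])))
  have hζ1 : 0 < 1 + ζ := by linarith
  -- The target is a convex combination of `(1 + ζ) • x` with weight `1 / (1 + ζ)` and of a multiple
  -- of `v` with weight `ζ / (1 + ζ)`. The bound on `ε` keeps that multiple in `conv Q`.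
  refine ⟨δ * (ζ / (1 + ζ)), by positivity, fun ε hε hεδ => ?_⟩
  have hθ : 0 < ζ / (1 + ζ) := by positivity
  have h2 := h.symm.mem_space_left (interior_subset (hδ' (ε / (ζ / (1 + ζ)))
    (by rw [abs_of_pos (by positivity), div_lt_iff₀ hθ]; exact hεδ)))
  have := h.mix_mem_space h1 h2 (p := 1 / (1 + ζ)) (q := ζ / (1 + ζ)) (by positivity)
    (by positivity) (by field_simp)
  convert this using 1
  rw [zero_add, h.symm.map_smul, h.map_add, h.map_smul]
  match_scalars <;> field_simp

/-- A face containing a point of the second summand contains it in its second part, unless it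
contains the carrier of the origin, and this carrier avoids the second summand. -/
lemma mem_convexHull_part_or (h : IsFreeSumTriangulation i j a b P Q K) {c r : Finset V}
    (hc : c ∈ K.faces) (h0 : 0 ∈ openHull c) (hr : r ∈ K.faces) {y : F}
    (hy : j y ∈ convexHull ℝ (r : Set V)) :
    y ∈ convexHull ℝ (part j r : Set F) ∨ (c ⊆ r ∧ ∀ v ∈ c, v ∉ Set.range j) := by
  classical
  obtain ⟨r1, hr1, hr1n, w, hw0, hw1, hw2⟩ := exists_mem_openHull hy
  by_cases hall : ∀ v ∈ r1, v ∈ Set.range j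
  · left
    rw [← h.symm.mem_convexHull_map]
    refine convexHull_mono (Finset.coe_subset.2 (IsDirectSum.subset_part_map hr1 hall)) ?_
    exact openHull_subset_convexHull r1 ⟨w, hw0, hw1, hw2⟩
  · right
    push Not at hall
    obtain ⟨v0, hv0, hv0'⟩ := hall
    -- The weighted sum of the vertices outside the second summand vanishes under both projections.
    -- Normalizing the weights puts `0` in the relative interior of `r2`, so `r2` is the carrier.
    set r2 := r1.filter fun v => v ∉ Set.range j with hr2
    have hr2n : r2.Nonempty := ⟨v0, Finset.mem_filter.2 ⟨hv0, hv0'⟩⟩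
    have hr2r : r2 ⊆ r := (Finset.filter_subset _ _).trans hr1
    have hr2K : r2 ∈ K.faces := K.down_closed hr hr2r hr2n
    have hpos : ∀ v ∈ r2, 0 < w v := fun v hv => hw0 v (Finset.mem_filter.1 hv).1
    have hM : 0 < ∑ v ∈ r2, w v := Finset.sum_pos hpos hr2n
    have hsum : ∑ v ∈ r2, w v • v = 0 := by
      refine h.ext ?_ ?_
      · have h1 : a (∑ v ∈ r1, w v • v) = 0 := by rw [hw2, h.fst_inr]
        rw [map_sum] at h1 ⊢
        rw [_root_.map_zero, ← h1]
        refine Finset.sum_subset (Finset.filter_subset _ _) fun v hv hv' => ?_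
        have : v ∈ Set.range j := by
          by_contra hvj
          exact hv' (Finset.mem_filter.2 ⟨hv, hvj⟩)
        obtain ⟨y, rfl⟩ := this
        rw [_root_.map_smul, h.fst_inr, smul_zero]
      · rw [map_sum, _root_.map_zero]
        refine Finset.sum_eq_zero fun v hv => ?_
        rcases h.mem_range_or hr2K hv with ⟨x, rfl⟩ | hvj
        · rw [_root_.map_smul, h.snd_inl, smul_zero]
        · exact absurd hvj (Finset.mem_filter.1 hv).2
    have h02 : (0 : V) ∈ openHull r2 := by
      refine ⟨fun v => (∑ v ∈ r2, w v)⁻¹ * w v, fun v hv => mul_pos (inv_pos.2 hM) (hpos v hv),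
        ?_, ?_⟩
      · rw [← Finset.mul_sum, inv_mul_cancel₀ hM.ne']
      · simp only [mul_smul]
        rw [← Finset.smul_sum, hsum, smul_zero]
    obtain rfl := eq_of_mem_openHull hc hr2K h0 h02
    exact ⟨hr2r, fun v hv => (Finset.mem_filter.1 hv).2⟩

/-- This is the dichotomy for faces meeting the second summand, taken at the point `0` and the face
`c` itself. -/
lemma carrier_subset_range_or (h : IsFreeSumTriangulation i j a b P Q K) {c : Finset V}
    (hc : c ∈ K.faces) (h0 : 0 ∈ openHull c) :
    (∀ v ∈ c, v ∈ Set.range i) ∨ (∀ v ∈ c, v ∈ Set.range j) := by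
  rcases h.mem_convexHull_part_or hc h0 hc (y := 0)
    (by rw [h.symm.map_zero]; exact openHull_subset_convexHull c h0) with hy | ⟨-, hy⟩
  · right
    rw [← h.symm.mem_convexHull_map, h.symm.map_zero] at hy
    have hf : (part j c).map j ∈ K.faces := by
      refine K.down_closed hc (IsDirectSum.part_map_subset c) ?_
      simpa using convexHull_nonempty_iff.1 ⟨_, hy⟩
    intro v hv
    obtain ⟨y, -, rfl⟩ := Finset.mem_map.1 (subset_of_mem_openHull hc hf h0 hy hv)
    exact ⟨y, rfl⟩
  · left
    intro v hv
    exact (h.mem_range_or hc hv).resolve_right (hy v hv)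

/-- A full-dimensional face around `0` contains the carrier, so the condition on all such faces is a
condition on `c` alone. The forward direction needs one such face, which exists because `0` is
interior. -/
lemma originInPart_iff (h : IsFreeSumTriangulation i j a b P Q K) {c : Finset V}
    (hc : c ∈ K.faces) (h0 : 0 ∈ openHull c) :
    OriginInPart i K ↔ ∀ v ∈ c, v ∈ Set.range i := by
  constructor
  · intro ho
    obtain ⟨r, hr, hcr⟩ := exists_topFace_of_mem_interior h.faces_finite hc
      (openHull_subset_convexHull c h0) h.zero_mem_interior
    have h1 := ho r hr (convexHull_mono (Finset.coe_subset.2 hcr)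
      (openHull_subset_convexHull c h0))
    rw [← h.mem_convexHull_map, h.map_zero] at h1
    have hf : (part i r).map i ∈ K.faces := by
      refine K.down_closed hr.1 (IsDirectSum.part_map_subset r) ?_
      simpa using convexHull_nonempty_iff.1 ⟨_, h1⟩
    intro v hv
    obtain ⟨y, -, rfl⟩ := Finset.mem_map.1 (subset_of_mem_openHull hc hf h0 h1 hv)
    exact ⟨y, rfl⟩
  · intro hci s hs h0s
    have hcs := subset_of_mem_openHull hc hs.1 h0 h0s
    rw [← h.mem_convexHull_map, h.map_zero]
    exact convexHull_mono (Finset.coe_subset.2 (IsDirectSum.subset_part_map hcs hci))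
      (openHull_subset_convexHull c h0)

lemma exists_carrier (h : IsFreeSumTriangulation i j a b P Q K) :
    ∃ c ∈ K.faces, (0 : V) ∈ openHull c :=
  exists_face_of_mem_space (interior_subset h.zero_mem_interior)

/-- A face meeting the first summand outside its own part would force `c` to avoid that summand,
whereas `c` lies in it. -/
lemma isTriangulation_partComplex (h : IsFreeSumTriangulation i j a b P Q K) {c : Finset V}
    (hc : c ∈ K.faces) (h0 : 0 ∈ openHull c) (hci : ∀ v ∈ c, v ∈ Set.range i) :
    IsTriangulation P (h.partComplex K) := by
  refine ⟨fun s hs => h.coe_subset_left hs, Set.Subset.antisymm ?_ ?_⟩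
  · intro x hx
    obtain ⟨s, hs, hxs⟩ := SimplicialComplex.mem_space_iff.1 hx
    exact convexHull_mono (h.coe_subset_left hs) hxs
  · intro x hx
    obtain ⟨r, hr, hxr⟩ := SimplicialComplex.mem_space_iff.1 (h.mem_space_left hx)
    rcases h.symm.mem_convexHull_part_or hc h0 hr hxr with h1 | ⟨-, h1⟩
    · refine SimplicialComplex.mem_space_iff.2 ⟨part i r, ?_, h1⟩
      refine K.down_closed hr (IsDirectSum.part_map_subset r) ?_
      simpa using convexHull_nonempty_iff.1 ⟨_, h1⟩
    · obtain ⟨v, hv⟩ := K.nonempty_of_mem_faces hc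
      exact absurd (hci v hv) (h1 v hv)

/-- The summands share only the origin, so a common vertex is `0`, and then `{0}` is itself the
carrier. -/
lemma carrier_eq_singleton (h : IsFreeSumTriangulation i j a b P Q K) {c : Finset V}
    (hc : c ∈ K.faces) (h0 : 0 ∈ openHull c) (hci : ∀ v ∈ c, v ∈ Set.range i)
    (hcj : ∃ v ∈ c, v ∈ Set.range j) : {0} ∈ K.faces ∧ c = {0} := by
  obtain ⟨v, hv, y, rfl⟩ := hcj
  obtain ⟨x, hx⟩ := hci _ hv
  have h1 : j y = 0 := by rw [h.symm.eq_zero_of_eq hx.symm, h.symm.map_zero]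
  rw [h1] at hv
  have h2 : {0} ∈ K.faces := K.down_closed hc (Finset.singleton_subset_iff.2 hv) (by simp)
  exact ⟨h2, eq_of_mem_openHull hc h2 h0 (mem_openHull_singleton 0)⟩

end IsFreeSumTriangulation

end Triangulations

/-! ### Links of full-dimensional simplices as unit spheres of gauges. -/

section Links

open Filter Topology

variable {E F V : Type*} [NormedAddCommGroup E] [NormedSpace ℝ E] [FiniteDimensional ℝ E]
  [NormedAddCommGroup F] [NormedSpace ℝ F] [FiniteDimensional ℝ F]
  [NormedAddCommGroup V] [NormedSpace ℝ V] [FiniteDimensional ℝ V]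
  {i : E ↪ V} {j : F ↪ V} {a : V →ₗ[ℝ] E} {b : V →ₗ[ℝ] F}
  {P : Set E} {Q : Set F} {K : SimplicialComplex ℝ V}

/-- Segments joining points on two coordinate axes cross if their end points are in opposite order
on the two axes. -/
lemma exists_crossing {p q : ℝ} (hp : 0 < p) (hq : 0 < q)
    (hpq : (1 < p ∧ 1 < q) ∨ (p < 1 ∧ q < 1)) :
    ∃ θ η : ℝ, 0 < θ ∧ θ < 1 ∧ 0 < η ∧ η < 1 ∧ θ = η * q ∧ (1 - θ) * p = 1 - η := by
  rcases hpq with ⟨hp1, hq1⟩ | ⟨hp1, hq1⟩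
  · have h1 : 0 < p * q - 1 := by nlinarith
    -- Eliminating `θ` from the two linear equations gives `η = (p - 1) / (p * q - 1)`; the other
    -- case has both signs changed.
    refine ⟨(p - 1) / (p * q - 1) * q, (p - 1) / (p * q - 1), ?_, ?_, ?_, ?_, rfl, ?_⟩
    · exact mul_pos (div_pos (by linarith) h1) hq
    · rw [div_mul_eq_mul_div, div_lt_one h1]
      nlinarith
    · exact div_pos (by linarith) h1
    · rw [div_lt_one h1]
      nlinarith
    · field_simp
      ring
  · have h1 : 0 < 1 - p * q := by nlinarith
    refine ⟨(1 - p) / (1 - p * q) * q, (1 - p) / (1 - p * q), ?_, ?_, ?_, ?_, rfl, ?_⟩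
    · exact mul_pos (div_pos (by linarith) h1) hq
    · rw [div_mul_eq_mul_div, div_lt_one h1]
      nlinarith
    · exact div_pos (by linarith) h1
    · rw [div_lt_one h1]
      nlinarith
    · field_simp
      ring

/-- The link of `s`, as far as it lies in the summand included by `j`. -/
def linkIn (j : F ↪ V) (K : SimplicialComplex ℝ V) (s : Finset V) : Set (Finset F) :=
  {t | t.map j ∈ link K s}

lemma mem_linkIn [DecidableEq V] {s : Finset V} {t : Finset F} :
    t ∈ linkIn j K s ↔ t.Nonempty ∧ Disjoint (t.map j) s ∧ s ∪ t.map j ∈ K.faces := by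
  constructor
  · rintro ⟨h1, h2, r, hr, hsr, htr⟩
    exact ⟨Finset.map_nonempty.1 h1, h2, K.down_closed hr (Finset.union_subset hsr htr)
      (h1.mono Finset.subset_union_right)⟩
  · rintro ⟨h1, h2, h3⟩
    exact ⟨h1.map, h2, _, h3, Finset.subset_union_left, Finset.subset_union_right⟩

lemma linkIn_subset_parts (s : Finset V) : linkIn j K s ⊆ parts j K := by
  rintro t ⟨h1, -, r, hr, -, htr⟩
  exact IsDirectSum.mem_parts.2 (K.down_closed hr htr h1)

namespace IsDirectSum

/-- Disjoint vertex sets of one affinely independent simplex have disjoint affine spans, so at most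
one of the two spans contains `0`. -/
lemma zero_notMem_affineSpan [DecidableEq V] (h : IsDirectSum i j a b) {s : Finset V}
    {t : Finset F} (hst : s ∪ t.map j ∈ K.faces) (hd : Disjoint (t.map j) s)
    (h0 : (0 : V) ∈ affineSpan ℝ (s : Set V)) : (0 : F) ∉ affineSpan ℝ (t : Set F) := by
  intro h1
  have h2 : h.symm.inl.toAffineMap 0 ∈ (affineSpan ℝ (t : Set F)).map h.symm.inl.toAffineMap :=
    AffineSubspace.mem_map_of_mem _ h1
  rw [AffineSubspace.map_span] at h2
  have h3 : (0 : V) ∈ affineSpan ℝ (t.map j : Set V) := by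
    rw [h.symm.coe_map]
    simpa using h2
  have key := (K.indep hst).affineSpan_disjoint_of_disjoint
    (s1 := {v | (v : V) ∈ s}) (s2 := {v | (v : V) ∈ t.map j})
    (Set.disjoint_left.2 fun v hv1 hv2 => Finset.disjoint_left.1 hd hv2 hv1)
  have e1 : (Subtype.val : (s ∪ t.map j : Finset V) → V) '' {v | (v : V) ∈ s} = s := by
    ext v
    simp only [Set.mem_image, Set.mem_ofPred_eq, Subtype.exists, Finset.mem_coe]
    exact ⟨by rintro ⟨v', -, hv, rfl⟩; exact hv,
      fun hv => ⟨v, Finset.mem_union_left _ hv, hv, rfl⟩⟩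
  have e2 : (Subtype.val : (s ∪ t.map j : Finset V) → V) '' {v | (v : V) ∈ t.map j}
      = (t.map j : Finset V) := by
    ext v
    simp only [Set.mem_image, Set.mem_ofPred_eq, Subtype.exists, Finset.mem_coe]
    exact ⟨by rintro ⟨v', -, hv, rfl⟩; exact hv,
      fun hv => ⟨v, Finset.mem_union_right _ hv, hv, rfl⟩⟩
  rw [e1, e2] at key
  exact Set.disjoint_left.1 key h0 h3

lemma mem_of_mem_face (h : IsDirectSum i j a b) {s : Finset E} (hsc : s.card = finrank ℝ E + 1)
    {r : Finset V} (hr : r ∈ K.faces) (hsr : s.map i ⊆ r) {x : E} (hx : i x ∈ r) : x ∈ s := by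
  classical
  by_contra hxs
  have h1 : (insert x s).map i ∈ K.faces := by
    refine K.down_closed hr ?_ (by simp)
    rw [Finset.map_insert]
    exact Finset.insert_subset hx hsr
  have h2 := card_le_of_affineIndependent (h.affineIndependent_of_map (K.indep h1))
  rw [Finset.card_insert_of_notMem hxs] at h2
  omega

lemma zero_mem_affineSpan_map (h : IsDirectSum i j a b) {s : Finset E}
    (hsc : s.card = finrank ℝ E + 1) (hs : s.map i ∈ K.faces) :
    (0 : V) ∈ affineSpan ℝ (s.map i : Set V) := by
  have h1 : (0 : E) ∈ affineSpan ℝ (s : Set E) := by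
    rw [affineSpan_eq_top_of_card (h.affineIndependent_of_map (K.indep hs)) hsc]
    exact AffineSubspace.mem_top _ _ _
  have h2 : h.inl.toAffineMap 0 ∈ (affineSpan ℝ (s : Set E)).map h.inl.toAffineMap :=
    AffineSubspace.mem_map_of_mem _ h1
  rw [AffineSubspace.map_span] at h2
  rw [h.coe_map]
  simpa using h2

lemma zero_notMem_affineSpan_of_mem_linkIn (h : IsDirectSum i j a b) {s : Finset E}
    (hsc : s.card = finrank ℝ E + 1) (hs : s.map i ∈ K.faces) {t : Finset F}
    (ht : t ∈ linkIn j K (s.map i)) : (0 : F) ∉ affineSpan ℝ (t : Set F) := by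
  classical
  obtain ⟨-, h2, h3⟩ := mem_linkIn.1 ht
  exact h.zero_notMem_affineSpan h3 h2 (h.zero_mem_affineSpan_map hsc hs)

lemma zero_notMem_of_mem_linkIn (h : IsDirectSum i j a b) {s : Finset E}
    (hsc : s.card = finrank ℝ E + 1) (hs : s.map i ∈ K.faces) {t : Finset F}
    (ht : t ∈ linkIn j K (s.map i)) : (0 : F) ∉ t := fun h0 =>
  h.zero_notMem_affineSpan_of_mem_linkIn hsc hs ht (subset_affineSpan ℝ _ h0)

lemma card_le_of_mem_linkIn (h : IsDirectSum i j a b) {s : Finset E}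
    (hsc : s.card = finrank ℝ E + 1) {t : Finset F}
    (ht : t ∈ linkIn j K (s.map i)) : t.card ≤ finrank ℝ F := by
  classical
  obtain ⟨-, h2, h3⟩ := mem_linkIn.1 ht
  have h4 := card_le_of_affineIndependent (K.indep h3)
  rw [Finset.card_union_of_disjoint h2.symm, Finset.card_map, Finset.card_map, h.finrank_eq] at h4
  omega

end IsDirectSum

namespace IsFreeSumTriangulation

/-- A face containing `s` has no further vertex in the first summand, since `s` is already
full-dimensional there. So every link simplex comes from the second summand. -/
lemma body_link (h : IsFreeSumTriangulation i j a b P Q K) {s : Finset E}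
    (hsc : s.card = finrank ℝ E + 1) :
    body (link K (s.map i)) = j '' body (linkIn j K (s.map i)) := by
  ext z
  constructor
  · intro hz
    simp only [body, Set.mem_iUnion] at hz
    obtain ⟨t, ht, hzt⟩ := hz
    obtain ⟨htn, htd, r, hr, hsr, htr⟩ := ht
    have hrange : ∀ v ∈ t, v ∈ Set.range j := by
      intro v hv
      refine (h.mem_range_or hr (htr hv)).resolve_left ?_
      rintro ⟨x, rfl⟩
      exact Finset.disjoint_left.1 htd hv
        (Finset.mem_map_of_mem i (h.mem_of_mem_face hsc hr hsr (htr hv)))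
    have e : (part j t).map j = t :=
      (IsDirectSum.part_map_subset t).antisymm
        (IsDirectSum.subset_part_map (Finset.Subset.refl t) hrange)
    rw [← e, h.symm.convexHull_map] at hzt
    obtain ⟨y, hy, rfl⟩ := hzt
    refine ⟨y, mem_body.2 ⟨part j t, ?_, hy⟩, rfl⟩
    change (part j t).map j ∈ link K _
    rw [e]
    exact ⟨htn, htd, r, hr, hsr, htr⟩
  · rintro ⟨y, hy, rfl⟩
    obtain ⟨t, ht, hyt⟩ := mem_body.1 hy
    simp only [body, Set.mem_iUnion]
    exact ⟨t.map j, ht, h.symm.mem_convexHull_map.2 hyt⟩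

lemma preimage_linkCone (h : IsFreeSumTriangulation i j a b P Q K) {s : Finset E}
    (hsc : s.card = finrank ℝ E + 1) {g : F → ℝ} (hg : IsGauge g)
    (hgL : ∀ y, g y = 1 ↔ y ∈ body (linkIn j K (s.map i))) :
    j ⁻¹' linkCone K (s.map i) = {y | g y ≤ 1} := by
  ext y
  simp only [linkCone, h.body_link hsc, Set.mem_preimage, Set.mem_union, Set.mem_singleton_iff,
    Set.mem_ofPred_eq]
  constructor
  · rintro (h0 | ⟨c, hc0, hc1, _, ⟨x, hx, rfl⟩, hy⟩)
    · have : y = 0 := j.injective (h0.trans h.symm.map_zero.symm)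
      rw [this, hg.map_zero]
      exact zero_le_one
    · rw [← h.symm.map_smul] at hy
      rw [j.injective hy, hg.hom _ _ hc0, (hgL x).2 hx, mul_one]
      exact hc1
  · intro hy
    rcases eq_or_ne y 0 with rfl | hy0
    · exact Or.inl h.symm.map_zero
    · have hgy := hg.pos y hy0
      refine Or.inr ⟨g y, hgy.le, hy, _, ⟨(g y)⁻¹ • y, (hgL _).1 ?_, rfl⟩, ?_⟩
      · rw [hg.hom _ _ (inv_nonneg.2 hgy.le), inv_mul_cancel₀ hgy.ne']
      · rw [← h.symm.map_smul, smul_smul, mul_inv_cancel₀ hgy.ne', one_smul]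

lemma openHull_subset_interior (h : IsFreeSumTriangulation i j a b P Q K) {s : Finset E}
    (hsc : s.card = finrank ℝ E + 1) (hs : s.map i ∈ K.faces) :
    openHull s ⊆ interior (convexHull ℝ P) :=
  interior_maximal ((openHull_subset_convexHull s).trans (convexHull_mono (h.coe_subset_left hs)))
    (isOpen_openHull (h.affineIndependent_of_map (K.indep hs)) hsc)

/-- Leaving a relative interior point of `s` in direction `v` enters a face `r` containing `s`.
Projecting to the second summand collapses `s` to `0`, so a positive multiple of `v` lies in the
cone over the rest of `r`. -/
lemma exists_eq_smul_of_mem_linkIn (h : IsFreeSumTriangulation i j a b P Q K) {s : Finset E}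
    (hsc : s.card = finrank ℝ E + 1) (hs : s.map i ∈ K.faces) {v : F} (hv : v ≠ 0) :
    ∃ u > (0 : ℝ), ∃ x ∈ body (linkIn j K (s.map i)), v = u • x := by
  classical
  obtain ⟨x, hx⟩ := openHull_nonempty (Finset.map_nonempty.1 (K.nonempty_of_mem_faces hs))
  obtain ⟨δ, hδ, hδ'⟩ := h.exists_forall_add_smul_mem_space (h.openHull_subset_interior hsc hs hx) v
  obtain ⟨r, hr, ε, hε, -, h1, h2⟩ := exists_face_along h.faces_finite hδ hδ'
  have hsr := subset_of_mem_openHull hs hr (h.mem_openHull_map hx) h1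
  set t := part j (r \ s.map i) with htdef
  have hb : ε • v ∈ convexHull ℝ (insert (0 : F) (t : Set F)) := by
    have h3 : b (i x + ε • j v) ∈ b '' convexHull ℝ (r : Set V) := ⟨_, h2, rfl⟩
    rw [LinearMap.image_convexHull, map_add, map_smul, h.snd_inl, h.snd_inr, zero_add] at h3
    refine convexHull_mono ?_ h3
    rintro _ ⟨w, hw, rfl⟩
    by_cases hws : w ∈ s.map i
    · obtain ⟨x, -, rfl⟩ := Finset.mem_map.1 hws
      exact Or.inl (h.snd_inl x)
    · rcases h.mem_range_or hr hw with ⟨x, rfl⟩ | ⟨y, rfl⟩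
      · exact Or.inl (h.snd_inl x)
      · right
        rw [h.snd_inr]
        exact IsDirectSum.mem_part.2 (Finset.mem_sdiff.2 ⟨hw, hws⟩)
  have hεv : ε • v ≠ 0 := smul_ne_zero hε.ne' hv
  have htn : t.Nonempty := by
    rw [Finset.nonempty_iff_ne_empty]
    intro he
    rw [he] at hb
    simp [hεv] at hb
  rw [convexHull_insert (by simpa using htn), mem_convexJoin] at hb
  obtain ⟨_, rfl, y, hy, p, q, -, hq, -, hpq⟩ := hb
  rw [smul_zero, zero_add] at hpq
  have hq0 : q ≠ 0 := by
    rintro rfl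
    rw [zero_smul] at hpq
    exact hεv hpq.symm
  refine ⟨q / ε, div_pos (lt_of_le_of_ne hq hq0.symm) hε, y, mem_body.2 ⟨t, ?_, hy⟩, ?_⟩
  · have htr : t.map j ⊆ r \ s.map i := IsDirectSum.part_map_subset _
    exact ⟨htn.map, Finset.disjoint_left.2 fun z hz => (Finset.mem_sdiff.1 (htr hz)).2,
      r, hr, hsr, htr.trans Finset.sdiff_subset⟩
  · rw [div_eq_inv_mul, mul_smul, hpq, smul_smul, inv_mul_cancel₀ hε.ne', one_smul]

/-- The segment from an interior point `z` of `s` to `p • x` crosses the one from `(1 + ζ) • z`,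
still in `s`, to `x`. Hence the carrier of `x` lies in the simplex `t'` of `p • x`, and the line
through both points puts `0` in the affine span of `t'`. -/
lemma not_smul_mem_of_one_lt (h : IsFreeSumTriangulation i j a b P Q K) {s : Finset E}
    (hsc : s.card = finrank ℝ E + 1) (hs : s.map i ∈ K.faces) {x : F}
    (hx : x ∈ body (linkIn j K (s.map i))) {p : ℝ} (hp : 1 < p)
    (hpx : p • x ∈ body (linkIn j K (s.map i))) : False := by
  classical
  obtain ⟨t, ht, hxt⟩ := mem_body.1 hx
  obtain ⟨t', ht', hxt'⟩ := mem_body.1 hpx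
  obtain ⟨t1, ht1, ht1n, hxt1⟩ := exists_mem_openHull hxt
  obtain ⟨z, hz⟩ := openHull_nonempty (Finset.map_nonempty.1 (K.nonempty_of_mem_faces hs))
  obtain ⟨η, hη, hη'⟩ := exists_pos_forall_add_smul_mem
    ((isOpen_openHull (h.affineIndependent_of_map (K.indep hs)) hsc).mem_nhds hz) z
  obtain ⟨ζ, hζ, hζη⟩ := exists_between hη
  have hz' := hη' ζ (by rwa [abs_of_pos hζ])
  obtain ⟨-, htd, htK⟩ := mem_linkIn.1 ht
  obtain ⟨-, htd', htK'⟩ := mem_linkIn.1 ht'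
  obtain ⟨θ, κ, hθ0, hθ1, hκ0, hκ1, e1, e2⟩ :=
    exists_crossing (p := p) (q := 1 + ζ) (by linarith) (by linarith) (Or.inl ⟨hp, by linarith⟩)
  have hsub : t1.map j ⊆ s.map i ∪ t'.map j := by
    refine subset_of_mix_mem htK htK'
      ((Finset.map_subset_map.2 ht1).trans Finset.subset_union_right) (h.symm.mem_openHull_map hxt1)
      (y := i (z + ζ • z)) (θ := 1 - κ) ?_ (by linarith) (by linarith) ?_
    · exact convexHull_mono (Finset.coe_subset.2 Finset.subset_union_left)
        (h.mem_convexHull_map.2 (openHull_subset_convexHull s hz'))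
    · have m1 : i z ∈ convexHull ℝ ((s.map i ∪ t'.map j : Finset V) : Set V) :=
        convexHull_mono (Finset.coe_subset.2 Finset.subset_union_left)
          (h.mem_convexHull_map.2 (openHull_subset_convexHull s hz))
      have m2 : j (p • x) ∈ convexHull ℝ ((s.map i ∪ t'.map j : Finset V) : Set V) :=
        convexHull_mono (Finset.coe_subset.2 Finset.subset_union_right)
          (h.symm.mem_convexHull_map.2 hxt')
      have m3 := convex_convexHull ℝ ((s.map i ∪ t'.map j : Finset V) : Set V) m1 m2
        hθ0.le (sub_nonneg.2 hθ1.le) (by ring)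
      convert m3 using 1
      rw [h.symm.map_smul, h.map_add, h.map_smul, smul_smul, e2, e1]
      module
  have ht1' : t1 ⊆ t' := by
    intro y hy
    have hy' := Finset.mem_map_of_mem j hy
    rcases Finset.mem_union.1 (hsub hy') with hy2 | hy2
    · exact absurd hy2 (Finset.disjoint_left.1 htd (Finset.map_subset_map.2 ht1 hy'))
    · simpa using hy2
  have n1 := convexHull_subset_affineSpan (𝕜 := ℝ) _ (convexHull_mono (Finset.coe_subset.2 ht1')
    (openHull_subset_convexHull t1 hxt1))
  have n2 := convexHull_subset_affineSpan (𝕜 := ℝ) _ hxt'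
  refine h.zero_notMem_affineSpan_of_mem_linkIn hsc hs ht' ?_
  -- The parameter `p / (p - 1)` is where the line from `p • x` through `x` reaches the origin.
  have n3 := AffineMap.lineMap_mem (k := ℝ) (p / (p - 1)) n2 n1
  rw [AffineMap.lineMap_apply] at n3
  convert n3 using 1
  have : p - 1 ≠ 0 := by linarith
  simp only [vsub_eq_sub, vadd_eq_add, smul_sub, smul_smul]
  match_scalars
  field_simp
  ring

lemma linkIn_finite (h : IsFreeSumTriangulation i j a b P Q K) (s : Finset V) :
    (linkIn j K s).Finite := by
  refine Set.Finite.subset ?_ (linkIn_subset_parts s)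
  rw [← h.symm.faces_partComplex]
  exact faces_finite_of_subset h.finite_right fun t ht => h.symm.coe_subset_left ht

/-- The link of a full-dimensional simplex of one summand is the unit sphere of a gauge on the other
summand, and the cone over the link is its unit ball. -/
lemma exists_isGauge_linkCone (h : IsFreeSumTriangulation i j a b P Q K) {s : Finset E}
    (hsc : s.card = finrank ℝ E + 1) (hs : s.map i ∈ K.faces) :
    ∃ g : F → ℝ, IsGauge g ∧ (∀ y, g y = 1 ↔ y ∈ body (linkIn j K (s.map i))) ∧
      j ⁻¹' linkCone K (s.map i) = {y | g y ≤ 1} ∧ {y | g y ≤ 1} ⊆ convexHull ℝ Q := by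
  have hinj1 := fun x hx p hp hpx => h.not_smul_mem_of_one_lt hsc hs (x := x) hx (p := p) hp hpx
  have hcomp : IsCompact (body (linkIn j K (s.map i))) :=
    (h.linkIn_finite _).isCompact_biUnion fun t _ => t.finite_toSet.isCompact_convexHull ℝ
  have hzero : (0 : F) ∉ body (linkIn j K (s.map i)) := by
    intro h0
    obtain ⟨t, ht, h0t⟩ := mem_body.1 h0
    exact h.zero_notMem_affineSpan_of_mem_linkIn hsc hs ht
      (convexHull_subset_affineSpan (𝕜 := ℝ) _ h0t)
  have hinj : ∀ x ∈ body (linkIn j K (s.map i)), ∀ p > (0 : ℝ),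
      p • x ∈ body (linkIn j K (s.map i)) → p = 1 := by
    intro x hx p hp hpx
    rcases lt_trichotomy p 1 with hp1 | hp1 | hp1
    · exfalso
      refine hinj1 (p • x) hpx p⁻¹ ((one_lt_inv₀ hp).2 hp1) ?_
      rwa [smul_smul, inv_mul_cancel₀ hp.ne', one_smul]
    · exact hp1
    · exact (hinj1 x hx p hp1 hpx).elim
  obtain ⟨g, hg, hgL⟩ := exists_isGauge hcomp
    (fun v hv => h.exists_eq_smul_of_mem_linkIn hsc hs hv) hzero hinj
  refine ⟨g, hg, hgL, h.preimage_linkCone hsc hg hgL, ?_⟩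
  intro y hy
  have h0 := subset_convexHull ℝ Q h.zero_right
  rcases eq_or_ne y 0 with rfl | hy0
  · exact h0
  · have hgy := hg.pos y hy0
    have h1 : (g y)⁻¹ • y ∈ body (linkIn j K (s.map i)) := (hgL _).1 (by
      rw [hg.hom _ _ (inv_nonneg.2 hgy.le), inv_mul_cancel₀ hgy.ne'])
    obtain ⟨t, ht, hyt⟩ := mem_body.1 h1
    have h2 := convexHull_mono (h.symm.coe_subset_left
      (IsDirectSum.mem_parts.1 (linkIn_subset_parts _ ht))) hyt
    have h3 := (convex_convexHull ℝ Q).smul_mem_of_zero_mem h0 h2 ⟨hgy.le, hy⟩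
    rwa [smul_smul, mul_inv_cancel₀ hgy.ne', one_smul] at h3

end IsFreeSumTriangulation

end Links

/-! ### Filling the second summand by a cone from the origin. -/

section ConeComplex

variable {E F V : Type*} [NormedAddCommGroup E] [NormedSpace ℝ E] [FiniteDimensional ℝ E]
  [NormedAddCommGroup F] [NormedSpace ℝ F] [FiniteDimensional ℝ F]
  [NormedAddCommGroup V] [NormedSpace ℝ V] [FiniteDimensional ℝ V]
  {i : E ↪ V} {j : F ↪ V} {a : V →ₗ[ℝ] E} {b : V →ₗ[ℝ] F}
  {P : Set E} {Q : Set F} {K : SimplicialComplex ℝ V} {c : Finset V}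

open Classical in
/-- The simplex of the free sum replacing a simplex of the second summand, where `c` takes the place
of the origin. -/
noncomputable def coneLift (j : F ↪ V) (c : Finset V) (t : Finset F) : Finset V :=
  if 0 ∈ t then c ∪ (t.erase 0).map j else t.map j

lemma coneLift_nonempty (hc : c.Nonempty) {t : Finset F} (ht : t.Nonempty) :
    (coneLift j c t).Nonempty := by
  classical
  rw [coneLift]
  split_ifs
  · exact hc.mono Finset.subset_union_left
  · exact ht.map

lemma coneLift_mono {s t : Finset F} (hst : s ⊆ t) : coneLift j c s ⊆ coneLift j c t := by
  classical
  unfold coneLift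
  split_ifs with h0 h1 h1
  · exact Finset.union_subset_union_right (Finset.map_subset_map.2 (Finset.erase_subset_erase _ hst))
  · exact absurd (hst h0) h1
  · refine Finset.Subset.trans (Finset.map_subset_map.2 ?_) Finset.subset_union_right
    exact fun y hy => Finset.mem_erase.2 ⟨fun hy0 => h0 (hy0 ▸ hy), hst hy⟩
  · exact Finset.map_subset_map.2 hst

lemma mem_coneLift {t : Finset F} {v : V} :
    v ∈ coneLift j c t ↔ (0 ∈ t ∧ v ∈ c) ∨ ∃ y ∈ t, y ≠ 0 ∧ j y = v := by
  classical
  unfold coneLift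
  split_ifs with h0
  · simp only [h0, true_and, Finset.mem_union, Finset.mem_map, Finset.mem_erase]
    constructor
    · rintro (h | ⟨y, ⟨h1, h2⟩, h3⟩)
      exacts [Or.inl h, Or.inr ⟨y, h2, h1, h3⟩]
    · rintro (h | ⟨y, h1, h2, h3⟩)
      exacts [Or.inl h, Or.inr ⟨y, ⟨h2, h1⟩, h3⟩]
  · simp only [h0, false_and, false_or, Finset.mem_map]
    constructor
    · rintro ⟨y, h1, h2⟩
      exact ⟨y, h1, fun hy => h0 (hy ▸ h1), h2⟩
    · rintro ⟨y, h1, -, h2⟩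
      exact ⟨y, h1, h2⟩

lemma coneLift_inter_subset [DecidableEq F] [DecidableEq V] (hcj : ∀ v ∈ c, v ∉ Set.range j)
    (s t : Finset F) : coneLift j c s ∩ coneLift j c t ⊆ coneLift j c (s ∩ t) := by
  intro v hv
  rw [Finset.mem_inter, mem_coneLift, mem_coneLift] at hv
  rw [mem_coneLift]
  rcases hv with ⟨⟨hs0, hvc⟩ | ⟨y, hy, hy0, rfl⟩, ⟨ht0, hvc'⟩ | ⟨y', hy', -, hyy⟩⟩
  · exact Or.inl ⟨Finset.mem_inter.2 ⟨hs0, ht0⟩, hvc⟩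
  · exact absurd ⟨y', hyy⟩ (hcj v hvc)
  · exact absurd ⟨y, rfl⟩ (hcj _ hvc')
  · rw [j.injective hyy] at hy'
    exact Or.inr ⟨y, Finset.mem_inter.2 ⟨hy, hy'⟩, hy0, rfl⟩

namespace IsFreeSumTriangulation

lemma mem_convexHull_coneLift (h : IsFreeSumTriangulation i j a b P Q K) (h0 : 0 ∈ openHull c)
    {t : Finset F} {y : F} (hy : y ∈ convexHull ℝ (t : Set F)) :
    j y ∈ convexHull ℝ (coneLift j c t : Set V) := by
  rw [← h.symm.mem_convexHull_map] at hy
  refine convexHull_min ?_ (convex_convexHull ℝ _) hy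
  intro v hv
  obtain ⟨y, hy, rfl⟩ := Finset.mem_map.1 (Finset.mem_coe.1 hv)
  rcases eq_or_ne y 0 with rfl | hy0
  · rw [h.symm.map_zero]
    refine convexHull_mono (Finset.coe_subset.2 ?_) (openHull_subset_convexHull c h0)
    exact fun v hv => mem_coneLift.2 (Or.inl ⟨hy, hv⟩)
  · exact subset_convexHull ℝ _ (mem_coneLift.2 (Or.inr ⟨y, hy, hy0, rfl⟩))

/-- The projection to the second summand sends all of `c` to `0` and so undoes the lift. With the
converse inclusion, intersections of simplices can be computed in `K`. -/
lemma mem_convexHull_of_coneLift (h : IsFreeSumTriangulation i j a b P Q K)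
    (hci : ∀ v ∈ c, v ∈ Set.range i) {t : Finset F} {y : F}
    (hy : j y ∈ convexHull ℝ (coneLift j c t : Set V)) : y ∈ convexHull ℝ (t : Set F) := by
  have h1 : b (j y) ∈ b '' convexHull ℝ (coneLift j c t : Set V) := ⟨_, hy, rfl⟩
  rw [h.snd_inr, LinearMap.image_convexHull] at h1
  refine convexHull_mono ?_ h1
  rintro _ ⟨v, hv, rfl⟩
  rcases mem_coneLift.1 (Finset.mem_coe.1 hv) with ⟨h0t, hvc⟩ | ⟨y, hy, -, rfl⟩
  · obtain ⟨x, rfl⟩ := hci v hvc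
    rw [h.snd_inl]
    exact h0t
  · rw [h.snd_inr]
    exact hy

/-- The complex of the parts of `K` in the second summand, completed by the cone from the origin over
the link of the carrier `c` of the origin. -/
def coneComplex (h : IsFreeSumTriangulation i j a b P Q K) (hc : c ∈ K.faces)
    (h0 : 0 ∈ openHull c) (hci : ∀ v ∈ c, v ∈ Set.range i) (hcj : ∀ v ∈ c, v ∉ Set.range j) :
    SimplicialComplex ℝ F where
  faces := {t | t.Nonempty ∧ coneLift j c t ∈ K.faces}
  isRelLowerSet_faces := by
    rintro t ⟨htn, ht⟩
    refine ⟨htn, fun s hst hs => ⟨hs, K.down_closed ht (coneLift_mono hst) ?_⟩⟩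
    exact coneLift_nonempty (K.nonempty_of_mem_faces hc) hs
  indep := by
    classical
    rintro t ⟨htn, ht⟩
    by_cases h0t : (0 : F) ∈ t
    · rw [coneLift, if_pos h0t] at ht
      -- The carrier already has `0` in its affine span, so the remaining vertices of the lifted
      -- face cannot; adjoining `0` to them keeps affine independence.
      have hspan : (0 : F) ∉ affineSpan ℝ ((t.erase 0 : Finset F) : Set F) := by
        refine h.zero_notMem_affineSpan (by convert ht) ?_
          (convexHull_subset_affineSpan (𝕜 := ℝ) _ (openHull_subset_convexHull c h0))
        rw [Finset.disjoint_left]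
        intro v hv hvc
        obtain ⟨y, -, rfl⟩ := Finset.mem_map.1 hv
        exact hcj _ hvc ⟨y, rfl⟩
      refine AffineIndependent.affineIndependent_of_notMem_span (i := ⟨0, h0t⟩) ?_ ?_
      · let e : {y : t // y ≠ ⟨0, h0t⟩} ↪ (t.erase 0 : Finset F) :=
          ⟨fun y => ⟨y, Finset.mem_erase.2 ⟨fun hy => y.2 (Subtype.ext hy), y.1.2⟩⟩,
            fun y z hyz => Subtype.ext (Subtype.ext
              (congrArg (fun w : (t.erase 0 : Finset F) => (w : F)) hyz :))⟩
        rcases (t.erase 0).eq_empty_or_nonempty with he | he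
        · have : IsEmpty {y : t // y ≠ ⟨0, h0t⟩} := ⟨fun y =>
            Finset.eq_empty_iff_forall_notMem.1 he _ (e y).2⟩
          exact affineIndependent_of_subsingleton ℝ _
        · have h1 : ((t.erase 0).map j) ∈ K.faces := K.down_closed ht
            (by intro v hv; exact Finset.mem_union_right _ (by convert hv)) he.map
          exact (h.symm.affineIndependent_of_map (K.indep h1)).comp_embedding e
      · convert hspan using 2
        congr 1
        ext y
        simp only [Set.mem_image, Set.mem_ofPred_eq, Subtype.exists, Finset.coe_erase,
          Set.mem_sdiff, Finset.mem_coe, Set.mem_singleton_iff]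
        constructor
        · rintro ⟨z, hz, hz0, rfl⟩
          exact ⟨hz, fun hz' => hz0 (Subtype.ext hz')⟩
        · rintro ⟨hy, hy0⟩
          exact ⟨y, hy, fun hy' => hy0 (congrArg Subtype.val hy'), rfl⟩
    · rw [coneLift, if_neg h0t] at ht
      exact h.symm.affineIndependent_of_map (K.indep ht)
  inter_subset_convexHull := by
    classical
    rintro s t ⟨-, hs⟩ ⟨-, ht⟩ y ⟨hys, hyt⟩
    have h1 := K.inter_subset_convexHull hs ht
      ⟨h.mem_convexHull_coneLift h0 hys, h.mem_convexHull_coneLift h0 hyt⟩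
    rw [← Finset.coe_inter] at h1 ⊢
    exact h.mem_convexHull_of_coneLift hci
      (convexHull_mono (Finset.coe_subset.2 (coneLift_inter_subset hcj s t)) h1)

lemma isTriangulation_coneComplex (h : IsFreeSumTriangulation i j a b P Q K) (hc : c ∈ K.faces)
    (h0 : 0 ∈ openHull c) (hci : ∀ v ∈ c, v ∈ Set.range i) (hcj : ∀ v ∈ c, v ∉ Set.range j) :
    IsTriangulation Q (h.coneComplex hc h0 hci hcj) := by
  classical
  have hsub : ∀ t ∈ (h.coneComplex hc h0 hci hcj).faces, (t : Set F) ⊆ Q := by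
    rintro t ⟨-, ht⟩ y hy
    rcases eq_or_ne y 0 with rfl | hy0
    · exact h.zero_right
    · exact h.symm.mem_left ht (mem_coneLift.2 (Or.inr ⟨y, hy, hy0, rfl⟩))
  refine ⟨hsub, Set.Subset.antisymm ?_ ?_⟩
  · intro y hy
    obtain ⟨t, ht, hyt⟩ := SimplicialComplex.mem_space_iff.1 hy
    exact convexHull_mono (hsub t ht) hyt
  · intro y hy
    obtain ⟨r, hr, hyr⟩ := SimplicialComplex.mem_space_iff.1 (h.symm.mem_space_left hy)
    rw [SimplicialComplex.mem_space_iff]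
    -- A face containing `c` projects into the simplex spanned by `0` and its second part. Any other
    -- face contains `y` in its second part, which cannot have `0` as a vertex.
    by_cases hcr : c ⊆ r
    · refine ⟨insert 0 (part j r), ⟨by simp, K.down_closed hr ?_
        (coneLift_nonempty (K.nonempty_of_mem_faces hc) (by simp))⟩, ?_⟩
      · intro v hv
        rcases mem_coneLift.1 hv with ⟨-, hv⟩ | ⟨y, hy, hy0, rfl⟩
        · exact hcr hv
        · exact IsDirectSum.mem_part.1 ((Finset.mem_insert.1 hy).resolve_left hy0)
      · have h1 : b (j y) ∈ b '' convexHull ℝ (r : Set V) := ⟨_, hyr, rfl⟩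
        rw [h.snd_inr, LinearMap.image_convexHull] at h1
        refine convexHull_mono ?_ h1
        rintro _ ⟨v, hv, rfl⟩
        rw [Finset.coe_insert]
        rcases h.mem_range_or hr hv with ⟨x, rfl⟩ | ⟨y, rfl⟩
        · exact Or.inl (h.snd_inl x)
        · right
          rw [h.snd_inr]
          exact IsDirectSum.mem_part.2 hv
    · have h1 := (h.mem_convexHull_part_or hc h0 hr hyr).resolve_right fun h2 => hcr h2.1
      have hn : (part j r).Nonempty := by simpa using convexHull_nonempty_iff.1 ⟨_, h1⟩
      have h2 : (part j r).map j ⊆ r := IsDirectSum.part_map_subset r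
      by_cases h0r : (0 : F) ∈ part j r
      · exfalso
        have h3 : (0 : V) ∈ r := by
          rw [← h.symm.map_zero]
          exact IsDirectSum.mem_part.1 h0r
        exact hcr (subset_of_mem_openHull hc hr h0 (subset_convexHull ℝ _ h3))
      · refine ⟨part j r, ⟨hn, ?_⟩, h1⟩
        rw [coneLift, if_neg h0r]
        exact K.down_closed hr h2 hn.map

/-- Conically induced triangulations of the summands exist. -/
lemma exists_isInducedPair (h : IsFreeSumTriangulation i j a b P Q K) (ho : OriginInPart i K) :
    ∃ KP KQ, IsInducedPair i j P Q K KP KQ ∧ IsConed j K KQ := by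
  classical
  obtain ⟨c, hc, h0⟩ := h.exists_carrier
  have hci := (h.originInPart_iff hc h0).1 ho
  refine ⟨h.partComplex K, ?_⟩
  have hKP := h.isTriangulation_partComplex hc h0 hci
  -- If `c` meets the second summand, then `c = {0}`; the carrier lies in both summands, and the
  -- second parts already form a triangulation.
  by_cases hcj : ∀ v ∈ c, v ∉ Set.range j
  · have h00 : {0} ∉ K.faces := by
      intro hz
      have := eq_of_mem_openHull hc hz h0 (mem_openHull_singleton 0)
      exact hcj 0 (by simp [this]) ⟨0, h.symm.map_zero⟩
    have hlift : ∀ t : Finset F, t.map j ∈ K.faces → coneLift j c t = t.map j := by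
      intro t ht
      rw [coneLift, if_neg]
      intro h0t
      refine h00 (K.down_closed ht (Finset.singleton_subset_iff.2 ?_) (by simp))
      rw [← h.symm.map_zero]
      exact Finset.mem_map_of_mem j h0t
    refine ⟨h.coneComplex hc h0 hci hcj, ⟨hKP, h.isTriangulation_coneComplex hc h0 hci hcj,
      h.faces_partComplex K, fun hz => absurd hz h00, fun _ => ⟨?_, ?_⟩⟩, ?_⟩
    · intro t ht
      rw [IsDirectSum.mem_parts] at ht
      refine ⟨Finset.map_nonempty.1 (K.nonempty_of_mem_faces ht), ?_⟩
      rwa [hlift t ht]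
    · refine ⟨by simp, ?_⟩
      rw [coneLift, if_pos (by simp)]
      simpa using hc
    · rintro t ⟨htn, ht⟩
      by_cases h0t : (0 : F) ∈ t
      · exact Or.inr ⟨htn, t, ⟨htn, ht⟩, subset_convexHull ℝ _ h0t, Finset.Subset.refl t⟩
      · rw [coneLift, if_neg h0t] at ht
        exact Or.inl (IsDirectSum.mem_parts.2 ht)
  · push Not at hcj
    obtain ⟨h00, rfl⟩ := h.carrier_eq_singleton hc h0 hci hcj
    refine ⟨h.symm.partComplex K, ⟨hKP, ?_, h.faces_partComplex K,
      fun _ => h.symm.faces_partComplex K, fun hz => absurd h00 hz⟩, ?_⟩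
    · refine h.symm.isTriangulation_partComplex hc h0 ?_
      intro v hv
      rw [Finset.mem_singleton.1 hv]
      exact ⟨0, h.symm.map_zero⟩
    · intro t ht
      rw [h.symm.faces_partComplex] at ht
      exact Or.inl ht

end IsFreeSumTriangulation

end ConeComplex

/-! ### Finitely generated cones and Farkas' lemma. -/

section FiniteCones

variable {V : Type*} [AddCommGroup V] [Module ℝ V]

/-- **Carathéodory's theorem** for cones: a nonnegative combination can be rewritten as one of
linearly independent vectors. -/
lemma exists_linearIndependent_combination (T : Finset V) (w : V → ℝ) (hw : ∀ v ∈ T, 0 ≤ w v) :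
    ∃ S ⊆ T, LinearIndependent ℝ ((↑) : S → V) ∧ ∃ u : V → ℝ, (∀ v ∈ S, 0 ≤ u v) ∧
      ∑ v ∈ S, u v • v = ∑ v ∈ T, w v • v := by
  classical
  induction T using Finset.strongInduction generalizing w with
  | H T ih =>
    by_cases hT : LinearIndependent ℝ ((↑) : T → V)
    · exact ⟨T, Finset.Subset.refl T, hT, w, hw, rfl⟩
    · obtain ⟨g, hg, v0, hv0T, hv0⟩ : ∃ g : V → ℝ, ∑ v ∈ T, g v • v = 0 ∧ ∃ v ∈ T, 0 < g v := by
        rw [Fintype.linearIndependent_iff] at hT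
        push Not at hT
        obtain ⟨g, hg, v0, hv0⟩ := hT
        have hsum : ∑ v ∈ T, (if hv : v ∈ T then g ⟨v, hv⟩ else 0) • v = 0 := by
          rw [← Finset.sum_coe_sort T]
          simpa using hg
        rcases lt_or_gt_of_ne hv0 with hlt | hgt
        · refine ⟨fun v => -(if hv : v ∈ T then g ⟨v, hv⟩ else 0), ?_, v0, v0.2, by simpa using hlt⟩
          simp only [neg_smul, Finset.sum_neg_distrib, hsum, neg_zero]
        · exact ⟨_, hsum, v0, v0.2, by simpa using hgt⟩
      -- Subtracting the smallest ratio `w v / g v` times the relation kills the weight of `v` and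
      -- keeps the others nonnegative.
      obtain ⟨v, hv, hmin⟩ := (T.filter fun v => 0 < g v).exists_min_image (fun v => w v / g v)
        ⟨v0, Finset.mem_filter.2 ⟨hv0T, hv0⟩⟩
      obtain ⟨hvT, hgv⟩ := Finset.mem_filter.1 hv
      have hnn : ∀ z ∈ T.erase v, 0 ≤ w z - w v / g v * g z := by
        intro z hz
        have hzT := Finset.mem_of_mem_erase hz
        rcases le_or_gt (g z) 0 with h | h
        · have := mul_nonneg (div_nonneg (hw v hvT) hgv.le) (neg_nonneg.2 h)
          linarith [hw z hzT]
        · have := hmin z (Finset.mem_filter.2 ⟨hzT, h⟩)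
          rw [le_div_iff₀ h] at this
          linarith
      obtain ⟨S, hS, hSli, u, hu, hsum⟩ := ih _ (Finset.erase_ssubset hvT) _ hnn
      refine ⟨S, hS.trans (Finset.erase_subset _ _), hSli, u, hu, ?_⟩
      rw [hsum, Finset.sum_erase]
      · simp only [sub_smul, Finset.sum_sub_distrib, mul_smul, ← Finset.smul_sum, hg, smul_zero,
          sub_zero]
      · rw [div_mul_cancel₀ _ hgv.ne', sub_self, zero_smul]

end FiniteCones

section FiniteConesTopology

variable {V : Type*} [NormedAddCommGroup V] [NormedSpace ℝ V]

/-- A finitely generated cone is closed. -/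
lemma isClosed_setOf_nonneg_combination (T : Finset V) :
    IsClosed {x : V | ∃ w : V → ℝ, (∀ v ∈ T, 0 ≤ w v) ∧ ∑ v ∈ T, w v • v = x} := by
  classical
  -- By Carathéodory the cone is a finite union of images of closed orthants under injective linear
  -- maps, which are closed embeddings.
  have h1 : {x : V | ∃ w : V → ℝ, (∀ v ∈ T, 0 ≤ w v) ∧ ∑ v ∈ T, w v • v = x}
      = ⋃ S ∈ T.powerset.filter (fun S : Finset V => LinearIndependent ℝ ((↑) : S → V)),
        (Fintype.linearCombination ℝ ((↑) : S → V)) '' {w | ∀ v, 0 ≤ w v} := by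
    ext x
    simp only [Set.mem_ofPred_eq, Set.mem_iUnion, Finset.mem_filter, Finset.mem_powerset,
      Set.mem_image, exists_prop]
    constructor
    · rintro ⟨w, hw, rfl⟩
      obtain ⟨S, hS, hli, u, hu, hsum⟩ := exists_linearIndependent_combination T w hw
      refine ⟨S, ⟨hS, hli⟩, fun v => u v, fun v => hu v v.2, ?_⟩
      rw [← hsum, Fintype.linearCombination_apply, Finset.sum_coe_sort S (fun v => u v • v)]
    · rintro ⟨S, ⟨hS, -⟩, w, hw, rfl⟩
      refine ⟨fun v => if hv : v ∈ S then w ⟨v, hv⟩ else 0, fun v _ => ?_, ?_⟩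
      · dsimp only
        split_ifs
        exacts [hw _, le_rfl]
      · rw [← Finset.sum_subset hS (fun v _ hv => by simp [hv]), ← Finset.sum_coe_sort S,
          Fintype.linearCombination_apply]
        simp
  rw [h1]
  refine isClosed_biUnion_finset fun S hS => ?_
  have hli := (Finset.mem_filter.1 hS).2
  have hker : (Fintype.linearCombination ℝ ((↑) : S → V)).ker = ⊥ :=
    LinearMap.ker_eq_bot.2 hli.fintypeLinearCombination_injective
  refine (LinearMap.isClosedEmbedding_of_injective hker).isClosedMap _ ?_
  have : {w : S → ℝ | ∀ v, 0 ≤ w v} = ⋂ v, {w | 0 ≤ w v} := by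
    ext
    simp
  rw [this]
  exact isClosed_iInter fun v => isClosed_le continuous_const (continuous_apply v)

/-- **Farkas' lemma** for a finite family of vectors. -/
lemma exists_nonneg_combination_of_forall_dual (T : Finset V) (x : V)
    (h : ∀ f : V →L[ℝ] ℝ, (∀ v ∈ T, 0 ≤ f v) → 0 ≤ f x) :
    ∃ w : V → ℝ, (∀ v ∈ T, 0 ≤ w v) ∧ ∑ v ∈ T, w v • v = x := by
  classical
  by_contra hx
  let C : ProperCone ℝ V :=
    { carrier := {x : V | ∃ w : V → ℝ, (∀ v ∈ T, 0 ≤ w v) ∧ ∑ v ∈ T, w v • v = x}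
      add_mem' := by
        rintro _ _ ⟨w, hw, rfl⟩ ⟨u, hu, rfl⟩
        exact ⟨fun v => w v + u v, fun v hv => add_nonneg (hw v hv) (hu v hv), by
          simp [add_smul, Finset.sum_add_distrib]⟩
      zero_mem' := ⟨fun _ => 0, by simp, by simp⟩
      smul_mem' := by
        rintro r _ ⟨w, hw, rfl⟩
        refine ⟨fun v => r * w v, fun v hv => mul_nonneg r.2 (hw v hv), ?_⟩
        rw [Finset.smul_sum]
        exact Finset.sum_congr rfl fun v _ => mul_smul _ _ _
      isClosed' := isClosed_setOf_nonneg_combination T }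
  obtain ⟨f, hf, hfx⟩ := C.hyperplane_separation_point (x₀ := x) hx
  refine absurd (h f fun v hv => hf v ?_) (not_le.2 hfx)
  exact ⟨fun z => if z = v then 1 else 0, fun z _ => by
    dsimp only
    split_ifs <;> norm_num, by simp [hv]⟩

end FiniteConesTopology

/-! ### The stabbing order in terms of rays from the origin. -/

section Stabbing

variable {V : Type*} [NormedAddCommGroup V] [NormedSpace ℝ V]

/-- If every hyperplane separating `s` from `t` has the origin on the side of `s`, then the origin
lies in `s`, or some ray from the origin passes first through `s` and later through `t`. -/
lemma zero_mem_or_exists_ray (s t : Finset V)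
    (h : ∀ (f : V →ₗ[ℝ] ℝ) (c : ℝ), f ≠ 0 → (∀ x ∈ convexHull ℝ (s : Set V), f x ≤ c) →
      (∀ x ∈ convexHull ℝ (t : Set V), c ≤ f x) → 0 ≤ c) (hs : s.Nonempty) :
    0 ∈ convexHull ℝ (s : Set V) ∨
      ∃ p ∈ convexHull ℝ (s : Set V), ∃ q : ℝ, 1 < q ∧ q • p ∈ convexHull ℝ (t : Set V) := by
  classical
  -- A functional that is nonnegative on all `(v, 1)` for `v` in `s` and all `(-v, -1)` for `v` in
  -- `t` encodes a hyperplane separating `s` from `t`, or is constant; its value at `(0, 1)` is the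
  -- offset `c`. Farkas then gives equal weighted vertex sums with total weight `1 + M` on `s` and
  -- `M` on `t`.
  obtain ⟨w, hw, hsum⟩ := exists_nonneg_combination_of_forall_dual
    (s.image (fun v => (v, (1 : ℝ))) ∪ t.image (fun v => (-v, (-1 : ℝ)))) ((0, 1) : V × ℝ) (by
    intro f hf
    set f1 : V →ₗ[ℝ] ℝ := (f : V × ℝ →ₗ[ℝ] ℝ) ∘ₗ LinearMap.inl ℝ V ℝ with hf1
    set c := f (0, 1) with hc
    have hsplit : ∀ (x : V) (r : ℝ), f (x, r) = f1 x + r * c := by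
      intro x r
      have : ((x, r) : V × ℝ) = (x, 0) + r • (0, 1) := by simp
      rw [this, map_add, map_smul, smul_eq_mul]
      rfl
    have h1 : ∀ x ∈ convexHull ℝ (s : Set V), (-f1) x ≤ c := by
      have : convexHull ℝ (s : Set V) ⊆ {x | (-f1) x ≤ c} := by
        refine convexHull_min (fun v hv => ?_) (convex_halfSpace_le (-f1).isLinear c)
        have := hf (v, 1) (Finset.mem_union_left _ (Finset.mem_image_of_mem _ hv))
        rw [hsplit] at this
        simp only [LinearMap.neg_apply, Set.mem_ofPred_eq]
        linarith
      exact this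
    have h2 : ∀ x ∈ convexHull ℝ (t : Set V), c ≤ (-f1) x := by
      have : convexHull ℝ (t : Set V) ⊆ {x | c ≤ (-f1) x} := by
        refine convexHull_min (fun v hv => ?_) (convex_halfSpace_ge (-f1).isLinear c)
        have := hf (-v, -1) (Finset.mem_union_right _ (Finset.mem_image_of_mem _ hv))
        rw [hsplit, map_neg] at this
        simp only [LinearMap.neg_apply, Set.mem_ofPred_eq]
        linarith
      exact this
    by_cases hf0 : -f1 = 0
    · obtain ⟨v, hv⟩ := hs
      have := h1 v (subset_convexHull ℝ _ hv)
      rwa [hf0] at this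
    · exact h _ c hf0 h1 h2)
  have hdisj : Disjoint (s.image fun v => (v, (1 : ℝ))) (t.image fun v => (-v, (-1 : ℝ))) := by
    rw [Finset.disjoint_left]
    intro z hz1 hz2
    obtain ⟨v, -, rfl⟩ := Finset.mem_image.1 hz1
    obtain ⟨v', -, hv'⟩ := Finset.mem_image.1 hz2
    have := congrArg Prod.snd hv'
    norm_num at this
  rw [Finset.sum_union hdisj, Finset.sum_image (by simp), Finset.sum_image (by simp)] at hsum
  have e1 := congrArg Prod.fst hsum
  have e2 := congrArg Prod.snd hsum
  simp only [Prod.fst_add, Prod.snd_add, Prod.fst_sum, Prod.snd_sum, Prod.smul_fst, Prod.smul_snd,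
    smul_neg, smul_eq_mul, mul_one, mul_neg, Finset.sum_neg_distrib] at e1 e2
  have hl : ∀ v ∈ s, 0 ≤ w (v, 1) := fun v hv =>
    hw _ (Finset.mem_union_left _ (Finset.mem_image_of_mem _ hv))
  have hm : ∀ v ∈ t, 0 ≤ w (-v, -1) := fun v hv =>
    hw _ (Finset.mem_union_right _ (Finset.mem_image_of_mem (fun v => (-v, (-1 : ℝ))) hv))
  set M := ∑ v ∈ t, w (-v, -1) with hM
  have hM0 : 0 ≤ M := Finset.sum_nonneg hm
  have e3 : ∑ v ∈ s, w (v, 1) • v = ∑ v ∈ t, w (-v, -1) • v := by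
    rwa [← sub_eq_add_neg, sub_eq_zero] at e1
  -- If `M = 0`, the combination over `s` represents `0`. Otherwise normalizing both sides gives
  -- points on one ray with ratio `(1 + M) / M`.
  rcases hM0.eq_or_lt with hM0 | hM0
  · left
    have hz := (Finset.sum_eq_zero_iff_of_nonneg hm).1 hM0.symm
    refine Finset.mem_convexHull'.2 ⟨fun v => w (v, 1), hl, by linarith, ?_⟩
    rw [e3]
    exact Finset.sum_eq_zero fun v hv => by rw [hz v hv, zero_smul]
  · right
    refine ⟨(1 + M)⁻¹ • ∑ v ∈ s, w (v, 1) • v, Finset.mem_convexHull'.2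
      ⟨fun v => (1 + M)⁻¹ * w (v, 1), fun v hv => mul_nonneg (by positivity) (hl v hv), ?_, ?_⟩,
      (1 + M) / M, ?_, Finset.mem_convexHull'.2
      ⟨fun v => M⁻¹ * w (-v, -1), fun v hv => mul_nonneg (by positivity) (hm v hv), ?_, ?_⟩⟩
    · rw [← Finset.mul_sum, show ∑ v ∈ s, w (v, 1) = 1 + M by linarith]
      exact inv_mul_cancel₀ (by positivity)
    · rw [Finset.smul_sum]
      exact Finset.sum_congr rfl fun v _ => mul_smul _ _ _
    · rw [lt_div_iff₀ hM0]
      linarith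
    · rw [← Finset.mul_sum]
      exact inv_mul_cancel₀ hM0.ne'
    · rw [e3, smul_smul, div_mul_eq_mul_div, mul_inv_cancel₀ (by positivity), one_div,
        Finset.smul_sum]
      exact Finset.sum_congr rfl fun v _ => mul_smul _ _ _

end Stabbing

/-! ### Star-shaped balls from links, monotonicity and compatibility. -/

section Webs

open Filter Topology

variable {E F V : Type*} [NormedAddCommGroup E] [NormedSpace ℝ E] [FiniteDimensional ℝ E]
  [NormedAddCommGroup F] [NormedSpace ℝ F] [FiniteDimensional ℝ F]
  [NormedAddCommGroup V] [NormedSpace ℝ V] [FiniteDimensional ℝ V]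
  {i : E ↪ V} {j : F ↪ V} {a : V →ₗ[ℝ] E} {b : V →ₗ[ℝ] F}
  {P : Set E} {Q : Set F} {K : SimplicialComplex ℝ V} {c : Finset V}
  {KP : SimplicialComplex ℝ E} {KQ : SimplicialComplex ℝ F}

lemma IsGauge.map_inv_smul {g : F → ℝ} (hg : IsGauge g) {y : F} (hy : y ≠ 0) :
    g ((g y)⁻¹ • y) = 1 := by
  rw [hg.hom _ _ (inv_nonneg.2 (hg.nonneg y)), inv_mul_cancel₀ (hg.ne_zero hy)]

lemma not_mem_map_union (h : IsDirectSum i j a b) [DecidableEq V] {s : Finset E}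
    (hsc : s.card = finrank ℝ E + 1) {t : Finset F} (htc : t.card = finrank ℝ F + 1)
    (h0 : (0 : F) ∉ t) : s.map i ∪ t.map j ∉ K.faces := by
  intro hst
  have h1 := card_le_of_affineIndependent (K.indep hst)
  have hd : Disjoint (s.map i) (t.map j) := by
    rw [Finset.disjoint_left]
    intro v hv hv'
    obtain ⟨x, -, rfl⟩ := Finset.mem_map.1 hv
    obtain ⟨y, hy, hxy⟩ := Finset.mem_map.1 hv'
    rw [h.symm.eq_zero_of_eq hxy] at hy
    exact h0 hy
  rw [Finset.card_union_of_disjoint hd, Finset.card_map, Finset.card_map, h.finrank_eq] at h1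
  omega

namespace IsFreeSumTriangulation

lemma exists_gauge_alphaMap (h : IsFreeSumTriangulation i j a b P Q K) {s : Finset E}
    (hsc : s.card = finrank ℝ E + 1) (hs : s.map i ∈ K.faces) (hKQ : IsTriangulation Q KQ) :
    ∃ g : F → ℝ, IsGauge g ∧ (∀ y, g y = 1 ↔ y ∈ body (linkIn j K (s.map i))) ∧
      alphaMap i j K KQ s = restrict KQ {y | g y ≤ 1} ∧ {y | g y ≤ 1} ⊆ KQ.space := by
  obtain ⟨g, hg, hgL, h1, h2⟩ := h.exists_isGauge_linkCone hsc hs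
  exact ⟨g, hg, hgL, by rw [alphaMap, h1], by rwa [hKQ.2]⟩

lemma alphaMap_mem_starBalls (h : IsFreeSumTriangulation i j a b P Q K) {s : Finset E}
    (hsc : s.card = finrank ℝ E + 1) (hs : s.map i ∈ K.faces) (hKQ : IsTriangulation Q KQ)
    (hsub : parts j K ⊆ KQ.faces) : alphaMap i j K KQ s ∈ starBalls KQ := by
  obtain ⟨g, hg, hgL, h1, h2⟩ := h.exists_gauge_alphaMap hsc hs hKQ
  rw [h1]
  exact restrict_mem_starBalls hg ((linkIn_subset_parts _).trans hsub) hgL h2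

lemma alphaMap_ne_empty (h : IsFreeSumTriangulation i j a b P Q K) {s : Finset E}
    (hsc : s.card = finrank ℝ E + 1) (hs : s.map i ∈ K.faces) (hKQ : IsTriangulation Q KQ)
    (hsub : parts j K ⊆ KQ.faces) : alphaMap i j K KQ s ≠ ∅ := by
  obtain ⟨g, hg, hgL, h1, h2⟩ := h.exists_gauge_alphaMap hsc hs hKQ
  have h3 := body_restrict hg ((linkIn_subset_parts _).trans hsub) hgL h2
  have h4 : (0 : F) ∈ {y | g y ≤ 1} := interior_subset hg.zero_mem_interior
  rw [← h3] at h4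
  obtain ⟨t, ht, -⟩ := mem_body.1 h4
  rw [h1]
  exact Set.nonempty_iff_ne_empty.1 ⟨t, ht⟩

lemma mem_boundaryFacets_alphaMap [DecidableEq V] (h : IsFreeSumTriangulation i j a b P Q K)
    {s : Finset E} (hsc : s.card = finrank ℝ E + 1) (hs : s.map i ∈ K.faces)
    (hKQ : IsTriangulation Q KQ) (hsub : parts j K ⊆ KQ.faces) {t : Finset F} :
    t ∈ boundaryFacets (alphaMap i j K KQ s) ↔
      t.card = finrank ℝ F ∧ Disjoint (t.map j) (s.map i) ∧ s.map i ∪ t.map j ∈ K.faces := by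
  obtain ⟨g, hg, hgL, h1, h2⟩ := h.exists_gauge_alphaMap hsc hs hKQ
  rw [h1, mem_boundaryFacets_restrict (faces_finite_of_subset h.finite_right hKQ.1) hg
    ((linkIn_subset_parts _).trans hsub) (fun t ht => h.card_le_of_mem_linkIn hsc ht) hgL h2,
    mem_linkIn]
  rcases t.eq_empty_or_nonempty with rfl | ht
  · simp [hs]
  · simp [ht, ht.ne_empty]

lemma mem_alphaMap_of_zero_mem (h : IsFreeSumTriangulation i j a b P Q K)
    {s : Finset E} (hsc : s.card = finrank ℝ E + 1) (hs : s.map i ∈ K.faces)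
    (hKQ : IsTriangulation Q KQ) (hsub : parts j K ⊆ KQ.faces) {t : Finset F}
    (ht : t ∈ KQ.faces) (h0 : (0 : F) ∈ t) : t ∈ alphaMap i j K KQ s := by
  obtain ⟨g, hg, hgL, h1, h2⟩ := h.exists_gauge_alphaMap hsc hs hKQ
  rw [h1]
  exact ⟨ht, convexHull_subset_of_lt_one hg ((linkIn_subset_parts _).trans hsub) hgL ht
    (subset_convexHull ℝ _ h0) (by rw [hg.map_zero]; exact zero_lt_one)⟩

lemma carrier_not_subset_map (h : IsFreeSumTriangulation i j a b P Q K) (hc : c ∈ K.faces)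
    (h0 : 0 ∈ openHull c) (hci : ∀ v ∈ c, v ∈ Set.range i) {t : Finset F} (ht : (0 : F) ∉ t) :
    ¬ c ⊆ t.map j := by
  intro hct
  obtain ⟨v, hv⟩ := K.nonempty_of_mem_faces hc
  obtain ⟨y, -, hy⟩ := Finset.mem_map.1 (hct hv)
  obtain ⟨-, rfl⟩ := h.carrier_eq_singleton hc h0 hci ⟨v, hv, y, hy⟩
  obtain ⟨y, hy, hy0⟩ := Finset.mem_map.1 (hct (Finset.mem_singleton_self 0))
  rw [← h.symm.map_zero] at hy0
  exact ht (j.injective hy0 ▸ hy)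

/-- Contracting a face that contains the carrier `c` of the origin moves its points off all faces
that do not contain `c`. -/
lemma subset_of_smul_mem (hc0 : (0 : V) ∈ openHull c) {r r' : Finset V} (hr : r ∈ K.faces)
    (hr' : r' ∈ K.faces) (hcr : c ⊆ r) {z : V} (hz : z ∈ convexHull ℝ (r : Set V)) {q : ℝ}
    (hq0 : 0 ≤ q) (hq1 : q < 1) (hqz : q • z ∈ convexHull ℝ (r' : Set V)) : c ⊆ r' := by
  refine subset_of_mix_mem hr hr' hcr hc0 hz (θ := 1 - q) (by linarith) (by linarith) ?_
  simpa using hqz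

/-- If `y` were beyond the link, shrinking it onto the link would land in a face of the second
summand without the vertex `0`, yet that face would have to contain `c`. -/
lemma mem_linkCone_of_carrier_subset (h : IsFreeSumTriangulation i j a b P Q K) (hc : c ∈ K.faces)
    (h0 : 0 ∈ openHull c) (hci : ∀ v ∈ c, v ∈ Set.range i) {s : Finset E}
    (hsc : s.card = finrank ℝ E + 1) (hs : s.map i ∈ K.faces) {r : Finset V} (hr : r ∈ K.faces)
    (hcr : c ⊆ r) {y : F} (hy : j y ∈ convexHull ℝ (r : Set V)) :
    y ∈ j ⁻¹' linkCone K (s.map i) := by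
  obtain ⟨g, hg, hgL, h1, -⟩ := h.exists_isGauge_linkCone hsc hs
  rw [h1]
  by_contra hgy
  simp only [Set.mem_ofPred_eq, not_le] at hgy
  have hy0 : y ≠ 0 := by
    rintro rfl
    rw [hg.map_zero] at hgy
    linarith
  obtain ⟨t, ht, hyt⟩ := mem_body.1 ((hgL _).1 (hg.map_inv_smul hy0))
  rw [← h.symm.mem_convexHull_map, h.symm.map_smul] at hyt
  exact h.carrier_not_subset_map hc h0 hci (h.zero_notMem_of_mem_linkIn hsc hs ht)
    (subset_of_smul_mem h0 hr (IsDirectSum.mem_parts.1 (linkIn_subset_parts _ ht)) hcr hy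
      (inv_nonneg.2 (hg.nonneg y)) (inv_lt_one_of_one_lt₀ hgy) hyt)

/-- The hypotheses say that in some direction the link of `s` is farther from `0` than that of `s'`,
while some ray meets `s` no later than `s'` or `0` lies in `s`. In the ray case this is the reversed
order that makes segments cross. -/
lemma false_of_stabs_of_smul_mem (h : IsFreeSumTriangulation i j a b P Q K) {s s' : Finset E}
    (hsc : s.card = finrank ℝ E + 1) (hs : s.map i ∈ K.faces)
    (hsc' : s'.card = finrank ℝ E + 1) (hs' : s'.map i ∈ K.faces) (hst : Stabs s s')
    (hne : s ≠ s') {x : F} {p : ℝ} (hp : 1 < p) (hx : x ∈ body (linkIn j K (s'.map i)))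
    (hpx : p • x ∈ body (linkIn j K (s.map i))) : False := by
  classical
  obtain ⟨t', ht', hxt'⟩ := mem_body.1 hx
  obtain ⟨t, ht, hxt⟩ := mem_body.1 hpx
  obtain ⟨-, htd, htK⟩ := mem_linkIn.1 ht
  obtain ⟨-, htd', htK'⟩ := mem_linkIn.1 ht'
  have h0t := h.zero_notMem_of_mem_linkIn hsc hs ht
  have h0t' := h.zero_notMem_of_mem_linkIn hsc' hs' ht'
  have hcancel : ∀ {u u' : Finset E} {w : Finset F}, (0 : F) ∉ w →
      u.map i ⊆ u'.map i ∪ w.map j → u ⊆ u' := by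
    intro u u' w hw hu x hx
    rcases Finset.mem_union.1 (hu (Finset.mem_map_of_mem i hx)) with hx' | hx'
    · simpa using hx'
    · obtain ⟨y, hy, hxy⟩ := Finset.mem_map.1 hx'
      rw [h.symm.eq_zero_of_eq hxy] at hy
      exact absurd hy hw
  obtain ⟨hside, f, e, -, he0, hf1, hf2⟩ := hst.resolve_left hne
  have hsn : s.Nonempty := Finset.map_nonempty.1 (K.nonempty_of_mem_faces hs)
  have hpx' := convexHull_mono (Finset.coe_subset.2 (Finset.subset_union_right (s₁ := s.map i)))
    (h.symm.mem_convexHull_map.2 hxt)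
  have hx' := convexHull_mono (Finset.coe_subset.2 (Finset.subset_union_right (s₁ := s'.map i)))
    (h.symm.mem_convexHull_map.2 hxt')
  -- When `0` is in `s`, shrinking `p • x` to `x` would force the carrier of `0` into a link simplex
  -- `t'` of the other summand that avoids `0`.
  rcases zero_mem_or_exists_ray s s' hside hsn with h0 | ⟨z, hz, q, hq, hqz⟩
  · obtain ⟨u, hus, -, h0u⟩ := exists_mem_openHull h0
    have h0i : (0 : V) ∈ openHull (u.map i) := by
      have := h.mem_openHull_map h0u
      rwa [h.map_zero] at this
    have hsub := subset_of_smul_mem h0i htK (IsDirectSum.mem_parts.1 (linkIn_subset_parts _ ht'))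
      ((Finset.map_subset_map.2 hus).trans Finset.subset_union_left) hpx' (q := p⁻¹)
      (by positivity) (inv_lt_one_of_one_lt₀ hp) (by
        rw [h.symm.map_smul, smul_smul, inv_mul_cancel₀ (by positivity), one_smul]
        exact h.symm.mem_convexHull_map.2 hxt')
    have := hcancel (u' := ∅) h0t' (hsub.trans Finset.subset_union_right)
    have hne := nonempty_of_mem_openHull h0u
    exact hne.ne_empty (Finset.subset_empty.1 this)
  · obtain ⟨θ, κ, hθ0, hθ1, hκ0, hκ1, e1, e2⟩ :=
      exists_crossing (p := p) (q := q) (by linarith) (by linarith) (Or.inl ⟨hp, hq⟩)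
    have hz' := convexHull_mono (Finset.coe_subset.2 (Finset.subset_union_left (s₂ := t.map j)))
      (h.mem_convexHull_map.2 hz)
    have hqz' := convexHull_mono (Finset.coe_subset.2 (Finset.subset_union_left (s₂ := t'.map j)))
      (h.mem_convexHull_map.2 hqz)
    have heq : θ • i z + (1 - θ) • j (p • x) = κ • i (q • z) + (1 - κ) • j x := by
      rw [h.map_smul, h.symm.map_smul, smul_smul, smul_smul, e1, ← e2, e1]
    have hmem := convex_convexHull ℝ _ hz' hpx' hθ0.le (sub_nonneg.2 hθ1.le) (by ring)
    have hmem' := convex_convexHull ℝ _ hqz' hx' hκ0.le (sub_nonneg.2 hκ1.le) (by ring)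
    have hzs' : z ∈ convexHull ℝ (s' : Set E) := by
      obtain ⟨u, hu, -, hzu⟩ := exists_mem_openHull hz
      have := subset_of_mix_mem htK htK' ((Finset.map_subset_map.2 hu).trans
        Finset.subset_union_left) (h.mem_openHull_map hzu) hpx' hθ0 hθ1.le (heq ▸ hmem')
      exact convexHull_mono (Finset.coe_subset.2 (hcancel h0t' this))
        (openHull_subset_convexHull u hzu)
    have hqzs : q • z ∈ convexHull ℝ (s : Set E) := by
      obtain ⟨u, hu, -, hzu⟩ := exists_mem_openHull hqz
      have := subset_of_mix_mem htK' htK ((Finset.map_subset_map.2 hu).trans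
        Finset.subset_union_left) (h.mem_openHull_map hzu) hx' hκ0 hκ1.le (heq ▸ hmem)
      exact convexHull_mono (Finset.coe_subset.2 (hcancel h0t this))
        (openHull_subset_convexHull u hzu)
    -- The crossing places `z` and `q • z` in both `s` and `s'`, so the separating functional equals
    -- `e` at both points. Since `q ≠ 1` this gives `e = 0`; here it matters that some separating
    -- hyperplane misses the origin.
    have k1 := hf1 z hz
    have k2 := hf2 z hzs'
    have k3 := hf1 _ hqzs
    have k4 := hf2 _ hqz
    rw [map_smul, smul_eq_mul] at k3 k4
    have k5 : f z = e := le_antisymm k1 k2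
    rw [k5] at k3 k4
    have k6 : (q - 1) * e = 0 := by linarith
    rcases mul_eq_zero.1 k6 with k7 | k7
    · linarith
    · exact he0 k7

/-- The cones over the links grow along the stabbing order. -/
lemma preimage_linkCone_mono (h : IsFreeSumTriangulation i j a b P Q K) {s s' : Finset E}
    (hsc : s.card = finrank ℝ E + 1) (hs : s.map i ∈ K.faces)
    (hsc' : s'.card = finrank ℝ E + 1) (hs' : s'.map i ∈ K.faces) (hst : Stabs s s') :
    j ⁻¹' linkCone K (s.map i) ⊆ j ⁻¹' linkCone K (s'.map i) := by
  rcases eq_or_ne s s' with rfl | hne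
  · exact subset_rfl
  obtain ⟨g, hg, hgL, h1, -⟩ := h.exists_isGauge_linkCone hsc hs
  obtain ⟨g', hg', hgL', h1', -⟩ := h.exists_isGauge_linkCone hsc' hs'
  rw [h1, h1']
  intro y hy
  by_contra hy'
  simp only [Set.mem_ofPred_eq, not_le] at hy hy'
  have hy0 : y ≠ 0 := by
    rintro rfl
    rw [hg'.map_zero] at hy'
    linarith
  have hgy := hg.pos y hy0
  refine h.false_of_stabs_of_smul_mem hsc hs hsc' hs' hst hne (p := g' y / g y)
    (by rw [lt_div_iff₀ hgy]; linarith) ((hgL' _).1 (hg'.map_inv_smul hy0)) ((hgL _).1 ?_)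
  rw [smul_smul, div_mul_eq_mul_div, mul_inv_cancel₀ (hg'.ne_zero hy0), one_div,
    hg.map_inv_smul hy0]

lemma restrict_mono {S T : Set F} (hST : S ⊆ T) : restrict KQ S ⊆ restrict KQ T :=
  fun _ ht => ⟨ht.1, ht.2.trans hST⟩

/-- Membership is tested at relative interior points `x` of `s` and `y` of `t`, by `k x ≤ 1` and `g
y ≤ 1`. Neither value is `1`, and they are not both smaller or both larger than `1`, since
coinciding or crossing segments would put `s` and `t` in one face, which would have too many
vertices. -/
lemma mem_alphaMap_iff_notMem (h : IsFreeSumTriangulation i j a b P Q K) {s : Finset E}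
    (hsc : s.card = finrank ℝ E + 1) (hs : s.map i ∈ K.faces) {t : Finset F}
    (htc : t.card = finrank ℝ F + 1) (ht : t.map j ∈ K.faces)
    (h0 : (0 : F) ∉ convexHull ℝ (t : Set F))
    (hKP : IsTriangulation P KP) (hKQ : IsTriangulation Q KQ) (hsubP : parts i K ⊆ KP.faces)
    (hsubQ : parts j K ⊆ KQ.faces) :
    s ∈ alphaMap j i K KP t ↔ t ∉ alphaMap i j K KQ s := by
  classical
  obtain ⟨g, hg, hgL, h1, -⟩ := h.exists_gauge_alphaMap hsc hs hKQ
  obtain ⟨k, hk, hkL, h2, -⟩ := h.symm.exists_gauge_alphaMap htc ht hKP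
  have hnot := not_mem_map_union (K := K) h.toIsDirectSum hsc htc
    (fun h0t => h0 (subset_convexHull ℝ _ h0t))
  have hfalse : ∀ r ∈ K.faces, s.map i ⊆ r → t.map j ⊆ r → False := fun r hr hsr htr =>
    hnot (K.down_closed hr (Finset.union_subset hsr htr)
      ((K.nonempty_of_mem_faces hs).mono Finset.subset_union_left))
  obtain ⟨x, hx⟩ := openHull_nonempty (Finset.map_nonempty.1 (K.nonempty_of_mem_faces hs))
  obtain ⟨y, hy⟩ := openHull_nonempty (Finset.map_nonempty.1 (K.nonempty_of_mem_faces ht))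
  have hix := h.mem_openHull_map hx
  have hjy := h.symm.mem_openHull_map hy
  have hsKP := hsubP (IsDirectSum.mem_parts.2 hs)
  have htKQ := hsubQ (IsDirectSum.mem_parts.2 ht)
  have e1 : s ∈ alphaMap j i K KP t ↔ k x ≤ 1 := by
    rw [h2]
    exact ⟨fun hm => hm.2 (openHull_subset_convexHull s hx), fun hm => ⟨hsKP,
      convexHull_subset_of_mem_openHull hk ((linkIn_subset_parts _).trans hsubP) hkL hsKP hx hm⟩⟩
  have e2 : t ∈ alphaMap i j K KQ s ↔ g y ≤ 1 := by
    rw [h1]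
    exact ⟨fun hm => hm.2 (openHull_subset_convexHull t hy), fun hm => ⟨htKQ,
      convexHull_subset_of_mem_openHull hg ((linkIn_subset_parts _).trans hsubQ) hgL htKQ hy hm⟩⟩
  rw [e1, e2]
  have hy0 : y ≠ 0 := by
    rintro rfl
    exact h0 (openHull_subset_convexHull t hy)
  obtain ⟨w, hw, hyw⟩ := mem_body.1 ((hgL _).1 (hg.map_inv_smul hy0))
  obtain ⟨-, -, hwK⟩ := mem_linkIn.1 hw
  have hyw' : j ((g y)⁻¹ • y) ∈ convexHull ℝ ((s.map i ∪ w.map j : Finset V) : Set V) :=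
    convexHull_mono (Finset.coe_subset.2 Finset.subset_union_right)
      (h.symm.mem_convexHull_map.2 hyw)
  have hgy1 : g y ≠ 1 := by
    intro hgy
    rw [hgy, inv_one, one_smul] at hyw'
    exact hfalse _ hwK Finset.subset_union_left (subset_of_mem_openHull ht hwK hjy hyw')
  -- If `x = 0` there is no direction to rescale; `k x = 0`, and contraction towards the origin
  -- replaces the crossing argument.
  rcases eq_or_ne x 0 with rfl | hx0
  · rw [hk.map_zero]
    simp only [zero_le_one, true_iff, not_le]
    by_contra hgy
    have hgy' : g y < 1 := lt_of_le_of_ne (not_lt.1 hgy) hgy1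
    rw [h.map_zero] at hix
    refine hfalse _ ht (subset_of_smul_mem hix hwK ht Finset.subset_union_left hyw' (q := g y)
      (hg.nonneg y) hgy' ?_) (Finset.Subset.refl _)
    rw [h.symm.map_smul, smul_smul, mul_inv_cancel₀ (hg.ne_zero hy0), one_smul]
    exact openHull_subset_convexHull _ hjy
  · obtain ⟨u, hu, hxu⟩ := mem_body.1 ((hkL _).1 (hk.map_inv_smul hx0))
    obtain ⟨-, -, huK⟩ := mem_linkIn.1 hu
    have hxu' : i ((k x)⁻¹ • x) ∈ convexHull ℝ ((t.map j ∪ u.map i : Finset V) : Set V) :=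
      convexHull_mono (Finset.coe_subset.2 Finset.subset_union_right)
        (h.mem_convexHull_map.2 hxu)
    have hkx1 : k x ≠ 1 := by
      intro hkx
      rw [hkx, inv_one, one_smul] at hxu'
      exact hfalse _ huK (subset_of_mem_openHull hs huK hix hxu') Finset.subset_union_left
    have hgy := hg.pos y hy0
    have hkx := hk.pos x hx0
    have key : ¬ ((1 < (g y)⁻¹ ∧ 1 < (k x)⁻¹) ∨ ((g y)⁻¹ < 1 ∧ (k x)⁻¹ < 1)) := by
      intro hpq
      obtain ⟨θ, κ, hθ0, hθ1, hκ0, hκ1, d1, d2⟩ :=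
        exists_crossing (inv_pos.2 hgy) (inv_pos.2 hkx) hpq
      have heq : θ • i x + (1 - θ) • j ((g y)⁻¹ • y)
          = κ • i ((k x)⁻¹ • x) + (1 - κ) • j y := by
        rw [h.map_smul, h.symm.map_smul, smul_smul, smul_smul, d2, d1]
      have hmem := convex_convexHull ℝ ((t.map j ∪ u.map i : Finset V) : Set V) hxu'
        (convexHull_mono (Finset.coe_subset.2 Finset.subset_union_left)
          (openHull_subset_convexHull _ hjy)) hκ0.le (sub_nonneg.2 hκ1.le) (by ring)
      rw [← heq] at hmem
      exact hfalse _ huK (subset_of_mix_mem hwK huK Finset.subset_union_left hix hyw' hθ0 hθ1.le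
        hmem) Finset.subset_union_left
    rw [one_lt_inv₀ hgy, one_lt_inv₀ hkx, inv_lt_one₀ hgy, inv_lt_one₀ hkx] at key
    push Not at key
    constructor
    · intro hle hle'
      exact absurd (key.1 (lt_of_le_of_ne hle' hgy1)) (not_le.2 (lt_of_le_of_ne hle hkx1))
    · intro hlt
      exact key.2 (not_le.1 hlt)

end IsFreeSumTriangulation

end Webs

/-! ### Induced pairs: webs of stars, facet formula and the conical case. -/

section Induced

open Filter Topology

variable {E F V : Type*} [NormedAddCommGroup E] [NormedSpace ℝ E] [FiniteDimensional ℝ E]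
  [NormedAddCommGroup F] [NormedSpace ℝ F] [FiniteDimensional ℝ F]
  [NormedAddCommGroup V] [NormedSpace ℝ V] [FiniteDimensional ℝ V]
  {i : E ↪ V} {j : F ↪ V} {a : V →ₗ[ℝ] E} {b : V →ₗ[ℝ] F}
  {P : Set E} {Q : Set F} {K : SimplicialComplex ℝ V} {c : Finset V}
  {KP : SimplicialComplex ℝ E} {KQ : SimplicialComplex ℝ F}

lemma mem_of_zero_mem_convexHull (hz : {0} ∈ KQ.faces) {t : Finset F} (ht : t ∈ KQ.faces)
    (h0 : (0 : F) ∈ convexHull ℝ (t : Set F)) : (0 : F) ∈ t :=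
  (SimplicialComplex.vertex_mem_convexHull_iff (SimplicialComplex.mem_vertices.2 hz) ht).1 h0

lemma betaMap_of_zero_mem {t : Finset F} (h0 : (0 : F) ∈ t) : betaMap i j K KP t = ∅ := if_pos h0

lemma betaMap_of_zero_notMem {t : Finset F} (h0 : (0 : F) ∉ t) :
    betaMap i j K KP t = alphaMap j i K KP t := if_neg h0

namespace IsFreeSumTriangulation

lemma parts_subset (hI : IsInducedPair i j P Q K KP KQ) : parts j K ⊆ KQ.faces := by
  by_cases hz : {0} ∈ K.faces
  · exact (hI.2.2.2.1 hz).ge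
  · exact (hI.2.2.2.2 hz).1

lemma singleton_zero_mem (h : IsFreeSumTriangulation i j a b P Q K)
    (hI : IsInducedPair i j P Q K KP KQ) : {0} ∈ KQ.faces := by
  by_cases hz : {0} ∈ K.faces
  · refine parts_subset hI (IsDirectSum.mem_parts.2 ?_)
    rwa [Finset.map_singleton, h.symm.map_zero]
  · exact (hI.2.2.2.2 hz).2

lemma map_mem_of_mem_left (hI : IsInducedPair i j P Q K KP KQ) {s : Finset E}
    (hs : s ∈ KP.faces) : s.map i ∈ K.faces := by
  rw [hI.2.2.1] at hs
  exact IsDirectSum.mem_parts.1 hs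

lemma singleton_zero_notMem (hI : IsInducedPair i j P Q K KP KQ) {t : Finset F}
    (ht : t ∈ KQ.faces) (htK : t.map j ∉ K.faces) : {0} ∉ K.faces := by
  intro hz
  rw [hI.2.2.2.1 hz] at ht
  exact htK (IsDirectSum.mem_parts.1 ht)

/-- A face of the second triangulation that does not come from `K` is covered by faces of `K`
containing the carrier of the origin. -/
lemma carrier_subset_of_notMem (h : IsFreeSumTriangulation i j a b P Q K) (hc : c ∈ K.faces)
    (h0 : 0 ∈ openHull c) (hI : IsInducedPair i j P Q K KP KQ) {t : Finset F} (ht : t ∈ KQ.faces)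
    (htK : t.map j ∉ K.faces) {y : F} (hy : y ∈ openHull t) {r : Finset V} (hr : r ∈ K.faces)
    (hyr : j y ∈ convexHull ℝ (r : Set V)) : c ⊆ r := by
  rcases h.mem_convexHull_part_or hc h0 hr hyr with h1 | h1
  · exfalso
    have hn : (part j r).Nonempty := by simpa using convexHull_nonempty_iff.1 ⟨_, h1⟩
    have h2 : part j r ∈ parts j K := ⟨hn, r, hr, rfl⟩
    have h3 := subset_of_mem_openHull ht (parts_subset hI h2) hy h1
    exact htK (K.down_closed (IsDirectSum.mem_parts.1 h2) (Finset.map_subset_map.2 h3)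
      (KQ.nonempty_of_mem_faces ht).map)
  · exact h1.1

/-- The link of a simplex outside `K` is empty and its cone is `{0}`, so only the face `{0}` could
remain. That would make `0` a vertex of `K`, and then every face of `KQ` would come from `K`. -/
lemma betaMap_of_notMem (h : IsFreeSumTriangulation i j a b P Q K)
    (hI : IsInducedPair i j P Q K KP KQ) {t : Finset F} (ht : t ∈ KQ.faces)
    (htK : t.map j ∉ K.faces) : betaMap i j K KP t = ∅ := by
  by_cases h0 : (0 : F) ∈ t
  · exact betaMap_of_zero_mem h0
  rw [betaMap_of_zero_notMem h0, Set.eq_empty_iff_forall_notMem]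
  rintro s ⟨hs, hsub⟩
  have hlink : body (link K (t.map j)) = ∅ := by
    rw [Set.eq_empty_iff_forall_notMem]
    intro z hz
    simp only [body, Set.mem_iUnion] at hz
    obtain ⟨_, ⟨-, -, r, hr, htr, -⟩, -⟩ := hz
    exact htK (K.down_closed hr htr (KQ.nonempty_of_mem_faces ht).map)
  have hzero : ∀ x ∈ convexHull ℝ (s : Set E), x = 0 := by
    intro x hx
    rcases hsub hx with hx0 | ⟨p, -, -, z, hz, -⟩
    · exact i.injective (hx0.trans h.map_zero.symm)
    · rw [hlink] at hz
      exact hz.elim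
  have hs0 : s = {0} := by
    obtain ⟨x, hx⟩ := KP.nonempty_of_mem_faces hs
    ext z
    rw [Finset.mem_singleton]
    refine ⟨fun hz => hzero z (subset_convexHull ℝ _ hz), ?_⟩
    rintro rfl
    rwa [← hzero x (subset_convexHull ℝ _ hx)]
  have := map_mem_of_mem_left hI hs
  rw [hs0, Finset.map_singleton, h.map_zero] at this
  exact singleton_zero_notMem hI ht htK this

lemma isWebOfStars_alphaMap (h : IsFreeSumTriangulation i j a b P Q K)
    (hI : IsInducedPair i j P Q K KP KQ) : IsWebOfStars KP KQ (alphaMap i j K KQ) :=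
  ⟨fun _ hs => h.alphaMap_mem_starBalls hs.2 (map_mem_of_mem_left hI hs.1) hI.2.1
      (parts_subset hI),
    fun _ hs _ ht hst => restrict_mono (h.preimage_linkCone_mono hs.2
      (map_mem_of_mem_left hI hs.1) ht.2 (map_mem_of_mem_left hI ht.1) hst)⟩

lemma isWebOfStars_betaMap (h : IsFreeSumTriangulation i j a b P Q K) (hc : c ∈ K.faces)
    (h0 : 0 ∈ openHull c) (hci : ∀ v ∈ c, v ∈ Set.range i)
    (hI : IsInducedPair i j P Q K KP KQ) : IsWebOfStars KQ KP (betaMap i j K KP) := by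
  refine ⟨fun t ht => ?_, fun s hs t ht hst => ?_⟩
  · by_cases h0t : (0 : F) ∈ t
    · exact Or.inr (betaMap_of_zero_mem h0t)
    by_cases htK : t.map j ∈ K.faces
    · rw [betaMap_of_zero_notMem h0t]
      exact h.symm.alphaMap_mem_starBalls ht.2 htK hI.1 hI.2.2.1.ge
    · exact Or.inr (h.betaMap_of_notMem hI ht.1 htK)
  · rcases eq_or_ne s t with rfl | hne
    · exact subset_rfl
    by_cases h0s : (0 : F) ∈ s
    · rw [betaMap_of_zero_mem h0s]
      exact Set.empty_subset _
    by_cases hsK : s.map j ∉ K.faces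
    · rw [h.betaMap_of_notMem hI hs.1 hsK]
      exact Set.empty_subset _
    rw [not_not] at hsK
    obtain ⟨hside, f, e, hf0, he0, hf1, hf2⟩ := hst.resolve_left hne
    by_cases h0t : (0 : F) ∈ t
    · exfalso
      have h1 := hside f e hf0 hf1 hf2
      have h2 := hf2 0 (subset_convexHull ℝ _ h0t)
      rw [map_zero] at h2
      exact he0 (le_antisymm h2 h1)
    by_cases htK : t.map j ∈ K.faces
    · rw [betaMap_of_zero_notMem h0s, betaMap_of_zero_notMem h0t]
      exact restrict_mono (h.symm.preimage_linkCone_mono hs.2 hsK ht.2 htK hst)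
    · exfalso
      rcases zero_mem_or_exists_ray s t hside (KQ.nonempty_of_mem_faces hs.1) with
        hzs | ⟨z, hz, q, hq, hqz⟩
      · exact h0s (mem_of_zero_mem_convexHull (h.singleton_zero_mem hI) hs.1 hzs)
      -- The ray meets `s` at `z` and then `t` at `q • z`. Moving slightly from `q • z` into the
      -- relative interior of `t` finds a face of `K` that contains both `q • z` and `c`;
      -- contracting `q • z` to `z` forces `c` into `s`.
      · obtain ⟨y, hy⟩ := openHull_nonempty (KQ.nonempty_of_mem_faces ht.1)
        have hmix : ∀ ε : ℝ, 0 < ε → ε < 1 → q • z + ε • (y - q • z) ∈ openHull t := by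
          intro ε hε hε1
          have := mix_mem_openHull hy hqz hε hε1.le
          convert this using 1
          module
        have hlin : ∀ ε : ℝ, j (q • z) + ε • j (y - q • z) = j (q • z + ε • (y - q • z)) := by
          intro ε
          rw [h.symm.map_add, h.symm.map_smul ε]
        obtain ⟨r, hr, ε, hε, hε1, h1, h2⟩ := exists_face_along h.faces_finite
          (z := j (q • z)) (v := j (y - q • z)) one_pos (fun ε hε hε1 => by
            rw [hlin]
            exact h.symm.mem_space_left (convexHull_mono (hI.2.1.1 t ht.1)
              (openHull_subset_convexHull t (hmix ε hε hε1))))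
        rw [hlin] at h2
        have hcr := h.carrier_subset_of_notMem hc h0 hI ht.1 htK (hmix ε hε hε1) hr h2
        refine h.carrier_not_subset_map hc h0 hci h0s (subset_of_smul_mem h0 hr hsK hcr h1
          (q := q⁻¹) (by positivity) (inv_lt_one_of_one_lt₀ hq) ?_)
        rw [h.symm.map_smul, smul_smul, inv_mul_cancel₀ (by positivity), one_smul]
        exact h.symm.mem_convexHull_map.2 hz

lemma isCompatiblePair (h : IsFreeSumTriangulation i j a b P Q K) (ho : OriginInPart i K)
    (hI : IsInducedPair i j P Q K KP KQ) :
    IsCompatiblePair KP KQ (alphaMap i j K KQ) (betaMap i j K KP) := by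
  obtain ⟨c, hc, h0⟩ := h.exists_carrier
  have hci := (h.originInPart_iff hc h0).1 ho
  refine ⟨h.isWebOfStars_alphaMap hI, h.isWebOfStars_betaMap hc h0 hci hI, fun s hs t ht => ?_⟩
  have hsK := map_mem_of_mem_left hI hs.1
  by_cases h0t : (0 : F) ∈ t
  · rw [betaMap_of_zero_mem h0t]
    simpa using h.mem_alphaMap_of_zero_mem hs.2 hsK hI.2.1 (parts_subset hI) ht.1 h0t
  by_cases htK : t.map j ∈ K.faces
  · rw [betaMap_of_zero_notMem h0t]
    exact h.mem_alphaMap_iff_notMem hs.2 hsK ht.2 htK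
      (fun hz => h0t (mem_of_zero_mem_convexHull (h.singleton_zero_mem hI) ht.1 hz)) hI.1 hI.2.1
      hI.2.2.1.ge (parts_subset hI)
  · rw [h.betaMap_of_notMem hI ht.1 htK]
    -- A face in the filled region is covered by faces of `K` containing `c`, so it lies in the cone
    -- over every link.
    simp only [Set.mem_empty_iff_false, false_iff, not_not]
    obtain ⟨y, hy⟩ := openHull_nonempty (KQ.nonempty_of_mem_faces ht.1)
    have hyt := openHull_subset_convexHull t hy
    obtain ⟨r, hr, hyr⟩ := SimplicialComplex.mem_space_iff.1
      (h.symm.mem_space_left (convexHull_mono (hI.2.1.1 t ht.1) hyt))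
    have hcr := h.carrier_subset_of_notMem hc h0 hI ht.1 htK hy hr hyr
    have hmem := h.mem_linkCone_of_carrier_subset hc h0 hci hs.2 hsK hr hcr hyr
    obtain ⟨g, hg, hgL, h1, -⟩ := h.exists_isGauge_linkCone hs.2 hsK
    rw [h1] at hmem
    rw [alphaMap, h1]
    exact ⟨ht.1, convexHull_subset_of_mem_openHull hg
      ((linkIn_subset_parts _).trans (parts_subset hI)) hgL ht.1 hy hmem⟩

lemma map_union_mem_topFaces [DecidableEq V] (h : IsFreeSumTriangulation i j a b P Q K)
    {s : Finset E} {t : Finset F} (hst : s.map i ∪ t.map j ∈ K.faces)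
    (hd : Disjoint (t.map j) (s.map i)) (hc : s.card + t.card = finrank ℝ E + finrank ℝ F + 1) :
    s.map i ∪ t.map j ∈ topFaces K := by
  refine ⟨hst, ?_⟩
  rw [Finset.card_union_of_disjoint hd.symm, Finset.card_map, Finset.card_map, h.finrank_eq, hc]

/-- Each part has at most one vertex more than the dimension of its summand, so a top face of `K` is
full-dimensional in at least one of them. The other vertices form a link simplex of maximal size,
that is, a boundary facet. -/
lemma facetFormula (h : IsFreeSumTriangulation i j a b P Q K)
    (hI : IsInducedPair i j P Q K KP KQ) :
    FacetFormula i j K KP KQ (alphaMap i j K KQ) (betaMap i j K KP) := by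
  classical
  have hsum : ∀ (s : Finset E) (t : Finset F), sumSimplex i j s t = s.map i ∪ t.map j := by
    intro s t
    unfold sumSimplex
    congr
  ext r
  simp only [Set.mem_union, Set.mem_ofPred_eq, hsum]
  constructor
  · rintro ⟨hr, hrc⟩
    rw [h.finrank_eq] at hrc
    have hpi : (part i r).map i ⊆ r := IsDirectSum.part_map_subset r
    have hpj : (part j r).map j ⊆ r := IsDirectSum.part_map_subset r
    have hface : ∀ {u : Finset V}, u ⊆ r → 0 < u.card → u ∈ K.faces := fun hu hu0 =>
      K.down_closed hr hu (Finset.card_pos.1 hu0)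
    have hle : ∀ {s : Finset E}, s.map i ⊆ r → s.card ≤ finrank ℝ E + 1 := by
      intro s hs
      rcases s.eq_empty_or_nonempty with rfl | hsn
      · simp
      · exact card_le_of_affineIndependent
          (h.affineIndependent_of_map (K.indep (K.down_closed hr hs hsn.map)))
    have hle' : (part j r).card ≤ finrank ℝ F + 1 := by
      rcases (part j r).eq_empty_or_nonempty with he | hn
      · simp [he]
      · exact card_le_of_affineIndependent
          (h.symm.affineIndependent_of_map (K.indep (K.down_closed hr hpj hn.map)))
    have hunion : r = (part i r).map i ∪ (part j r).map j := by
      refine Finset.Subset.antisymm (fun v hv => ?_) (Finset.union_subset hpi hpj)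
      rcases h.mem_range_or hr hv with ⟨x, rfl⟩ | ⟨y, rfl⟩
      · exact Finset.mem_union_left _ (Finset.mem_map_of_mem i (IsDirectSum.mem_part.2 hv))
      · exact Finset.mem_union_right _ (Finset.mem_map_of_mem j (IsDirectSum.mem_part.2 hv))
    by_cases hsc : (part i r).card = finrank ℝ E + 1
    · left
      have hs : (part i r).map i ∈ K.faces := hface hpi (by rw [Finset.card_map]; omega)
      -- The vertex `0` belongs to both parts if it occurs; removing the first part counts it only
      -- once.
      set t := part j (r \ (part i r).map i) with ht
      have htr : t.map j ⊆ r \ (part i r).map i := IsDirectSum.part_map_subset _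
      have hd : Disjoint (t.map j) ((part i r).map i) :=
        Finset.disjoint_left.2 fun v hv => (Finset.mem_sdiff.1 (htr hv)).2
      have hr' : r = (part i r).map i ∪ t.map j := by
        refine Finset.Subset.antisymm (fun v hv => ?_)
          (Finset.union_subset hpi (htr.trans Finset.sdiff_subset))
        by_cases hv' : v ∈ (part i r).map i
        · exact Finset.mem_union_left _ hv'
        · refine Finset.mem_union_right _ ?_
          rcases h.mem_range_or hr hv with ⟨x, rfl⟩ | ⟨y, rfl⟩
          · exact absurd (Finset.mem_map_of_mem i (IsDirectSum.mem_part.2 hv)) hv'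
          · exact Finset.mem_map_of_mem j
              (IsDirectSum.mem_part.2 (Finset.mem_sdiff.2 ⟨hv, hv'⟩))
      have hcard := congrArg Finset.card hr'
      rw [Finset.card_union_of_disjoint hd.symm, Finset.card_map, Finset.card_map] at hcard
      refine ⟨part i r, ⟨?_, hsc⟩, t, ?_, hr'⟩
      · rw [hI.2.2.1]
        exact IsDirectSum.mem_parts.2 hs
      · rw [h.mem_boundaryFacets_alphaMap hsc hs hI.2.1 (parts_subset hI)]
        exact ⟨by omega, hd, hr' ▸ hr⟩
    · right
      have h1 := hle hpi
      have hcard := congrArg Finset.card hunion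
      have h2 := Finset.card_union_add_card_inter ((part i r).map i) ((part j r).map j)
      rw [← hcard, Finset.card_map, Finset.card_map] at h2
      -- With at most `finrank ℝ E` vertices in the first part, the count forces the second part to
      -- be full and the two to be disjoint, so `0` is not a vertex.
      have htc : (part j r).card = finrank ℝ F + 1 := by omega
      have hinter : (part i r).map i ∩ (part j r).map j = ∅ := by
        rw [← Finset.card_eq_zero]
        omega
      have h0t : (0 : F) ∉ part j r := by
        intro h0t
        have h3 : i 0 ∈ (part i r).map i ∩ (part j r).map j := by
          refine Finset.mem_inter.2 ⟨?_, ?_⟩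
          · refine Finset.mem_map_of_mem i (IsDirectSum.mem_part.2 ?_)
            rw [h.map_zero, ← h.symm.map_zero]
            exact IsDirectSum.mem_part.1 h0t
          · rw [h.map_zero, ← h.symm.map_zero]
            exact Finset.mem_map_of_mem j h0t
        rw [hinter] at h3
        simp at h3
      have ht : (part j r).map j ∈ K.faces := hface hpj (by rw [Finset.card_map]; omega)
      refine ⟨part j r, ⟨parts_subset hI (IsDirectSum.mem_parts.2 ht), htc⟩, ?_, part i r, ?_,
        hunion⟩
      · rw [betaMap_of_zero_notMem h0t]
        exact h.symm.alphaMap_ne_empty htc ht hI.1 hI.2.2.1.ge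
      · rw [betaMap_of_zero_notMem h0t,
          h.symm.mem_boundaryFacets_alphaMap htc ht hI.1 hI.2.2.1.ge]
        refine ⟨by omega, Finset.disjoint_iff_inter_eq_empty.2 hinter, ?_⟩
        rw [Finset.union_comm, ← hunion]
        exact hr
  · rintro (⟨s, hs, t, ht, rfl⟩ | ⟨t, ht, hne, s, hs, rfl⟩)
    · have hsK := map_mem_of_mem_left hI hs.1
      rw [h.mem_boundaryFacets_alphaMap hs.2 hsK hI.2.1 (parts_subset hI)] at ht
      exact h.map_union_mem_topFaces ht.2.2 ht.2.1 (by rw [hs.2, ht.1]; ring)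
    · have h0t : (0 : F) ∉ t := fun h0t => hne (betaMap_of_zero_mem h0t)
      have htK : t.map j ∈ K.faces := by
        by_contra htK
        exact hne (h.betaMap_of_notMem hI ht.1 htK)
      rw [betaMap_of_zero_notMem h0t,
        h.symm.mem_boundaryFacets_alphaMap ht.2 htK hI.1 hI.2.2.1.ge] at hs
      refine h.map_union_mem_topFaces ?_ hs.2.1.symm (by rw [ht.2, hs.1]; ring)
      rw [Finset.union_comm]
      exact hs.2.2

/-- A simplex `s` around `0` contains `c`, so contracting a point of its link leads only to faces
containing `c`. A second part with this property has the vertex `0`, and the remaining faces lie in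
the star by conicality. -/
lemma alphaMap_eq_starAt (h : IsFreeSumTriangulation i j a b P Q K) (ho : OriginInPart i K)
    (hI : IsInducedPair i j P Q K KP KQ) (hcone : IsConed j K KQ) {s : Finset E}
    (hs : s ∈ topFaces KP) (hs0 : s ∈ starAt KP 0) : alphaMap i j K KQ s = starAt KQ 0 := by
  classical
  obtain ⟨c, hc, h0⟩ := h.exists_carrier
  have hci := (h.originInPart_iff hc h0).1 ho
  have hsK := map_mem_of_mem_left hI hs.1
  have h0s : (0 : E) ∈ convexHull ℝ (s : Set E) := by
    obtain ⟨-, s', hs', h0s', hss'⟩ := hs0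
    have h1 := card_le_of_affineIndependent (KP.indep hs')
    rwa [Finset.eq_of_subset_of_card_le hss' (by rw [hs.2]; exact h1)]
  have hcs : c ⊆ s.map i := by
    refine subset_of_mem_openHull hc hsK h0 ?_
    rw [← h.map_zero]
    exact h.mem_convexHull_map.2 h0s
  have hzero := h.singleton_zero_mem hI
  ext t
  constructor
  · rintro ⟨ht, htsub⟩
    have htn := KQ.nonempty_of_mem_faces ht
    rcases hcone t ht with htp | hst
    swap
    · exact hst
    have htK := IsDirectSum.mem_parts.1 htp
    have hstar : (0 : F) ∈ t → t ∈ starAt KQ 0 := fun h0t =>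
      ⟨htn, t, ht, subset_convexHull ℝ _ h0t, Finset.Subset.refl t⟩
    obtain ⟨y, hy⟩ := openHull_nonempty htn
    obtain ⟨g, hg, hgL, h1, h2⟩ := h.exists_isGauge_linkCone hs.2 hsK
    have hgy : g y ≤ 1 := by
      have := htsub (openHull_subset_convexHull t hy)
      rwa [h1] at this
    by_cases hy0 : y = 0
    · refine hstar (mem_of_zero_mem_convexHull hzero ht ?_)
      rw [← hy0]
      exact openHull_subset_convexHull t hy
    obtain ⟨u, hu, hyu⟩ := mem_body.1 ((hgL _).1 (hg.map_inv_smul hy0))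
    obtain ⟨-, hud, huK⟩ := mem_linkIn.1 hu
    have hyu' : j ((g y)⁻¹ • y) ∈ convexHull ℝ ((s.map i ∪ u.map j : Finset V) : Set V) :=
      convexHull_mono (Finset.coe_subset.2 Finset.subset_union_right)
        (h.symm.mem_convexHull_map.2 hyu)
    have hyj : j y = g y • j ((g y)⁻¹ • y) := by
      rw [h.symm.map_smul, smul_smul, mul_inv_cancel₀ (hg.ne_zero hy0), one_smul]
    have hcu : c ⊆ s.map i ∪ u.map j := hcs.trans Finset.subset_union_left
    rcases hgy.lt_or_eq with hlt | heq
    · refine hstar ?_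
      by_contra h0t
      refine h.carrier_not_subset_map hc h0 hci h0t (subset_of_smul_mem h0 huK htK hcu hyu'
        (hg.nonneg y) hlt ?_)
      rw [← hyj]
      exact h.symm.mem_convexHull_map.2 (openHull_subset_convexHull t hy)
    -- On the sphere itself `t` need not contain `0`. A step towards the origin enters a face `t1`
    -- containing `t`, to which the contraction argument applies unless `t1` is in the star already.
    · rw [heq, inv_one, one_smul] at hyu'
      have hspace : ∀ ε : ℝ, 0 < ε → ε < 1 → y + ε • (-y) ∈ KQ.space := by
        intro ε hε hε1
        rw [hI.2.1.2]
        have := (convex_convexHull ℝ Q).smul_mem_of_zero_mem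
          (subset_convexHull ℝ Q h.zero_right) (convexHull_mono (hI.2.1.1 t ht)
          (openHull_subset_convexHull t hy)) (t := 1 - ε) ⟨by linarith, by linarith⟩
        convert this using 1
        module
      obtain ⟨t1, ht1, ε, hε, hε1, k1, k2⟩ := exists_face_along
        (faces_finite_of_subset h.finite_right hI.2.1.1) one_pos hspace
      have htt1 := subset_of_mem_openHull ht ht1 hy k1
      rcases hcone t1 ht1 with ht1p | ⟨-, t2, ht2, h0t2, ht12⟩
      · have hkey : (0 : F) ∈ t1 := by
          by_contra h0t1
          refine h.carrier_not_subset_map hc h0 hci h0t1 (subset_of_smul_mem h0 huK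
            (IsDirectSum.mem_parts.1 ht1p) hcu hyu' (q := 1 - ε) (by linarith) (by linarith) ?_)
          rw [← h.symm.map_smul]
          refine h.symm.mem_convexHull_map.2 ?_
          convert k2 using 1
          module
        exact ⟨htn, t1, ht1, subset_convexHull ℝ _ hkey, htt1⟩
      · exact ⟨htn, t2, ht2, h0t2, htt1.trans ht12⟩
  · rintro ⟨htn, t1, ht1, h0t1, htt1⟩
    have := h.mem_alphaMap_of_zero_mem hs.2 hsK hI.2.1 (parts_subset hI) ht1
      (mem_of_zero_mem_convexHull hzero ht1 h0t1)
    exact ⟨KQ.down_closed ht1 htt1 htn,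
      (convexHull_mono (Finset.coe_subset.2 htt1)).trans this.2⟩

/-- Every pair of induced triangulations yields a compatible pair of webs of stars describing the
triangulation of the free sum, which is a sum-triangulation in the conically induced case. -/
lemma induced_spec (h : IsFreeSumTriangulation i j a b P Q K) (ho : OriginInPart i K)
    (hI : IsInducedPair i j P Q K KP KQ) :
    IsCompatiblePair KP KQ (alphaMap i j K KQ) (betaMap i j K KP) ∧
      FacetFormula i j K KP KQ (alphaMap i j K KQ) (betaMap i j K KP) ∧
      (IsConed j K KQ →
        IsSumTriangulationVia i j K KP KQ (alphaMap i j K KQ) (betaMap i j K KP)) :=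
  have h1 := h.isCompatiblePair ho hI
  have h2 := h.facetFormula hI
  ⟨h1, h2, fun hcone => ⟨h1, fun _ hs hs0 => h.alphaMap_eq_starAt ho hI hcone hs hs0, h2⟩⟩

lemma originInPart_or (h : IsFreeSumTriangulation i j a b P Q K) :
    OriginInPart i K ∨ OriginInPart j K := by
  obtain ⟨c, hc, h0⟩ := h.exists_carrier
  rw [h.originInPart_iff hc h0, h.symm.originInPart_iff hc h0]
  exact h.carrier_subset_range_or hc h0

end IsFreeSumTriangulation

lemma isFreeSumTriangulation_freeSum {P : Set E} {Q : Set F} {K : SimplicialComplex ℝ (E × F)}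
    (hPf : P.Finite) (hQf : Q.Finite) (hP : 0 ∈ P) (hPint : 0 ∈ interior (convexHull ℝ P))
    (hQ : 0 ∈ Q) (hQint : 0 ∈ interior (convexHull ℝ Q))
    (hK : IsTriangulation (freeSum P Q) K) :
    IsFreeSumTriangulation inP inQ (LinearMap.fst ℝ E F) (LinearMap.snd ℝ E F) P Q K where
  fst_inl _ := rfl
  fst_inr _ := rfl
  snd_inl _ := rfl
  snd_inr _ := rfl
  sum_eq v := Prod.ext (add_zero v.1) (zero_add v.2)
  finite_left := hPf
  finite_right := hQf
  zero_left := hP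
  zero_right := hQ
  interior_left := hPint
  interior_right := hQint
  vertices_subset := hK.1
  space_eq := hK.2

end Induced

end FreeSum

/-! ### Assembly: both summands are treated by one symmetric statement. -/

theorem mainTheorem1 (d e : ℕ)
    (P : Finset (EuclideanSpace ℝ (Fin d))) (Q : Finset (EuclideanSpace ℝ (Fin e)))
    (hP : 0 ∈ P) (hPint : 0 ∈ interior (convexHull ℝ (P : Set (EuclideanSpace ℝ (Fin d)))))
    (hQ : 0 ∈ Q) (hQint : 0 ∈ interior (convexHull ℝ (Q : Set (EuclideanSpace ℝ (Fin e)))))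
    (K : Geometry.SimplicialComplex ℝ (EuclideanSpace ℝ (Fin d) × EuclideanSpace ℝ (Fin e)))
    (hK : FreeSum.IsTriangulation
      (FreeSum.freeSum (P : Set (EuclideanSpace ℝ (Fin d))) (Q : Set (EuclideanSpace ℝ (Fin e))))
      K) :
    -- The origin lies in the P-part or in the Q-part
    (FreeSum.OriginInPart FreeSum.inP K ∨ FreeSum.OriginInPart FreeSum.inQ K) ∧
    -- The origin lies in the P-part
    (FreeSum.OriginInPart FreeSum.inP K →
      (∃ KP KQ, FreeSum.IsInducedPair FreeSum.inP FreeSum.inQ P Q K KP KQ ∧ FreeSum.IsConed FreeSum.inQ K KQ) ∧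
      ∀ KP KQ, FreeSum.IsInducedPair FreeSum.inP FreeSum.inQ P Q K KP KQ →
        FreeSum.IsCompatiblePair KP KQ
          (FreeSum.alphaMap FreeSum.inP FreeSum.inQ K KQ) (FreeSum.betaMap FreeSum.inP FreeSum.inQ K KP) ∧
        FreeSum.FacetFormula FreeSum.inP FreeSum.inQ K KP KQ
          (FreeSum.alphaMap FreeSum.inP FreeSum.inQ K KQ) (FreeSum.betaMap FreeSum.inP FreeSum.inQ K KP) ∧
        (FreeSum.IsConed FreeSum.inQ K KQ →
          FreeSum.IsSumTriangulationVia FreeSum.inP FreeSum.inQ K KP KQ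
            (FreeSum.alphaMap FreeSum.inP FreeSum.inQ K KQ) (FreeSum.betaMap FreeSum.inP FreeSum.inQ K KP))) ∧
    -- The origin lies in the Q-part: the same with the roles of P and Q interchanged
    (FreeSum.OriginInPart FreeSum.inQ K →
      (∃ KQ KP, FreeSum.IsInducedPair FreeSum.inQ FreeSum.inP Q P K KQ KP ∧ FreeSum.IsConed FreeSum.inP K KP) ∧
      ∀ KQ KP, FreeSum.IsInducedPair FreeSum.inQ FreeSum.inP Q P K KQ KP →
        FreeSum.IsCompatiblePair KQ KP
          (FreeSum.alphaMap FreeSum.inQ FreeSum.inP K KP) (FreeSum.betaMap FreeSum.inQ FreeSum.inP K KQ) ∧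
        FreeSum.FacetFormula FreeSum.inQ FreeSum.inP K KQ KP
          (FreeSum.alphaMap FreeSum.inQ FreeSum.inP K KP) (FreeSum.betaMap FreeSum.inQ FreeSum.inP K KQ) ∧
        (FreeSum.IsConed FreeSum.inP K KP →
          FreeSum.IsSumTriangulationVia FreeSum.inQ FreeSum.inP K KQ KP
            (FreeSum.alphaMap FreeSum.inQ FreeSum.inP K KP) (FreeSum.betaMap FreeSum.inQ FreeSum.inP K KQ))) ∧
    -- Every triangulation of the free sum is a P- or Q-sum-triangulation
    ∃ KP KQ, FreeSum.IsTriangulation (P : Set (EuclideanSpace ℝ (Fin d))) KP ∧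
      FreeSum.IsTriangulation (Q : Set (EuclideanSpace ℝ (Fin e))) KQ ∧
      (FreeSum.IsSumTriangulation FreeSum.inP FreeSum.inQ K KP KQ ∨ FreeSum.IsSumTriangulation FreeSum.inQ FreeSum.inP K KQ KP) := by
  have h := FreeSum.isFreeSumTriangulation_freeSum P.finite_toSet Q.finite_toSet (by simpa using hP)
    hPint (by simpa using hQ) hQint hK
  refine ⟨h.originInPart_or,
    fun ho => ⟨h.exists_isInducedPair ho, fun KP KQ hI => h.induced_spec ho hI⟩,
    fun ho => ⟨h.symm.exists_isInducedPair ho, fun KQ KP hI => h.symm.induced_spec ho hI⟩, ?_⟩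
  rcases h.originInPart_or with ho | ho
  · obtain ⟨KP, KQ, hI, hc⟩ := h.exists_isInducedPair ho
    exact ⟨KP, KQ, hI.1, hI.2.1, Or.inl ⟨_, _, (h.induced_spec ho hI).2.2 hc⟩⟩
  · obtain ⟨KQ, KP, hI, hc⟩ := h.symm.exists_isInducedPair ho
    exact ⟨KP, KQ, hI.2.1, hI.1, Or.inr ⟨_, _, (h.symm.induced_spec ho hI).2.2 hc⟩⟩
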